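/- **Theorem (classifying property of the twisted spherical quotient).** *Conventions.* A diffeological group is a group with a diffeology for which multiplication and inversion are smooth. All products, subsets and quotients carry the product, subset and quotient diffeologies. Two smooth maps $f,g:X\to Y$ are smoothly homotopic if there is a smooth map $F:X\times\mathbb R\to Y$ with $F(\cdot,0)=f$ and $F(\cdot,1)=g$; $[X,Y]^\infty$ denotes the set of smooth homotopy classes of smooth maps. A diffeological space is smoothly contractible if its identity map is smoothly homotopic to a constant map. For a diffeological group $H$, a principal $H$-bundle over $X$ is a diffeological space $P$ with a smooth (left) $H$-action and an $H$-invariant subduction $\pi:P\to X$ such that $(p,h)\mapsto(p,h\cdot p)$ is a diffeomorphism of $P\times H$ onto $P\times_XP$. Isomorphisms are equivariant diffeomorphisms over $X$. The bundle is $D$-numerable if there are a cover $(U_i)$ of $X$ by $D$-open sets over each of which $P$ is trivial (equivariantly diffeomorphic over $U_i$ to $U_i\times H$), and smooth functions $\lambda_i:X\to[0,\infty)$ whose supports form a locally finite family (for the $D$-topology), with $\overline{\{\lambda_i\ne0\}}\subset U_i$ and $\sum_i\lambda_i=1$. Let $G$ be a diffeological group. Let $\widetilde E^{\mathrm{sph}}(G)$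 be the set of pairs of sequences $(x_i,g_i)_{i\in\mathbb N}$ with $x_i\in\mathbb R$, only finitely many $x_i$ non-zero, $\sum_ix_i^2=1$ and $g_i\in G$, with the final diffeology generated by the maps $S_I\times G^I\to\widetilde E^{\mathrm{sph}}(G)$, $I\subset\mathbb N$ finite, that extend by $x_i=0$, $g_i=1$ for $i\notin I$; here $S_I=\{x\in\mathbb R^I:\sum_{i\in I}x_i^2=1\}$ has the subset diffeology. Let $E^{\mathrm{sph}}(G)$ be its quotient by the relation $(x_i,g_i)\sim(x_i,g_i')$ iff $g_i=g_i'$ whenever $x_i\neq0$. Let $\sigma:\mathbb Z_2=\{\pm1\}\to\operatorname{Aut}(G)$ be a smooth action ($\mathbb Z_2$ discrete), let $H_\sigma=G\rtimes_\sigma\mathbb Z_2$, with the product diffeology, act on $E^{\mathrm{sph}}(G)$ by $$(h,\varepsilon)\cdot[(x_i,g_i)]=[(\varepsilon x_i,\ h\,\sigma^\varepsilon(g_i))],$$ and put $B^{\mathrm{sph}}_\sigma(G)=E^{\mathrm{sph}}(G)/H_\sigma$ with the quotient diffeology. *Statement.* Assume that $E^{\mathrm{sph}}(G)$ is smoothly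 contractible and that the action of $H_\sigma$ on $E^{\mathrm{sph}}(G)$ is smooth and free. Then the quotient projection $\pi:E^{\mathrm{sph}}(G)\to B^{\mathrm{sph}}_\sigma(G)$ is a principal $H_\sigma$-bundle. Moreover it is universal for $D$-numerable principal $H_\sigma$-bundles: for every diffeological space $X$, the pull-back $f^*E^{\mathrm{sph}}(G)$ along every smooth map $f:X\to B^{\mathrm{sph}}_\sigma(G)$ is a $D$-numerable principal $H_\sigma$-bundle over $X$, and $[f]\mapsto[f^*E^{\mathrm{sph}}(G)]$ is a well-defined bijection from $[X,B^{\mathrm{sph}}_\sigma(G)]^\infty$ onto the set of isomorphism classes of $D$-numerable principal $H_\sigma$-bundles over $X$. -/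

import Mathlib

open Diffeology Topology

universe u v w

namespace SphMilnor

/-! ### Basic constructions on diffeological spaces -/

/-- The initial (pull-back) diffeology along a map `f : X → Y`: a parametrization `p` of `X` is a
plot if and only if `f ∘ p` is a plot of `Y`. -/
@[reducible]
def inducedDiffeology {X : Type u} {Y : Type v} [DiffeologicalSpace Y] (f : X → Y) :
    DiffeologicalSpace X where
  plots n := {p | IsPlot (fun a : EuclideanSpace ℝ (Fin n) => f (p a))}
  constant_plots x := isPlot_const (x := f x)
  plot_reparam hp hf := isPlot_reparam hp hf
  locality hp := DiffeologicalSpace.locality hp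

/-- The subset diffeology. -/
instance instSubtype {X : Type u} [DiffeologicalSpace X] (s : X → Prop) :
    DiffeologicalSpace (Subtype s) :=
  inducedDiffeology Subtype.val

/-- The product diffeology on `X × Y`. -/
instance instProd {X : Type u} {Y : Type v} [DiffeologicalSpace X] [DiffeologicalSpace Y] :
    DiffeologicalSpace (X × Y) :=
  inducedDiffeology Prod.fst ⊓ inducedDiffeology Prod.snd

/-- The product diffeology on a family of spaces. -/
instance instPi {ι : Type u} {X : ι → Type v} [∀ i, DiffeologicalSpace (X i)] :
    DiffeologicalSpace (∀ i, X i) :=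
  ⨅ i, inducedDiffeology (fun x => x i)

/-- The final diffeology for a family of maps `f i : X i → Y`: the finest diffeology on `Y` making
all of the maps smooth. -/
@[reducible]
def finalDiffeology {ι : Type u} {X : ι → Type v} {Y : Type w} [∀ i, DiffeologicalSpace (X i)]
    (f : ∀ i, X i → Y) : DiffeologicalSpace Y :=
  DiffeologicalSpace.generateFrom
    {q | ∃ (i : ι) (p : EuclideanSpace ℝ (Fin q.1) → X i), IsPlot p ∧ q.2 = fun a => f i (p a)}

/-- The quotient (push-forward) diffeology along a single map `f : X → Y`. -/
@[reducible]
def coinducedDiffeology {X : Type v} {Y : Type w} [DiffeologicalSpace X] (f : X → Y) :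
    DiffeologicalSpace Y :=
  finalDiffeology (fun _ : Unit => f)

/-- The quotient diffeology. -/
instance instQuotient {X : Type u} [DiffeologicalSpace X] (s : Setoid X) :
    DiffeologicalSpace (Quotient s) :=
  coinducedDiffeology (Quotient.mk s)

/-- A subduction: a surjection whose target carries the push-forward diffeology. -/
def IsSubduction {X : Type u} {Y : Type v} [DiffeologicalSpace X] [dY : DiffeologicalSpace Y]
    (f : X → Y) : Prop :=
  Function.Surjective f ∧ coinducedDiffeology f = dY

/-- A diffeomorphism. -/
structure IsDiffeo {X : Type u} {Y : Type v} [DiffeologicalSpace X] [DiffeologicalSpace Y]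
    (e : X ≃ Y) : Prop where
  smooth : DSmooth e
  smooth_symm : DSmooth e.symm

/-- A diffeological group: multiplication and inversion are smooth. -/
class DiffeologicalGroup (G : Type u) [Group G] [DiffeologicalSpace G] : Prop where
  smooth_mul : DSmooth (fun a : G × G => a.1 * a.2)
  smooth_inv : DSmooth (fun a : G => a⁻¹)

/-! ### Smooth homotopy -/

/-- Smooth maps `X → Y`. -/
def DMap (X : Type u) (Y : Type v) [DiffeologicalSpace X] [DiffeologicalSpace Y] :
    Type (max u v) :=
  {f : X → Y // DSmooth f}

/-- Two maps are smoothly homotopic if they are the restrictions to the times `0` and `1` of one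
smooth map `X × ℝ → Y`. -/
def SmoothlyHomotopic {X : Type u} {Y : Type v} [DiffeologicalSpace X] [DiffeologicalSpace Y]
    (f g : X → Y) : Prop :=
  ∃ F : X × ℝ → Y, DSmooth F ∧ (∀ x, F (x, 0) = f x) ∧ ∀ x, F (x, 1) = g x

/-- `X` is smoothly contractible: its identity is smoothly homotopic to a constant map. -/
def SmoothlyContractible (X : Type u) [DiffeologicalSpace X] : Prop :=
  ∃ x₀ : X, SmoothlyHomotopic (fun x : X => x) (fun _ => x₀)

section HomotopyEquivalence

variable {X : Type u} {Y : Type v} {Z : Type w} [DiffeologicalSpace X] [DiffeologicalSpace Y]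
  [DiffeologicalSpace Z]

theorem isPlot_prod_iff {n : ℕ} {p : EuclideanSpace ℝ (Fin n) → X × Y} :
    IsPlot p ↔ IsPlot (fun a => (p a).1) ∧ IsPlot (fun a => (p a).2) :=
  DiffeologicalSpace.isPlot_inf_iff

theorem dSmooth_fst : DSmooth (Prod.fst : X × Y → X) :=
  fun _ _ hp => (isPlot_prod_iff.1 hp).1

theorem dSmooth_snd : DSmooth (Prod.snd : X × Y → Y) :=
  fun _ _ hp => (isPlot_prod_iff.1 hp).2

theorem dSmooth_pair {f : Z → X} {g : Z → Y} (hf : DSmooth f) (hg : DSmooth g) :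
    DSmooth (fun z => (f z, g z)) :=
  fun n p hp => isPlot_prod_iff.2 ⟨hf n p hp, hg n p hp⟩

theorem dSmooth_reparam {F : X × ℝ → Y} (hF : DSmooth F) {τ : ℝ → ℝ}
    (hτ : ContDiff ℝ (⊤ : ℕ∞) τ) : DSmooth (fun a : X × ℝ => F (a.1, τ a.2)) :=
  hF.comp (dSmooth_pair dSmooth_fst (hτ.dSmooth.comp dSmooth_snd))

theorem smoothlyHomotopic_refl {f : X → Y} (hf : DSmooth f) : SmoothlyHomotopic f f :=
  ⟨fun a => f a.1, hf.comp dSmooth_fst, fun _ => rfl, fun _ => rfl⟩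

theorem SmoothlyHomotopic.symm {f g : X → Y} (h : SmoothlyHomotopic f g) :
    SmoothlyHomotopic g f := by
  obtain ⟨F, hF, h0, h1⟩ := h
  refine ⟨fun a => F (a.1, 1 - a.2), dSmooth_reparam hF (τ := fun t => 1 - t) (by fun_prop),
    fun x => ?_, fun x => ?_⟩
  · simpa using h1 x
  · simpa using h0 x

theorem SmoothlyHomotopic.trans {f g h : X → Y} (h₁ : SmoothlyHomotopic f g)
    (h₂ : SmoothlyHomotopic g h) : SmoothlyHomotopic f h := by
  obtain ⟨F, hF, F0, F1⟩ := h₁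
  obtain ⟨K, hK, K0, K1⟩ := h₂
  have hs : ContDiff ℝ (⊤ : ℕ∞) Real.smoothTransition := Real.smoothTransition.contDiff
  have hF' : DSmooth (fun a : X × ℝ => F (a.1, Real.smoothTransition (3 * a.2))) :=
    dSmooth_reparam hF (τ := fun t => Real.smoothTransition (3 * t))
      (hs.comp (by fun_prop))
  have hK' : DSmooth (fun a : X × ℝ => K (a.1, Real.smoothTransition (3 * a.2 - 2))) :=
    dSmooth_reparam hK (τ := fun t => Real.smoothTransition (3 * t - 2))
      (hs.comp (by fun_prop))
  refine ⟨fun a => if a.2 < 1 / 2 then F (a.1, Real.smoothTransition (3 * a.2))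
    else K (a.1, Real.smoothTransition (3 * a.2 - 2)), ?_, fun x => ?_, fun x => ?_⟩
  · intro n p hp
    have hc : Continuous (fun a => (p a).2) := by
      have := (isPlot_prod_iff.1 hp).2
      exact (IsPlot.contDiff this).continuous
    refine DiffeologicalSpace.locality fun a => ?_
    by_cases ha : (p a).2 < 1 / 2
    · refine ⟨{b | (p b).2 < 1 / 2}, isOpen_lt hc continuous_const, ha, ?_⟩
      intro m φ hφ hφ'
      have hq : IsPlot ((fun a : X × ℝ => F (a.1, Real.smoothTransition (3 * a.2))) ∘ (p ∘ φ)) :=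
        hF' _ _ (isPlot_reparam hp hφ')
      refine Set.mem_of_eq_of_mem (funext fun b => ?_) hq
      exact if_pos (hφ b)
    · refine ⟨{b | 1 / 3 < (p b).2}, isOpen_lt continuous_const hc, ?_, ?_⟩
      · change 1 / 3 < (p a).2
        linarith
      intro m φ hφ hφ'
      have hq : IsPlot ((fun a : X × ℝ => K (a.1, Real.smoothTransition (3 * a.2 - 2))) ∘ (p ∘ φ)) :=
        hK' _ _ (isPlot_reparam hp hφ')
      refine Set.mem_of_eq_of_mem (funext fun b => ?_) hq
      have hb : 1 / 3 < (p (φ b)).2 := hφ b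
      simp only [Function.comp]
      split_ifs with hlt
      · rw [Real.smoothTransition.one_of_one_le (by linarith),
          Real.smoothTransition.zero_of_nonpos (by linarith), F1, K0]
      · rfl
  · have h0 : Real.smoothTransition (3 * (0 : ℝ)) = 0 :=
      Real.smoothTransition.zero_of_nonpos (by norm_num)
    simp only [h0, F0]
    norm_num
  · have h1 : Real.smoothTransition (3 * (1 : ℝ) - 2) = 1 :=
      Real.smoothTransition.one_of_one_le (by norm_num)
    simp only [h1, K1]
    norm_num

end HomotopyEquivalence

/-- Smooth homotopy as an equivalence relation on smooth maps. -/
instance homotopySetoid (X : Type u) (Y : Type v) [DiffeologicalSpace X] [DiffeologicalSpace Y] :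
    Setoid (DMap X Y) where
  r f g := SmoothlyHomotopic f.1 g.1
  iseqv := ⟨fun f => smoothlyHomotopic_refl f.2, fun h => h.symm, fun h k => h.trans k⟩

/-- The set of smooth homotopy classes of smooth maps `X → Y`. -/
def SmoothHomotopyClasses (X : Type u) (Y : Type v) [DiffeologicalSpace X]
    [DiffeologicalSpace Y] : Type (max u v) :=
  Quotient (homotopySetoid X Y)

/-! ### Principal bundles -/

/-- A diffeological space with an action of `H` by (set-theoretic) fibre-preserving bijections,
over the base `X`. -/
structure HSpaceOver (H : Type u) [Group H] (X : Type v) where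
  /-- the total space -/
  Total : Type w
  [diff : DiffeologicalSpace Total]
  [act : MulAction H Total]
  /-- the projection -/
  proj : Total → X
  proj_smul : ∀ (h : H) (p : Total), proj (h • p) = proj p

attribute [instance] HSpaceOver.diff HSpaceOver.act

namespace HSpaceOver

variable {H : Type u} [Group H] [DiffeologicalSpace H] {X : Type v} [DiffeologicalSpace X]

/-- `P → X` is a diffeological principal `H`-bundle: the action is smooth, the projection is a
subduction, and `(p, h) ↦ (p, h • p)` is a diffeomorphism from `P × H` onto the fibre product
`P ×_X P`. -/
structure IsPrincipal (P : HSpaceOver.{u, v, w} H X) : Prop where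
  smooth_smul : DSmooth (fun a : H × P.Total => a.1 • a.2)
  subduction : IsSubduction P.proj
  diffeo : ∃ e : P.Total × H ≃ {q : P.Total × P.Total // P.proj q.1 = P.proj q.2},
    IsDiffeo e ∧ ∀ p h, (e (p, h)).1 = (p, h • p)

/-- `P` is trivial over `U`: there is an `H`-equivariant diffeomorphism over `U` from `U × H`
(with `H` acting by left translation of the second factor) to the restriction of `P` to `U`. -/
def IsTrivialOver (P : HSpaceOver.{u, v, w} H X) (U : Set X) : Prop :=
  ∃ e : {x : X // x ∈ U} × H ≃ {p : P.Total // P.proj p ∈ U},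
    IsDiffeo e ∧ (∀ x h, P.proj (e (x, h)).1 = x.1) ∧
      ∀ x h k, (e (x, h * k)).1 = h • (e (x, k)).1

/-- A smooth partition of unity `l` subordinate to the open cover `U`, with respect to the
D-topology of `X`: the functions are smooth and non-negative, the closed support of `l i` lies in
`U i`, the family is locally finite, and the sum is `1` everywhere. -/
structure IsSmoothPartition {ι : Type v} (U : ι → Set X) (l : ι → X → ℝ) : Prop where
  isOpen : ∀ i, IsOpen[dTopology] (U i)
  cover : ∀ x, ∃ i, x ∈ U i
  smooth : ∀ i, DSmooth (l i)
  nonneg : ∀ i x, 0 ≤ l i x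
  support_subset : ∀ i, closure[dTopology] (Function.support (l i)) ⊆ U i
  locallyFinite : ∀ x, ∃ W : Set X, IsOpen[dTopology] W ∧ x ∈ W ∧
    {i | (Function.support (l i) ∩ W).Nonempty}.Finite
  sum_eq_one : ∀ x, ∑ᶠ i, l i x = 1

/-- `P` is D-numerable: it is trivial over the members of some D-open cover of the base which
admits a subordinate smooth partition of unity. -/
def IsDNumerable (P : HSpaceOver.{u, v, w} H X) : Prop :=
  ∃ (ι : Type v) (U : ι → Set X) (l : ι → X → ℝ),
    IsSmoothPartition U l ∧ ∀ i, P.IsTrivialOver (U i)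

/-- Isomorphism over `X`: an equivariant diffeomorphism commuting with the projections. -/
def Iso (P Q : HSpaceOver.{u, v, w} H X) : Prop :=
  ∃ e : P.Total ≃ Q.Total, IsDiffeo e ∧ (∀ (h : H) p, e (h • p) = h • e p) ∧
    ∀ p, Q.proj (e p) = P.proj p

/-- The pull-back `f^* P = {(x, p) | f x = proj p}` of `P → Y` along `f : X → Y`, with the subset
diffeology of the product and the action on the second coordinate. -/
@[reducible]
def pullback {Y : Type w} (P : HSpaceOver.{u, w, u} H Y) (f : X → Y) :
    HSpaceOver.{u, v, max u v} H X where
  Total := {a : X × P.Total // f a.1 = P.proj a.2}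
  act :=
    { smul := fun h a => ⟨(a.1.1, h • a.1.2), by rw [P.proj_smul]; exact a.2⟩
      one_smul := fun a => Subtype.ext (Prod.ext rfl (one_smul H a.1.2))
      mul_smul := fun h k a => Subtype.ext (Prod.ext rfl (mul_smul h k a.1.2)) }
  proj a := a.1.1
  proj_smul _ _ := rfl

end HSpaceOver

/-- D-numerable principal `H`-bundles over `X`. -/
def DNumerableBundle (H : Type u) [Group H] [DiffeologicalSpace H] (X : Type v)
    [DiffeologicalSpace X] : Type (max u v (w + 1)) :=
  {P : HSpaceOver.{u, v, w} H X // P.IsPrincipal ∧ P.IsDNumerable}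

/-- Isomorphism as an equivalence relation on D-numerable principal bundles. -/
instance isoSetoid (H : Type u) [Group H] [DiffeologicalSpace H] (X : Type v)
    [DiffeologicalSpace X] : Setoid (DNumerableBundle.{u, v, w} H X) where
  r P Q := P.1.Iso Q.1
  iseqv :=
    { refl := fun P => ⟨Equiv.refl _, ⟨dSmooth_id, dSmooth_id⟩, fun _ _ => rfl, fun _ => rfl⟩
      symm := by
        rintro P Q ⟨e, he, h1, h2⟩
        refine ⟨e.symm, ⟨he.2, he.1⟩, fun h p => ?_, fun p => ?_⟩
        · rw [Equiv.symm_apply_eq, h1, Equiv.apply_symm_apply]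
        · rw [← h2, Equiv.apply_symm_apply]
      trans := by
        rintro P Q R ⟨e, he, h1, h2⟩ ⟨e', he', h1', h2'⟩
        refine ⟨e.trans e', ⟨he'.1.comp he.1, he.2.comp he'.2⟩, fun h p => ?_, fun p => ?_⟩
        · simp [h1, h1']
        · simp [h2, h2'] }

/-- Isomorphism classes of D-numerable principal `H`-bundles over `X`. -/
def IsoClasses (H : Type u) [Group H] [DiffeologicalSpace H] (X : Type v)
    [DiffeologicalSpace X] : Type (max u v (w + 1)) :=
  Quotient (isoSetoid.{u, v, w} H X)

/-! ### The spherical Milnor model -/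

/-- The finite-dimensional unit sphere in `ℝ^I`, with the subset diffeology. -/
abbrev Sphere (I : Finset ℕ) : Type :=
  {x : EuclideanSpace ℝ I // ∑ i, x i ^ 2 = 1}

/-- Labelled points of the infinite sphere: finitely supported `x` with `∑ x_i ^ 2 = 1`, together
with group labels `g_i`. -/
@[ext]
structure PreE (G : Type u) where
  /-- spherical coordinates -/
  x : ℕ →₀ ℝ
  /-- group labels -/
  g : ℕ → G
  sum_sq : (x.sum fun _ t => t ^ 2) = 1

/-- The chart `S_I × G^I → PreE G`; coordinates outside `I` are `0`, labelled by `1`. -/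
noncomputable def chart (G : Type u) [Group G] (I : Finset ℕ) (a : Sphere I × (I → G)) :
    PreE G where
  x := Finsupp.onFinset I (fun i => if h : i ∈ I then a.1.1 ⟨i, h⟩ else 0)
    (fun i hi => by by_contra h; simp [h] at hi)
  g := fun i => if h : i ∈ I then a.2 ⟨i, h⟩ else 1
  sum_sq := by
    rw [Finsupp.onFinset_sum _ (fun _ => by simp), ← Finset.sum_coe_sort I]
    refine Eq.trans (Finset.sum_congr rfl fun i _ => by simp) a.1.2

/-- The final diffeology generated by the charts. -/
noncomputable instance instPreE (G : Type u) [Group G] [DiffeologicalSpace G] :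
    DiffeologicalSpace (PreE G) :=
  finalDiffeology (chart G)

/-- Two labelled points are identified if they have the same coordinates and the same labels at
the non-zero coordinates. -/
instance preESetoid (G : Type u) : Setoid (PreE G) where
  r a b := a.x = b.x ∧ ∀ i, a.x i ≠ 0 → a.g i = b.g i
  iseqv :=
    { refl := fun _ => ⟨rfl, fun _ _ => rfl⟩
      symm := fun h => ⟨h.1.symm, fun i hi => (h.2 i (by rw [h.1]; exact hi)).symm⟩
      trans := fun h k => ⟨h.1.trans k.1, fun i hi =>
        (h.2 i hi).trans (k.2 i (by rw [← h.1]; exact hi))⟩ }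

/-- The spherical Milnor space, with the quotient diffeology. -/
abbrev ESph (G : Type u) : Type u :=
  Quotient (preESetoid G)

/-- The discrete diffeology on `ℤ₂ = {1, -1}`. -/
instance instSign : DiffeologicalSpace ℤˣ := ⊥

section Action

variable {G : Type u} [Group G]

/-- `(h, ε) · (x_i, g_i) = (ε x_i, h σ^ε(g_i))` on labelled points. -/
noncomputable def preAct (σ : ℤˣ →* MulAut G) (k : G ⋊[σ] ℤˣ) (a : PreE G) : PreE G where
  x := ((k.right : ℤ) : ℝ) • a.x
  g := fun i => k.left * σ k.right (a.g i)
  sum_sq := by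
    rw [← a.sum_sq, Finsupp.sum_smul_index' (by simp)]
    refine Finset.sum_congr rfl fun i _ => ?_
    rcases Int.units_eq_one_or k.right with h | h <;> simp [h]

/-- The `σ`-twisted action of `G ⋊ ℤ₂` on the spherical Milnor space. -/
noncomputable instance twistedAction (σ : ℤˣ →* MulAut G) : MulAction (G ⋊[σ] ℤˣ) (ESph G) where
  smul k := Quotient.map (preAct σ k) (by
    rintro a b ⟨h1, h2⟩
    refine ⟨by simp [preAct, h1], fun i hi => ?_⟩
    have : a.x i ≠ 0 := fun h => hi (by simp [preAct, h])
    simp [preAct, h2 i this])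
  one_smul e := by
    refine Quotient.inductionOn e fun a => ?_
    exact congrArg (Quotient.mk _) (by ext <;> simp [preAct])
  mul_smul k l e := by
    refine Quotient.inductionOn e fun a => ?_
    exact congrArg (Quotient.mk _) (by ext <;> simp [preAct, mul_assoc])

/-- The diffeology of the semidirect product, that of the product `G × ℤ₂`. -/
instance instSemidirect [DiffeologicalSpace G] (σ : ℤˣ →* MulAut G) :
    DiffeologicalSpace (G ⋊[σ] ℤˣ) :=
  inducedDiffeology (fun k => (k.left, k.right))

/-- The twisted classifying space `ESph G / (G ⋊ ℤ₂)`, with the quotient diffeology. -/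
abbrev BSph (σ : ℤˣ →* MulAut G) : Type u :=
  Quotient (MulAction.orbitRel (G ⋊[σ] ℤˣ) (ESph G))

/-- The quotient projection `ESph G → BSph σ`. -/
@[reducible]
noncomputable def universalBundle [DiffeologicalSpace G] (σ : ℤˣ →* MulAut G) :
    HSpaceOver.{u, u, u} (G ⋊[σ] ℤˣ) (BSph σ) where
  Total := ESph G
  proj := Quotient.mk _
  proj_smul h _ := Quotient.sound ⟨h, rfl⟩

end Action

end SphMilnor

open SphMilnor

/-! Where the coordinate `x_i` of a point of `ESph G` is non-zero, the pair `(g_i, sign x_i)` is an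
element of `G ⋊ ℤ₂` on which the action becomes left multiplication (`frame_smul`). Quotients of
such frames express the division map, so `ESph G → BSph σ` is principal, and each frame trivialises
it over `{x_i² ≠ 0}`. The functions `x_i²` descend to the base and sum to `1`, but they are known to
be locally finite only along plots. Passing to the functions `gap` produces a partition of unity
that is locally finite for the D-topology (`IsNumeration.isSmoothPartition`), so every pull-back is
D-numerable.

Homotopic maps have isomorphic pull-backs by a covering homotopy argument that needs no compactness.
Along a path so short that the coordinates large at its start never vanish, a point is carried by
keeping its 0th frame fixed, then its 1st, and so on, for times prescribed by the partition of unity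
at the start of the path (`dSmooth_transport`). How short is short enough must be a smooth function
of the point of `X`; an energy integral provides it (`relCoord_sub_lt`). Iterating the short
transports lifts the whole homotopy smoothly and equivariantly (`dSmooth_coverEnd`), and an
equivariant smooth map over the base between principal bundles is an isomorphism
(`iso_of_equivariant`).

For surjectivity, an arbitrary trivialising cover is made countable by Milnor's device: group the
finite sets of indices by cardinality, using that two sets of equal size cannot both dominate at a
point (`exists_countable_frames`). The resulting frames are the labels and signs of an equivariant
map into `ESph G`, which descends to a classifying map.

For injectivity, an isomorphism of pull-backs gives two equivariant maps from one bundle into `ESph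
G`. The first is spread equivariantly over the even coordinates, in infinitely many stages of which
only finitely many matter along a plot away from the end, and is then rotated into a copy of the
second placed in the odd coordinates (`exists_homotopic_join`). The end point depends only on the
second map, so both maps reach it (`homotopic_of_covered`). -/

namespace SphMilnor

open Filter
open scoped ContDiff

/-! ### Germs of plots -/

/-- The parameter space of `n`-dimensional plots. -/
abbrev Eu (n : ℕ) : Type := EuclideanSpace ℝ (Fin n)

/-- Plots are parametrized by whole Euclidean spaces. Precomposing with such a `ψ` turns data valid
only near `u` into a global plot with the same germ at `u`. The bump function scales `v - u`, so
points at distance at least `ε / 2` collapse to `u` and the others move no farther from it. -/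
theorem exists_contDiff_retract {n : ℕ} {u : Eu n} {N : Set (Eu n)} (hN : N ∈ 𝓝 u) :
    ∃ ψ : Eu n → Eu n, ContDiff ℝ ∞ ψ ∧ (∀ v, ψ v ∈ N) ∧ ψ =ᶠ[𝓝 u] id := by
  obtain ⟨ε, hε, hb⟩ := Metric.mem_nhds_iff.1 hN
  let f : ContDiffBump u := ⟨ε / 4, ε / 2, by linarith, by linarith⟩
  refine ⟨fun v => u + f v • (v - u), ?_, fun v => hb ?_, ?_⟩
  · exact contDiff_const.add (f.contDiff.smul (contDiff_id.sub contDiff_const))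
  · rw [Metric.mem_ball, dist_eq_norm, add_sub_cancel_left, norm_smul, Real.norm_eq_abs,
      abs_of_nonneg f.nonneg]
    by_cases hv : v ∈ Metric.ball u (ε / 2)
    · rw [Metric.mem_ball, dist_eq_norm] at hv
      nlinarith [f.le_one (x := v), f.nonneg (x := v), norm_nonneg (v - u)]
    · rw [f.zero_of_le_dist (by simpa using hv)]
      simpa using hε
  · filter_upwards [f.eventuallyEq_one] with v hv
    simp only [hv, Pi.one_apply, id]
    simp

section Germ

variable {X : Type u} {Y : Type v} {Z : Type w} [DiffeologicalSpace X] [DiffeologicalSpace Y]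
  [DiffeologicalSpace Z] {n : ℕ}

/-- `p` agrees with a plot near `u`. -/
def IsPlotAt (p : Eu n → X) (u : Eu n) : Prop :=
  ∃ q : Eu n → X, IsPlot q ∧ p =ᶠ[𝓝 u] q

theorem IsPlotAt.congr {p q : Eu n → X} {u : Eu n} (hp : IsPlotAt p u) (h : q =ᶠ[𝓝 u] p) :
    IsPlotAt q u :=
  let ⟨r, hr, hpr⟩ := hp
  ⟨r, hr, h.trans hpr⟩

theorem isPlotAt_of_isPlot {p : Eu n → X} (hp : IsPlot p) (u : Eu n) : IsPlotAt p u :=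
  ⟨p, hp, EventuallyEq.rfl⟩

theorem isPlot_of_isPlotAt {p : Eu n → X} (h : ∀ u, IsPlotAt p u) : IsPlot p := by
  refine DiffeologicalSpace.locality fun u => ?_
  obtain ⟨q, hq, he⟩ := h u
  obtain ⟨U, hU, hUo, hu⟩ := mem_nhds_iff.1 he
  refine ⟨U, hUo, hu, fun {m f} hf hf' => ?_⟩
  have : p ∘ f = q ∘ f := funext fun a => hU (hf a)
  rw [this]
  exact isPlot_reparam hq hf'

theorem _root_.Diffeology.DSmooth.isPlotAt {f : X → Y} (hf : DSmooth f) {p : Eu n → X} {u : Eu n}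
    (hp : IsPlotAt p u) : IsPlotAt (fun v => f (p v)) u :=
  let ⟨q, hq, he⟩ := hp
  ⟨f ∘ q, hf _ _ hq, he.mono fun _ hv => congrArg f hv⟩

theorem dSmooth_of_isPlotAt {f : X → Y}
    (h : ∀ (n : ℕ) (p : Eu n → X) (u : Eu n), IsPlot p → IsPlotAt (fun v => f (p v)) u) :
    DSmooth f :=
  fun n p hp => isPlot_of_isPlotAt fun u => h n p u hp

theorem IsPlotAt.pair {p : Eu n → X} {q : Eu n → Y} {u : Eu n} (hp : IsPlotAt p u)
    (hq : IsPlotAt q u) : IsPlotAt (fun v => (p v, q v)) u :=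
  let ⟨p', hp', he⟩ := hp
  let ⟨q', hq', he'⟩ := hq
  ⟨fun v => (p' v, q' v), isPlot_prod_iff.2 ⟨hp', hq'⟩, he.prodMk he'⟩

/-- `f` is smooth along plots near the points of `U`. -/
def DSmoothOn (f : X → Y) (U : Set X) : Prop :=
  ∀ (n : ℕ) (p : Eu n → X) (u : Eu n), IsPlot p → p u ∈ U → IsPlotAt (fun v => f (p v)) u

theorem DSmoothOn.isPlotAt {f : X → Y} {U : Set X} (hf : DSmoothOn f U) {p : Eu n → X} {u : Eu n}
    (hp : IsPlotAt p u) (hu : p u ∈ U) : IsPlotAt (fun v => f (p v)) u := by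
  obtain ⟨q, hq, he⟩ := hp
  refine (hf n q u hq (he.eq_of_nhds ▸ hu)).congr (he.mono fun v hv => ?_)
  exact congrArg f hv

theorem IsPlotAt.continuousAt {p : Eu n → ℝ} {u : Eu n} (hp : IsPlotAt p u) :
    ContinuousAt p u := by
  obtain ⟨q, hq, he⟩ := hp
  exact (IsPlot.contDiff hq).continuous.continuousAt.congr he.symm

theorem _root_.Diffeology.IsPlot.continuous_real {p : Eu n → ℝ} (hp : IsPlot p) : Continuous p :=
  (IsPlot.contDiff hp).continuous

/-! ### Plots of constructed diffeologies -/

theorem isPlot_subtype_iff {s : X → Prop} {p : Eu n → Subtype s} :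
    IsPlot p ↔ IsPlot (fun a => (p a).1) :=
  Iff.rfl

theorem dSmooth_subtype_val {s : X → Prop} : DSmooth (Subtype.val : Subtype s → X) :=
  fun _ _ hp => hp

theorem dSmooth_subtype_mk {s : X → Prop} {f : Y → X} (hf : DSmooth f) (h : ∀ y, s (f y)) :
    DSmooth (fun y => (⟨f y, h y⟩ : Subtype s)) :=
  fun n p hp => hf n p hp

theorem isPlot_pi_iff {ι : Type u} {X : ι → Type v} [∀ i, DiffeologicalSpace (X i)]
    {p : Eu n → ∀ i, X i} : IsPlot p ↔ ∀ i, IsPlot (fun a => p a i) :=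
  DiffeologicalSpace.isPlot_iInf_iff

/-- The parametrizations on the right already form a diffeology, with `exists_contDiff_retract`
giving its locality; it contains the generators and hence the generated diffeology. Locally constant
ones need a separate clause because the family `f` need not be jointly surjective. -/
theorem isPlot_final_iff {ι : Type u} {X : ι → Type v} {Y : Type w}
    [∀ i, DiffeologicalSpace (X i)] {f : ∀ i, X i → Y} {p : Eu n → Y} :
    @IsPlot _ (finalDiffeology f) n p ↔
      ∀ u, (∃ y, p =ᶠ[𝓝 u] fun _ => y) ∨
        ∃ (i : ι) (q : Eu n → X i), IsPlot q ∧ p =ᶠ[𝓝 u] fun v => f i (q v) := by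
  constructor
  · let d : DiffeologicalSpace Y :=
      { plots := fun n => {p | ∀ u, (∃ y, p =ᶠ[𝓝 u] fun _ => y) ∨
          ∃ (i : ι) (q : Eu n → X i), IsPlot q ∧ p =ᶠ[𝓝 u] fun v => f i (q v)}
        constant_plots := fun y u => Or.inl ⟨y, EventuallyEq.rfl⟩
        plot_reparam := fun {n m p φ} hp hφ u => by
          obtain ⟨y, he⟩ | ⟨i, q, hq, he⟩ := hp (φ u)
          · exact Or.inl ⟨y, hφ.continuous.continuousAt.eventually he⟩
          · exact Or.inr ⟨i, q ∘ φ, isPlot_reparam hq hφ,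
              hφ.continuous.continuousAt.eventually he⟩
        locality := fun {n p} hp u => by
          obtain ⟨U, hU, hu, h⟩ := hp u
          obtain ⟨ψ, hψ, hψU, hid⟩ := exists_contDiff_retract (hU.mem_nhds hu)
          obtain ⟨y, he⟩ | ⟨i, q, hq, he⟩ := h hψU hψ u
          · refine Or.inl ⟨y, ?_⟩
            filter_upwards [he, hid] with v hv hv'
            rw [← hv, Function.comp, hv', id]
          · refine Or.inr ⟨i, q, hq, ?_⟩
            filter_upwards [he, hid] with v hv hv'
            rw [← hv, Function.comp, hv', id] }
    intro hp
    have hle : finalDiffeology f ≤ d := by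
      rw [DiffeologicalSpace.generateFrom_le_iff]
      rintro n q ⟨i, r, hr, h⟩ u
      exact Or.inr ⟨i, r, hr, Eventually.of_forall (congrFun h)⟩
    exact DiffeologicalSpace.le_iff'.1 hle n p hp
  · intro h
    refine @isPlot_of_isPlotAt _ (finalDiffeology f) _ _ fun u => ?_
    obtain ⟨y, he⟩ | ⟨i, q, hq, he⟩ := h u
    · exact ⟨_, @isPlot_const _ (finalDiffeology f) _ y, he⟩
    · exact ⟨_, DiffeologicalSpace.isPlot_generatedFrom_of_mem ⟨i, q, hq, rfl⟩, he⟩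

theorem isPlot_coinduced_iff {Y : Type v} {f : X → Y} (hf : Function.Surjective f) {p : Eu n → Y} :
    @IsPlot _ (coinducedDiffeology f) n p ↔
      ∀ u, ∃ q : Eu n → X, IsPlot q ∧ p =ᶠ[𝓝 u] fun v => f (q v) := by
  rw [isPlot_final_iff]
  refine forall_congr' fun u => ⟨?_, fun ⟨q, h⟩ => Or.inr ⟨(), q, h⟩⟩
  rintro (⟨y, he⟩ | ⟨_, q, h⟩)
  · obtain ⟨x, rfl⟩ := hf y
    exact ⟨fun _ => x, isPlot_const, he⟩
  · exact ⟨q, h⟩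

theorem isSubduction_iff {f : X → Y} :
    IsSubduction f ↔ Function.Surjective f ∧ DSmooth f ∧
      ∀ (n : ℕ) (p : Eu n → Y) (u : Eu n), IsPlot p →
        ∃ q : Eu n → X, IsPlot q ∧ p =ᶠ[𝓝 u] fun v => f (q v) := by
  constructor
  · rintro ⟨hs, h⟩
    have key : ∀ (n : ℕ) (p : Eu n → Y), IsPlot p ↔
        ∀ u, ∃ q : Eu n → X, IsPlot q ∧ p =ᶠ[𝓝 u] fun v => f (q v) := fun n p => by
      rw [← isPlot_coinduced_iff hs, h]
    exact ⟨hs, fun n p hp => (key n _).2 fun u => ⟨p, hp, EventuallyEq.rfl⟩,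
      fun n p u hp => (key n p).1 hp u⟩
  · rintro ⟨hs, hf, hl⟩
    refine ⟨hs, ?_⟩
    ext n p
    rw [isPlot_coinduced_iff hs]
    refine ⟨fun h => isPlot_of_isPlotAt fun u => ?_, fun h u => hl n p u h⟩
    obtain ⟨q, hq, he⟩ := h u
    exact ⟨_, hf n q hq, he⟩

theorem isSubduction_quotient_mk (s : Setoid X) : IsSubduction (Quotient.mk s) :=
  ⟨Quotient.mk_surjective, rfl⟩

theorem IsSubduction.dSmooth_of_comp {f : X → Y} (hf : IsSubduction f) {g : Y → Z}
    (hg : DSmooth (fun x => g (f x))) : DSmooth g := by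
  refine dSmooth_of_isPlotAt fun n p u hp => ?_
  obtain ⟨q, hq, he⟩ := (isSubduction_iff.1 hf).2.2 n p u hp
  exact ⟨_, hg n q hq, he.mono fun v hv => congrArg g hv⟩

theorem isPlot_bot_iff {X : Type u} {p : Eu n → X} :
    @IsPlot X ⊥ n p ↔ ∀ u, p =ᶠ[𝓝 u] fun _ => p u := by
  constructor
  · let d : DiffeologicalSpace X :=
      { plots := fun n => {p | ∀ u, p =ᶠ[𝓝 u] fun _ => p u}
        constant_plots := fun y u => EventuallyEq.rfl
        plot_reparam := fun {n m p φ} hp hφ u =>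
          hφ.continuous.continuousAt.eventually (hp (φ u))
        locality := fun {n p} hp u => by
          obtain ⟨U, hU, hu, h⟩ := hp u
          obtain ⟨ψ, hψ, hψU, hid⟩ := exists_contDiff_retract (hU.mem_nhds hu)
          filter_upwards [h hψU hψ u, hid] with v hv hv'
          simp only [Function.comp, hv', id, hid.eq_of_nhds] at hv
          exact hv }
    intro hp
    have hle : ⊥ ≤ d := bot_le
    exact DiffeologicalSpace.le_iff'.1 hle n p hp
  · intro h
    exact @isPlot_of_isPlotAt _ ⊥ _ _ fun u => ⟨_, @isPlot_const _ ⊥ _ _, h u⟩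

theorem isPlot_units_iff {p : Eu n → ℤˣ} : IsPlot p ↔ ∀ u, p =ᶠ[𝓝 u] fun _ => p u :=
  isPlot_bot_iff

/-! ### Smooth real-valued functions -/

theorem _root_.Diffeology.DSmooth.comp_contDiff₂ {f g : X → ℝ} (hf : DSmooth f) (hg : DSmooth g) {k : ℝ × ℝ → ℝ}
    (hk : ContDiff ℝ ∞ k) : DSmooth (fun x => k (f x, g x)) := fun n p hp =>
  (hk.comp ((IsPlot.contDiff (hf n p hp)).prodMk (IsPlot.contDiff (hg n p hp)))).isPlot

theorem _root_.Diffeology.DSmooth.add_real {f g : X → ℝ} (hf : DSmooth f) (hg : DSmooth g) :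
    DSmooth (fun x => f x + g x) :=
  hf.comp_contDiff₂ hg (k := fun a => a.1 + a.2) (by fun_prop)

theorem _root_.Diffeology.DSmooth.sub_real {f g : X → ℝ} (hf : DSmooth f) (hg : DSmooth g) :
    DSmooth (fun x => f x - g x) :=
  hf.comp_contDiff₂ hg (k := fun a => a.1 - a.2) (by fun_prop)

theorem _root_.Diffeology.DSmooth.mul_real {f g : X → ℝ} (hf : DSmooth f) (hg : DSmooth g) :
    DSmooth (fun x => f x * g x) :=
  hf.comp_contDiff₂ hg (k := fun a => a.1 * a.2) (by fun_prop)

theorem _root_.Diffeology.DSmooth.comp_contDiff {f : X → ℝ} (hf : DSmooth f) {k : ℝ → ℝ} (hk : ContDiff ℝ ∞ k) :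
    DSmooth (fun x => k (f x)) :=
  hk.dSmooth.comp hf

theorem _root_.Diffeology.DSmooth.div_real {f g : X → ℝ} (hf : DSmooth f) (hg : DSmooth g) (h0 : ∀ x, g x ≠ 0) :
    DSmooth (fun x => f x / g x) := fun n p hp =>
  ((IsPlot.contDiff (hf n p hp)).div (IsPlot.contDiff (hg n p hp)) fun u => h0 (p u)).isPlot

theorem _root_.Diffeology.DSmooth.sqrt_real {f : X → ℝ} (hf : DSmooth f) (h0 : ∀ x, f x ≠ 0) :
    DSmooth (fun x => Real.sqrt (f x)) := fun n p hp =>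
  ((IsPlot.contDiff (hf n p hp)).sqrt fun u => h0 (p u)).isPlot

theorem _root_.Diffeology.DSmooth.sum_real {ι : Type w} {f : ι → X → ℝ} {s : Finset ι}
    (hf : ∀ i ∈ s, DSmooth (f i)) : DSmooth (fun x => ∑ i ∈ s, f i x) := fun n p hp =>
  (ContDiff.sum fun i hi => (IsPlot.contDiff (hf i hi n p hp))).isPlot

theorem _root_.Diffeology.DSmooth.prod_real {ι : Type w} {f : ι → X → ℝ} {s : Finset ι}
    (hf : ∀ i ∈ s, DSmooth (f i)) : DSmooth (fun x => ∏ i ∈ s, f i x) := fun n p hp =>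
  (contDiff_prod fun i hi => (IsPlot.contDiff (hf i hi n p hp))).isPlot

/-! ### Families that are locally finite along plots -/

/-- Along every plot, all but finitely many of the functions vanish locally. -/
def PlotLocallyFinite {ι : Type w} (f : ι → X → ℝ) : Prop :=
  ∀ (n : ℕ) (p : Eu n → X) (u : Eu n), IsPlot p →
    ∃ I : Finset ι, ∀ᶠ v in 𝓝 u, ∀ i ∉ I, f i (p v) = 0

theorem PlotLocallyFinite.comp {ι : Type w} {f : ι → X → ℝ} (hf : PlotLocallyFinite f)
    {g : Y → X} (hg : DSmooth g) : PlotLocallyFinite (fun i y => f i (g y)) :=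
  fun n p u hp => hf n (fun v => g (p v)) u (hg n p hp)

theorem PlotLocallyFinite.mono {ι : Type w} {f g : ι → X → ℝ} (hf : PlotLocallyFinite f)
    (h : ∀ i x, f i x = 0 → g i x = 0) : PlotLocallyFinite g := fun n p u hp =>
  let ⟨I, hI⟩ := hf n p u hp
  ⟨I, hI.mono fun _ hv i hi => h i _ (hv i hi)⟩

theorem PlotLocallyFinite.finite {ι : Type w} {f : ι → X → ℝ} (hf : PlotLocallyFinite f) (x : X) :
    (Function.support (fun i => f i x)).Finite := by
  obtain ⟨I, hI⟩ := hf 0 (fun _ => x) 0 isPlot_const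
  refine I.finite_toSet.subset fun i hi => ?_
  by_contra h
  exact hi (hI.self_of_nhds i h)

theorem finsum_eq_sum_of_zero {ι : Type w} {f : ι → ℝ} {I : Finset ι} (h : ∀ i ∉ I, f i = 0) :
    ∑ᶠ i, f i = ∑ i ∈ I, f i :=
  finsum_eq_sum_of_support_subset _ fun i hi => by
    by_contra h'
    exact hi (h i h')

theorem PlotLocallyFinite.dSmooth_finsum {ι : Type w} {f : ι → X → ℝ} (hf : PlotLocallyFinite f)
    (hs : ∀ i, DSmooth (f i)) : DSmooth (fun x => ∑ᶠ i, f i x) := by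
  refine dSmooth_of_isPlotAt fun n p u hp => ?_
  obtain ⟨I, hI⟩ := hf n p u hp
  refine ⟨fun v => ∑ i ∈ I, f i (p v), DSmooth.sum_real (fun i _ => hs i) n p hp, ?_⟩
  filter_upwards [hI] with v hv
  exact finsum_eq_sum_of_zero hv

/-! ### The D-topology -/

theorem isOpen_dTopology_of_eventually {U : Set X}
    (h : ∀ (n : ℕ) (p : Eu n → X) (u : Eu n), IsPlot p → p u ∈ U → ∀ᶠ v in 𝓝 u, p v ∈ U) :
    IsOpen[dTopology] U :=
  isOpen_iff_preimages_plots.2 fun n p hp => isOpen_iff_mem_nhds.2 fun u hu => h n p u hp hu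

theorem eventually_mem_of_isOpen {U : Set X} (hU : IsOpen[dTopology] U) {p : Eu n → X} {u : Eu n}
    (hp : IsPlot p) (hu : p u ∈ U) : ∀ᶠ v in 𝓝 u, p v ∈ U :=
  (isOpen_iff_preimages_plots.1 hU n p hp).mem_nhds hu

theorem isOpen_dTopology_lt {f g : X → ℝ} (hf : DSmooth f) (hg : DSmooth g) :
    IsOpen[dTopology] {x | f x < g x} :=
  isOpen_iff_preimages_plots.2 fun n p hp =>
    isOpen_lt (IsPlot.continuous_real (hf n p hp)) (IsPlot.continuous_real (hg n p hp))

theorem isOpen_dTopology_ne {f : X → ℝ} (hf : DSmooth f) : IsOpen[dTopology] {x | f x ≠ 0} :=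
  isOpen_iff_preimages_plots.2 fun n p hp =>
    isOpen_ne_fun (IsPlot.continuous_real (hf n p hp)) continuous_const

theorem closure_dTopology_subset_le {S : Set X} {f g : X → ℝ} (hf : DSmooth f) (hg : DSmooth g)
    (h : ∀ x ∈ S, f x ≤ g x) : closure[dTopology] S ⊆ {x | f x ≤ g x} := by
  let _ : TopologicalSpace X := dTopology
  refine closure_minimal h ⟨?_⟩
  convert! isOpen_dTopology_lt hg hf using 1
  ext x
  simp

end Germ

/-! ### Coordinates on the spherical Milnor space -/

section Coordinates

variable {G : Type u}

/-- The `i`-th spherical coordinate. -/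
def coord (i : ℕ) : ESph G → ℝ :=
  Quotient.lift (fun a => a.x i) fun _ _ h => DFunLike.congr_fun h.1 i

theorem finite_support_coord (e : ESph G) : (Function.support fun i => coord i e).Finite := by
  induction e using Quotient.inductionOn with | _ a
  exact a.x.hasFiniteSupport

theorem finsum_coord_sq (e : ESph G) : ∑ᶠ i, coord i e ^ 2 = 1 := by
  induction e using Quotient.inductionOn with | _ a
  rw [← a.sum_sq]
  exact finsum_eq_sum_of_zero fun i hi => by
    change a.x i ^ 2 = 0
    simp [Finsupp.notMem_support_iff.1 hi]

theorem exists_coord_ne_zero (e : ESph G) : ∃ i, coord i e ≠ 0 := by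
  by_contra! h
  simpa [h] using finsum_coord_sq e

/-- The point with given coordinates and labels. -/
noncomputable def mkPt (x : ℕ → ℝ) (g : ℕ → G) (hf : (Function.support x).Finite)
    (hs : ∑ᶠ i, x i ^ 2 = 1) : ESph G :=
  Quotient.mk _
    { x := Finsupp.ofSupportFinite x hf
      g := g
      sum_sq := by
        rw [← hs]
        refine (finsum_eq_sum_of_zero fun i hi => ?_).symm
        have : x i = 0 := Finsupp.notMem_support_iff.1 hi
        exact (congrArg (· ^ 2) this).trans (by simp) }

variable [Group G]

open Classical in
/-- The `i`-th label, normalised to be `1` where the `i`-th coordinate vanishes. -/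
noncomputable def lab (i : ℕ) : ESph G → G :=
  Quotient.lift (fun a => if a.x i = 0 then 1 else a.g i) fun a b h => by
    have h1 : a.x i = b.x i := DFunLike.congr_fun h.1 i
    by_cases h0 : a.x i = 0
    · simp [h0, ← h1]
    · simp [h0, ← h1, h.2 i h0]

theorem lab_mk {i : ℕ} {a : PreE G} (h : a.x i ≠ 0) : lab i (Quotient.mk _ a : ESph G) = a.g i :=
  if_neg h

theorem eSph_ext {e e' : ESph G} (h : ∀ i, coord i e = coord i e')
    (h' : ∀ i, coord i e ≠ 0 → lab i e = lab i e') : e = e' := by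
  induction e using Quotient.inductionOn with | _ a
  induction e' using Quotient.inductionOn with | _ b
  refine Quotient.sound ⟨Finsupp.ext h, fun i hi => ?_⟩
  have hb : b.x i ≠ 0 := fun h0 => hi ((h i).trans h0)
  rw [← lab_mk hi, ← lab_mk hb]
  exact h' i hi

theorem lab_mkPt (x : ℕ → ℝ) (g : ℕ → G) (hf hs) {i : ℕ} (hi : x i ≠ 0) :
    lab i (mkPt x g hf hs) = g i :=
  lab_mk hi

variable [DiffeologicalSpace G] {n : ℕ}

theorem isSubduction_eSph_mk : IsSubduction (Quotient.mk (preESetoid G)) :=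
  isSubduction_quotient_mk _

theorem isPlot_chart {I : Finset ℕ} {q : Eu n → Sphere I × (I → G)} (hq : IsPlot q) :
    IsPlot (fun v => (Quotient.mk _ (chart G I (q v)) : ESph G)) :=
  (isSubduction_iff.1 isSubduction_eSph_mk).2.1 n _
    (isPlot_final_iff.2 fun _ => Or.inr ⟨I, q, hq, EventuallyEq.rfl⟩)

/-- A plot locally factors through one chart, whence the uniform finite set `I`. The label plots `g
i` come from the chart and are defined also where the `i`-th coordinate vanishes: labels extend
smoothly across the zero set, although `lab i` jumps there. -/
theorem IsPlotAt.exists_chart {p : Eu n → ESph G} {u : Eu n} (hp : IsPlotAt p u) :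
    ∃ (I : Finset ℕ) (c : ℕ → Eu n → ℝ) (g : ℕ → Eu n → G), (∀ i, IsPlot (c i)) ∧
      (∀ i, IsPlot (g i)) ∧ ∀ᶠ v in 𝓝 u, (∀ i ∉ I, coord i (p v) = 0) ∧
        ∀ i, coord i (p v) = c i v ∧ (coord i (p v) ≠ 0 → lab i (p v) = g i v) := by
  obtain ⟨p', hp', he⟩ := hp
  obtain ⟨q, hq, he'⟩ := (isSubduction_iff.1 isSubduction_eSph_mk).2.2 n p' u hp'
  obtain ⟨y, hy⟩ | ⟨I, r, hr, hy⟩ := (isPlot_final_iff (f := chart G)).1 hq u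
  · refine ⟨y.x.support, fun i _ => y.x i, fun i _ => y.g i, fun _ => isPlot_const,
      fun _ => isPlot_const, ?_⟩
    filter_upwards [he, he', hy] with v h1 h2 h3
    rw [h1, h2, h3]
    exact ⟨fun i hi => Finsupp.notMem_support_iff.1 hi, fun i => ⟨rfl, fun h => lab_mk h⟩⟩
  · have hr' := isPlot_prod_iff.1 hr
    refine ⟨I, fun i v => if h : i ∈ I then (r v).1.1 ⟨i, h⟩ else 0,
      fun i v => if h : i ∈ I then (r v).2 ⟨i, h⟩ else 1, fun i => ?_, fun i => ?_, ?_⟩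
    · by_cases h : i ∈ I
      · simp only [h, dite_true]
        have h1 : ContDiff ℝ ∞ (fun v => (r v).1.1) := IsPlot.contDiff hr'.1
        exact (contDiff_euclidean.1 h1 ⟨i, h⟩).isPlot
      · simp only [h, dite_false]
        exact isPlot_const
    · by_cases h : i ∈ I
      · simp only [h, dite_true]
        exact isPlot_pi_iff.1 hr'.2 ⟨i, h⟩
      · simp only [h, dite_false]
        exact isPlot_const
    · filter_upwards [he, he', hy] with v h1 h2 h3
      rw [h1, h2, h3]
      exact ⟨fun i hi => dif_neg hi, fun i => ⟨rfl, fun h => lab_mk h⟩⟩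

theorem dSmooth_coord (i : ℕ) : DSmooth (coord i : ESph G → ℝ) :=
  dSmooth_of_isPlotAt fun _ _ u hp => by
    obtain ⟨I, c, g, hc, -, h⟩ := (isPlotAt_of_isPlot hp u).exists_chart
    exact ⟨c i, hc i, h.mono fun v hv => (hv.2 i).1⟩

theorem dSmoothOn_lab (i : ℕ) : DSmoothOn (lab i : ESph G → G) {e | coord i e ≠ 0} :=
  fun n p u hp hu => by
    obtain ⟨I, c, g, -, hg, h⟩ := (isPlotAt_of_isPlot hp u).exists_chart
    refine ⟨g i, hg i, ?_⟩
    have hne : ∀ᶠ v in 𝓝 u, coord i (p v) ≠ 0 :=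
      (IsPlot.continuous_real (dSmooth_coord i n p hp)).continuousAt.eventually_ne hu
    filter_upwards [h, hne] with v hv hv'
    exact (hv.2 i).2 hv'

/-- Converse of `IsPlotAt.exists_chart`. A label has to agree with a plot only where its coordinate
is non-zero, but that plot must be defined on a full neighbourhood, since a chart records labels at
vanishing coordinates too. -/
theorem isPlotAt_eSph {q : Eu n → ESph G} {u : Eu n} (I : Finset ℕ)
    (h0 : ∀ᶠ v in 𝓝 u, ∀ i ∉ I, coord i (q v) = 0)
    (hc : ∀ i ∈ I, IsPlotAt (fun v => coord i (q v)) u)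
    (hg : ∀ i ∈ I, ∃ r : Eu n → G, IsPlotAt r u ∧
      ∀ᶠ v in 𝓝 u, coord i (q v) ≠ 0 → lab i (q v) = r v) : IsPlotAt q u := by
  choose! c hc hce using hc
  have hg' : ∀ i ∈ I, ∃ r : Eu n → G, IsPlot r ∧
      ∀ᶠ v in 𝓝 u, coord i (q v) ≠ 0 → lab i (q v) = r v := fun i hi => by
    obtain ⟨r, ⟨r', hr', he⟩, h⟩ := hg i hi
    refine ⟨r', hr', ?_⟩
    filter_upwards [he, h] with v h1 h2 h3
    rw [h2 h3, h1]
  choose! g hg hge using hg'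
  have hN : ∀ᶠ v in 𝓝 u, (∀ i ∉ I, coord i (q v) = 0) ∧
      ∀ i ∈ I, coord i (q v) = c i v ∧ (coord i (q v) ≠ 0 → lab i (q v) = g i v) := by
    refine h0.and ((eventually_all_finset I).2 fun i hi => ?_)
    exact (hce i hi).and (hge i hi)
  -- After retracting into the neighbourhood where all conditions hold, `q ∘ ψ` takes values in the
  -- single chart of `I` everywhere.
  obtain ⟨ψ, hψ, hψN, hid⟩ := exists_contDiff_retract hN
  let r : Eu n → Sphere I × (I → G) := fun v =>
    (⟨WithLp.toLp 2 fun i => coord i (q (ψ v)), by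
      rw [← finsum_coord_sq (q (ψ v)), finsum_eq_sum_of_zero (I := I) fun i hi => by
        rw [(hψN v).1 i hi]; simp]
      exact Finset.sum_coe_sort I fun i => coord i (q (ψ v)) ^ 2⟩, fun i => g i (ψ v))
  have hr : IsPlot r := by
    refine isPlot_prod_iff.2 ⟨?_, isPlot_pi_iff.2 fun i => isPlot_reparam (hg i i.2) hψ⟩
    refine isPlot_subtype_iff.2 (ContDiff.isPlot (contDiff_euclidean.2 fun i => ?_))
    have : (fun v => coord (i : ℕ) (q (ψ v))) = c i ∘ ψ := funext fun v => ((hψN v).2 i i.2).1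
    exact this ▸ (IsPlot.contDiff (isPlot_reparam (hc i i.2) hψ))
  have key : ∀ v, q (ψ v) = Quotient.mk _ (chart G I (r v)) := fun v => by
    have hx : ∀ i, coord i (q (ψ v)) = coord i (Quotient.mk _ (chart G I (r v)) : ESph G) := by
      intro i
      change _ = if h : i ∈ I then coord i (q (ψ v)) else 0
      split_ifs with h
      · rfl
      · exact (hψN v).1 i h
    refine eSph_ext hx fun i hi => ?_
    have hi' : i ∈ I := by
      by_contra h
      exact hi ((hψN v).1 i h)
    rw [((hψN v).2 i hi').2 hi, lab_mk (fun h => hi ((hx i).trans h))]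
    change _ = if h : i ∈ I then g i (ψ v) else 1
    rw [dif_pos hi']
  refine ⟨_, isPlot_chart hr, ?_⟩
  filter_upwards [hid] with v hv
  rw [← key v, hv, id]

end Coordinates

/-! ### The structure group -/

section StructureGroup

variable {G : Type u} [Group G] [DiffeologicalSpace G] {σ : ℤˣ →* MulAut G}
  {X : Type v} [DiffeologicalSpace X] {n : ℕ}

theorem isPlot_semidirect_iff {p : Eu n → G ⋊[σ] ℤˣ} :
    IsPlot p ↔ IsPlot (fun v => (p v).left) ∧ IsPlot (fun v => (p v).right) :=
  isPlot_prod_iff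

theorem dSmooth_left : DSmooth (fun k : G ⋊[σ] ℤˣ => k.left) :=
  fun _ _ hp => (isPlot_semidirect_iff.1 hp).1

theorem dSmooth_right : DSmooth (fun k : G ⋊[σ] ℤˣ => k.right) :=
  fun _ _ hp => (isPlot_semidirect_iff.1 hp).2

theorem dSmooth_units (f : ℤˣ → X) : DSmooth f := fun _ p hp =>
  isPlot_of_isPlotAt fun u =>
    ⟨fun _ => f (p u), isPlot_const, (isPlot_units_iff.1 hp u).mono fun _ hv => congrArg f hv⟩

theorem dSmooth_units_mul : DSmooth (fun a : ℤˣ × ℤˣ => a.1 * a.2) := fun n p hp =>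
  isPlot_units_iff.2 fun u => by
    filter_upwards [isPlot_units_iff.1 (isPlot_prod_iff.1 hp).1 u,
      isPlot_units_iff.1 (isPlot_prod_iff.1 hp).2 u] with v h1 h2
    simp [h1, h2]

theorem diffeologicalGroup_semidirect [DiffeologicalGroup G]
    (hσ : DSmooth (fun a : ℤˣ × G => σ a.1 a.2)) : DiffeologicalGroup (G ⋊[σ] ℤˣ) where
  smooth_mul := by
    have h1 : DSmooth (fun a : (G ⋊[σ] ℤˣ) × (G ⋊[σ] ℤˣ) => a.1.left * σ a.1.right a.2.left) :=
      DiffeologicalGroup.smooth_mul.comp (dSmooth_pair (dSmooth_left.comp dSmooth_fst)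
        (hσ.comp (dSmooth_pair (dSmooth_right.comp dSmooth_fst) (dSmooth_left.comp dSmooth_snd))))
    have h2 : DSmooth (fun a : (G ⋊[σ] ℤˣ) × (G ⋊[σ] ℤˣ) => a.1.right * a.2.right) :=
      dSmooth_units_mul.comp (dSmooth_pair (dSmooth_right.comp dSmooth_fst)
        (dSmooth_right.comp dSmooth_snd))
    exact fun n p hp => isPlot_semidirect_iff.2 ⟨h1 n p hp, h2 n p hp⟩
  smooth_inv := by
    have h1 : DSmooth (fun a : G ⋊[σ] ℤˣ => σ a.right⁻¹ a.left⁻¹) :=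
      hσ.comp (dSmooth_pair ((dSmooth_units _).comp dSmooth_right)
        (DiffeologicalGroup.smooth_inv.comp dSmooth_left))
    have h2 : DSmooth (fun a : G ⋊[σ] ℤˣ => a.right⁻¹) := (dSmooth_units _).comp dSmooth_right
    exact fun n p hp => isPlot_semidirect_iff.2 ⟨h1 n p hp, h2 n p hp⟩

end StructureGroup

/-! ### The twisted action in coordinates -/

section Twisted

variable {G : Type u} [Group G] (σ : ℤˣ →* MulAut G)

variable {σ} in
theorem coord_smul (i : ℕ) (k : G ⋊[σ] ℤˣ) (e : ESph G) :
    coord i (k • e) = ((k.right : ℤ) : ℝ) * coord i e := by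
  induction e using Quotient.inductionOn with | _ a
  rfl

variable {σ} in
theorem coord_smul_ne_zero {i : ℕ} {k : G ⋊[σ] ℤˣ} {e : ESph G} :
    coord i (k • e) ≠ 0 ↔ coord i e ≠ 0 := by
  rw [coord_smul]
  simp

variable {σ} in
theorem lab_smul {i : ℕ} (k : G ⋊[σ] ℤˣ) {e : ESph G} (h : coord i e ≠ 0) :
    lab i (k • e) = k.left * σ k.right (lab i e) := by
  have h' : coord i (k • e) ≠ 0 := coord_smul_ne_zero.2 h
  induction e using Quotient.inductionOn with | _ a
  rw [lab_mk h]
  exact lab_mk (a := preAct σ k a) h'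

open Classical in
/-- The sign of a real number, as a unit of `ℤ`. -/
noncomputable def sgn (t : ℝ) : ℤˣ := if t < 0 then -1 else 1

theorem sgn_mul (ε : ℤˣ) {t : ℝ} (ht : t ≠ 0) : sgn (((ε : ℤ) : ℝ) * t) = ε * sgn t := by
  rcases Int.units_eq_one_or ε with h | h
  · simp [h]
  · rcases lt_or_gt_of_ne ht with h' | h'
    · simp [h, sgn, h', h'.le]
    · simp [h, sgn, h', h'.le]

theorem eventually_sgn_eq {n : ℕ} {f : Eu n → ℝ} {u : Eu n} (hf : ContinuousAt f u)
    (hu : f u ≠ 0) : ∀ᶠ v in 𝓝 u, sgn (f v) = sgn (f u) := by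
  rcases lt_or_gt_of_ne hu with h | h
  · filter_upwards [hf.eventually_lt_const h] with v hv
    simp [sgn, hv, h]
  · filter_upwards [hf.eventually_const_lt h] with v hv
    simp [sgn, hv.not_gt, h.not_gt]

/-- The `i`-th frame coordinate `(g_i, sign x_i)` in the structure group. -/
noncomputable def frame (i : ℕ) (e : ESph G) : G ⋊[σ] ℤˣ := ⟨lab i e, sgn (coord i e)⟩

variable {σ}

/-- The twisted action sends the label `g` to `h σ^ε(g)` and multiplies the sign by `ε`, which is
exactly multiplication in the semidirect product. Non-vanishing is needed because both `lab` and
`sgn` take a conventional value at a zero coordinate. -/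
theorem frame_smul {i : ℕ} (k : G ⋊[σ] ℤˣ) {e : ESph G} (h : coord i e ≠ 0) :
    frame σ i (k • e) = k * frame σ i e := by
  ext
  · exact lab_smul k h
  · simp only [frame, coord_smul, sgn_mul _ h, SemidirectProduct.mul_right]

theorem dSmoothOn_frame [DiffeologicalSpace G] (i : ℕ) :
    DSmoothOn (frame σ i) {e | coord i e ≠ 0} := fun n p u hp hu => by
  obtain ⟨q, hq, he⟩ := dSmoothOn_lab i n p u hp hu
  refine ⟨fun v => ⟨q v, sgn (coord i (p u))⟩, isPlot_semidirect_iff.2 ⟨hq, isPlot_const⟩, ?_⟩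
  filter_upwards [he, eventually_sgn_eq
    (IsPlot.continuous_real (dSmooth_coord i n p hp)).continuousAt hu] with v h1 h2
  exact SemidirectProduct.ext h1 h2

variable (σ) in
/-- The quotient projection as a function. -/
noncomputable abbrev toB (e : ESph G) : BSph σ := Quotient.mk _ e

theorem toB_smul (k : G ⋊[σ] ℤˣ) (e : ESph G) : toB σ (k • e) = toB σ e :=
  Quotient.sound ⟨k, rfl⟩

/-- The square of the `i`-th coordinate, as a function on the base. -/
noncomputable def sqCoord (i : ℕ) : BSph σ → ℝ :=
  Quotient.lift (fun e => coord i e ^ 2) fun _ b ⟨k, hk⟩ => by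
    rw [← hk]
    simp only [coord_smul, mul_pow]
    rcases Int.units_eq_one_or k.right with h | h <;> simp [h]

theorem sqCoord_toB (i : ℕ) (e : ESph G) : sqCoord i (toB σ e) = coord i e ^ 2 := rfl

theorem sqCoord_toB_ne_zero {i : ℕ} {e : ESph G} : sqCoord i (toB σ e) ≠ 0 ↔ coord i e ≠ 0 := by
  simp [sqCoord_toB]

theorem sqCoord_nonneg (i : ℕ) (b : BSph σ) : 0 ≤ sqCoord i b := by
  induction b using Quotient.inductionOn
  exact sq_nonneg _

theorem finsum_sqCoord (b : BSph σ) : ∑ᶠ i, sqCoord i b = 1 := by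
  induction b using Quotient.inductionOn with | _ e
  exact finsum_coord_sq e

variable [DiffeologicalSpace G]

theorem isSubduction_toB : IsSubduction (toB σ) := isSubduction_quotient_mk _

theorem dSmooth_sqCoord (i : ℕ) : DSmooth (sqCoord i : BSph σ → ℝ) :=
  isSubduction_toB.dSmooth_of_comp ((dSmooth_coord i).comp_contDiff (k := fun t => t ^ 2)
    (by fun_prop))

theorem plotLocallyFinite_coord : PlotLocallyFinite (fun i (e : ESph G) => coord i e) :=
  fun n p u hp => by
    obtain ⟨I, c, g, -, -, h⟩ := (isPlotAt_of_isPlot hp u).exists_chart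
    exact ⟨I, h.mono fun v hv => hv.1⟩

theorem plotLocallyFinite_sqCoord : PlotLocallyFinite (fun i (b : BSph σ) => sqCoord i b) :=
  fun n p u hp => by
    obtain ⟨q, hq, he⟩ := (isSubduction_iff.1 (isSubduction_toB (σ := σ))).2.2 n p u hp
    obtain ⟨I, hI⟩ := plotLocallyFinite_coord n q u hq
    refine ⟨I, ?_⟩
    filter_upwards [he, hI] with v h1 h2 i hi
    rw [h1, sqCoord_toB, h2 i hi]
    simp

end Twisted

/-! ### Principal bundles -/

namespace HSpaceOver

variable {H : Type u} [Group H] [DiffeologicalSpace H] {X : Type v} [DiffeologicalSpace X]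
  {P : HSpaceOver.{u, v, w} H X} {n : ℕ}

/-- Freeness and transitivity on fibres make `(p, h) ↦ (p, h • p)` bijective onto the fibre product;
smoothness of its inverse is precisely the statement `h_div` about quotients of plots. -/
theorem isPrincipal_of_div (h_act : DSmooth (fun a : H × P.Total => a.1 • a.2))
    (h_sub : IsSubduction P.proj) (h_free : ∀ (h : H) (p : P.Total), h • p = p → h = 1)
    (h_trans : ∀ p q : P.Total, P.proj p = P.proj q → ∃ h : H, q = h • p)
    (h_div : ∀ (n : ℕ) (a b : Eu n → P.Total) (h : Eu n → H), IsPlot a → IsPlot b →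
      (∀ v, b v = h v • a v) → IsPlot h) : P.IsPrincipal where
  smooth_smul := h_act
  subduction := h_sub
  diffeo := by
    let φ : P.Total × H → {q : P.Total × P.Total // P.proj q.1 = P.proj q.2} := fun a =>
      ⟨(a.1, a.2 • a.1), (P.proj_smul a.2 a.1).symm⟩
    have hφ : Function.Bijective φ := by
      constructor
      · rintro ⟨p, h⟩ ⟨q, k⟩ hpq
        have h1 : p = q := congrArg (fun a => a.1.1) hpq
        have h2 : h • p = k • q := congrArg (fun a => a.1.2) hpq
        subst h1
        have h3 : (k⁻¹ * h) • p = p := by rw [mul_smul, h2, inv_smul_smul]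
        rw [inv_mul_eq_one.1 (h_free _ _ h3)]
      · rintro ⟨⟨p, q⟩, hpq⟩
        obtain ⟨h, rfl⟩ := h_trans p q hpq
        exact ⟨(p, h), rfl⟩
    refine ⟨Equiv.ofBijective φ hφ, ⟨?_, ?_⟩, fun p h => rfl⟩
    · exact dSmooth_subtype_mk (dSmooth_pair dSmooth_fst
        (h_act.comp (dSmooth_pair dSmooth_snd dSmooth_fst))) _
    · intro n q hq
      have hq' := isPlot_prod_iff.1 (isPlot_subtype_iff.1 hq)
      have key : ∀ v, φ ((Equiv.ofBijective φ hφ).symm (q v)) = q v := fun v =>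
        (Equiv.ofBijective φ hφ).apply_symm_apply (q v)
      have h1 : ∀ v, ((Equiv.ofBijective φ hφ).symm (q v)).1 = (q v).1.1 := fun v =>
        congrArg (fun a => a.1.1) (key v)
      refine isPlot_prod_iff.2 ⟨(funext h1 : _ = fun v => (q v).1.1) ▸ hq'.1,
        h_div n _ _ _ hq'.1 hq'.2 fun v => ?_⟩
      rw [← h1]
      exact (congrArg (fun a => a.1.2) (key v)).symm

namespace IsPrincipal

theorem exists_smul_eq (hP : P.IsPrincipal) {p q : P.Total} (h : P.proj p = P.proj q) : ∃ k : H, q = k • p := by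
  obtain ⟨e, -, he⟩ := hP.diffeo
  have h1 := he (e.symm ⟨(p, q), h⟩).1 (e.symm ⟨(p, q), h⟩).2
  rw [Prod.mk.eta, Equiv.apply_symm_apply, Prod.ext_iff] at h1
  exact ⟨_, h1.2.trans (congrArg _ h1.1.symm)⟩

theorem eq_of_smul_eq (hP : P.IsPrincipal) {p : P.Total} {h k : H} (hk : h • p = k • p) : h = k := by
  obtain ⟨e, -, he⟩ := hP.diffeo
  have : e (p, h) = e (p, k) := Subtype.ext (by rw [he, he, hk])
  exact congrArg Prod.snd (e.injective this)

theorem isPlot_div (hP : P.IsPrincipal) {a b : Eu n → P.Total} {h : Eu n → H} (ha : IsPlot a) (hb : IsPlot b)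
    (hab : ∀ v, b v = h v • a v) : IsPlot h := by
  obtain ⟨e, he, he'⟩ := hP.diffeo
  have hproj : ∀ v, P.proj (a v) = P.proj (b v) := fun v => by rw [hab, P.proj_smul]
  have hq : IsPlot (fun v => (⟨(a v, b v), hproj v⟩ :
      {q : P.Total × P.Total // P.proj q.1 = P.proj q.2})) :=
    isPlot_subtype_iff.2 (isPlot_prod_iff.2 ⟨ha, hb⟩)
  have h1 := (isPlot_prod_iff.1 (he.smooth_symm _ _ hq)).2
  convert h1 using 2 with v
  have : e (a v, h v) = ⟨(a v, b v), hproj v⟩ := Subtype.ext ((he' _ _).trans (by rw [← hab]))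
  simp [← this]

theorem isPlotAt_div (hP : P.IsPrincipal) {a b : Eu n → P.Total} {h : Eu n → H} {u : Eu n} (ha : IsPlotAt a u)
    (hb : IsPlotAt b u) (hab : ∀ᶠ v in 𝓝 u, b v = h v • a v) : IsPlotAt h u := by
  obtain ⟨a', ha', hae⟩ := ha
  obtain ⟨b', hb', hbe⟩ := hb
  obtain ⟨ψ, hψ, hψN, hid⟩ := exists_contDiff_retract (hab.and (hae.and hbe))
  refine ⟨h ∘ ψ, hP.isPlot_div (isPlot_reparam ha' hψ) (isPlot_reparam hb' hψ) fun v => ?_, ?_⟩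
  · obtain ⟨h1, h2, h3⟩ := hψN v
    simp only [Function.comp, ← h2, ← h3, h1]
  · filter_upwards [hid] with v hv
    rw [Function.comp, hv, id]

theorem isPlotAt_smul (hP : P.IsPrincipal) {h : Eu n → H} {a : Eu n → P.Total} {u : Eu n} (hh : IsPlotAt h u)
    (ha : IsPlotAt a u) : IsPlotAt (fun v => h v • a v) u :=
  hP.smooth_smul.isPlotAt (hh.pair ha)

theorem dSmooth_proj (hP : P.IsPrincipal) : DSmooth P.proj := (isSubduction_iff.1 hP.subduction).2.1

theorem exists_lift (hP : P.IsPrincipal) {a : Eu n → X} (ha : IsPlot a) (u : Eu n) :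
    ∃ p : Eu n → P.Total, IsPlot p ∧ a =ᶠ[𝓝 u] fun v => P.proj (p v) :=
  (isSubduction_iff.1 hP.subduction).2.2 n a u ha

/-- A smooth equivariant map over the base between principal bundles is an isomorphism. -/
theorem iso_of_equivariant (hP : P.IsPrincipal) {Q : HSpaceOver.{u, v, w} H X} (hQ : Q.IsPrincipal)
    {φ : P.Total → Q.Total} (hφ : DSmooth φ) (h_eq : ∀ (h : H) p, φ (h • p) = h • φ p)
    (h_over : ∀ p, Q.proj (φ p) = P.proj p) : P.Iso Q := by
  have hb : Function.Bijective φ := by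
    constructor
    · intro p q hpq
      obtain ⟨k, rfl⟩ := hP.exists_smul_eq (p := p) (q := q) (by rw [← h_over, hpq, h_over])
      have : (1 : H) • φ p = k • φ p := by rw [one_smul, ← h_eq, ← hpq]
      rw [← hQ.eq_of_smul_eq this, one_smul]
    · intro y
      obtain ⟨p, hp⟩ := hP.subduction.1 (Q.proj y)
      obtain ⟨k, rfl⟩ := hQ.exists_smul_eq (p := φ p) (q := y) (by rw [h_over, hp])
      exact ⟨k • p, h_eq k p⟩
  refine ⟨Equiv.ofBijective φ hb, ⟨hφ, dSmooth_of_isPlotAt fun n y u hy => ?_⟩, h_eq, h_over⟩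
  -- Near `u`, lift the projection of `y` to a plot `p` of `P` and write `y = k • φ p`. The factor
  -- `k` is smooth by division in `Q`, and the inverse image of `y` is `k • p`.
  obtain ⟨p, hp, he⟩ := hP.exists_lift (hQ.dSmooth_proj n y hy) u
  have hex : ∀ v, ∃ k : H, Q.proj (φ (p v)) = Q.proj (y v) → y v = k • φ (p v) := fun v => by
    by_cases h : Q.proj (φ (p v)) = Q.proj (y v)
    · obtain ⟨k, hk⟩ := hQ.exists_smul_eq h
      exact ⟨k, fun _ => hk⟩
    · exact ⟨1, fun h' => absurd h' h⟩
  choose k hk using hex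
  have hev : ∀ᶠ v in 𝓝 u, y v = k v • φ (p v) := he.mono fun v hv =>
    hk v (by rw [h_over]; exact hv.symm)
  have hk' : IsPlotAt k u :=
    hQ.isPlotAt_div (isPlotAt_of_isPlot (hφ n p hp) u) (isPlotAt_of_isPlot hy u) hev
  refine (hP.isPlotAt_smul hk' (isPlotAt_of_isPlot hp u)).congr (hev.mono fun v hv => ?_)
  rw [Equiv.symm_apply_eq]
  exact hv.trans (h_eq _ _).symm

/-- A smooth equivariant map to the structure group over `U` trivialises the bundle over `U`. -/
theorem isTrivialOver_of_frame (hP : P.IsPrincipal) [DiffeologicalGroup H] {U : Set X} {τ : P.Total → H}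
    (hτ : DSmoothOn τ (P.proj ⁻¹' U))
    (h_eq : ∀ (h : H) p, P.proj p ∈ U → τ (h • p) = h * τ p) : P.IsTrivialOver U := by
  choose s hs using hP.subduction.1
  -- The point `(k * (τ p)⁻¹) • p` depends only on the fibre of `p`. Hence the arbitrary section `s`
  -- may be replaced locally by a smooth lift when smoothness is checked.
  have key : ∀ (p q : P.Total) (k : H), P.proj p ∈ U → P.proj p = P.proj q →
      (k * (τ p)⁻¹) • p = (k * (τ q)⁻¹) • q := fun p q k hp hpq => by
    obtain ⟨l, rfl⟩ := hP.exists_smul_eq hpq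
    rw [h_eq l p hp, mul_inv_rev, ← mul_smul]
    simp [mul_assoc]
  have hmem : ∀ (x : {x : X // x ∈ U}) (k : H), P.proj (k • s x.1) ∈ U := fun x k => by
    rw [P.proj_smul, hs]
    exact x.2
  refine ⟨{ toFun := fun a => ⟨(a.2 * (τ (s a.1))⁻¹) • s a.1, hmem a.1 _⟩
            invFun := fun p => (⟨P.proj p.1, p.2⟩, τ p.1)
            left_inv := ?_
            right_inv := ?_ }, ⟨?_, ?_⟩, ?_, ?_⟩
  · rintro ⟨x, h⟩
    refine Prod.ext (Subtype.ext ?_) ?_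
    · simp only [P.proj_smul, hs]
    · simp only [h_eq _ _ (show P.proj (s x.1) ∈ U by rw [hs]; exact x.2), inv_mul_cancel_right]
  · rintro ⟨p, hp⟩
    refine Subtype.ext ?_
    simp only
    rw [key (s (P.proj p)) p _ (by rw [hs]; exact hp) (hs _), mul_inv_cancel, one_smul]
  · refine dSmooth_of_isPlotAt fun n a u ha => ?_
    have ha' := isPlot_prod_iff.1 ha
    obtain ⟨p, hp, he⟩ := hP.exists_lift (isPlot_subtype_iff.1 ha'.1) u
    have hu : P.proj (p u) ∈ U := he.eq_of_nhds ▸ (a u).1.2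
    have hinv := DiffeologicalGroup.smooth_inv.isPlotAt (hτ n p u hp hu)
    have h1 := hP.isPlotAt_smul (DiffeologicalGroup.smooth_mul.isPlotAt
      ((isPlotAt_of_isPlot ha'.2 u).pair hinv)) (isPlotAt_of_isPlot hp u)
    have h2 : IsPlotAt (fun v => ((a v).2 * (τ (s (a v).1))⁻¹) • s (a v).1) u := by
      refine h1.congr (he.mono fun v hv => ?_)
      exact key _ _ _ (by rw [hs]; exact (a v).1.2) (by rw [hs]; exact hv)
    obtain ⟨q, hq, hqe⟩ := h2
    obtain ⟨ψ, hψ, hψN, hid⟩ := exists_contDiff_retract hqe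
    refine ⟨fun v => ⟨((a (ψ v)).2 * (τ (s (a (ψ v)).1))⁻¹) • s (a (ψ v)).1,
      hmem (a (ψ v)).1 _⟩, ?_, ?_⟩
    · refine isPlot_subtype_iff.2 ?_
      rw [show (fun v => ((a (ψ v)).2 * (τ (s (a (ψ v)).1))⁻¹) • s (a (ψ v)).1) = q ∘ ψ from
        funext fun v => hψN v]
      exact isPlot_reparam hq hψ
    · filter_upwards [hid] with v hv
      rw [hv, id]
      rfl
  · intro n p hp
    refine isPlot_prod_iff.2 ⟨hP.dSmooth_proj.comp dSmooth_subtype_val n p hp, ?_⟩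
    exact isPlot_of_isPlotAt fun u => hτ n _ u (isPlot_subtype_iff.1 hp) (p u).2
  · intro x h
    exact (P.proj_smul _ _).trans (hs _)
  · intro x h k
    simp only [Equiv.coe_fn_mk, mul_smul]

theorem exists_frame_of_isTrivialOver (hP : P.IsPrincipal) {U : Set X} (hU : IsOpen[dTopology] U)
    (h : P.IsTrivialOver U) : ∃ τ : P.Total → H, DSmoothOn τ (P.proj ⁻¹' U) ∧
      ∀ (h : H) p, P.proj p ∈ U → τ (h • p) = h * τ p := by
  classical
  obtain ⟨e, he, h_over, h_eq⟩ := h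
  refine ⟨fun p => if hp : P.proj p ∈ U then (e.symm ⟨p, hp⟩).2 else 1, ?_, ?_⟩
  · intro n p u hp hu
    have hN := eventually_mem_of_isOpen hU (hP.dSmooth_proj n p hp) hu
    obtain ⟨ψ, hψ, hψN, hid⟩ := exists_contDiff_retract hN
    have hq : IsPlot (fun v => (⟨p (ψ v), hψN v⟩ : {p : P.Total // P.proj p ∈ U})) :=
      isPlot_subtype_iff.2 (isPlot_reparam hp hψ)
    refine ⟨_, (isPlot_prod_iff.1 (he.smooth_symm n _ hq)).2, ?_⟩
    filter_upwards [hid] with v hv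
    have : P.proj (p v) ∈ U := by
      have := hψN v
      rwa [hv] at this
    simp only [this, dite_true, Function.comp, hv, id]
  · intro k p hp
    have hkp : P.proj (k • p) ∈ U := by rwa [P.proj_smul]
    simp only [hp, hkp, dite_true]
    have h1 : (⟨k • p, hkp⟩ : {p : P.Total // P.proj p ∈ U}) =
        e ((e.symm ⟨p, hp⟩).1, k * (e.symm ⟨p, hp⟩).2) := by
      refine Subtype.ext ?_
      rw [h_eq, Prod.mk.eta, Equiv.apply_symm_apply]
    rw [h1, Equiv.symm_apply_apply]

end IsPrincipal

/-! ### Pull-backs -/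

theorem dSmooth_pullback_snd {H : Type u} [Group H] {X : Type v} [DiffeologicalSpace X] {Y : Type w}
    {Q : HSpaceOver.{u, w, u} H Y} {f : X → Y} : DSmooth (fun a : (Q.pullback f).Total => a.1.2) :=
  dSmooth_snd.comp dSmooth_subtype_val

variable {Y : Type w} [DiffeologicalSpace Y] {Q : HSpaceOver.{u, w, u} H Y} {f : X → Y}

theorem IsPrincipal.pullback (hQ : Q.IsPrincipal) (hf : DSmooth f) :
    (Q.pullback f).IsPrincipal := by
  refine isPrincipal_of_div ?_ (isSubduction_iff.2 ⟨?_, ?_, ?_⟩) ?_ ?_ ?_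
  · exact dSmooth_subtype_mk (dSmooth_pair
      (dSmooth_fst.comp (dSmooth_subtype_val.comp dSmooth_snd))
      (hQ.smooth_smul.comp (dSmooth_pair dSmooth_fst (dSmooth_pullback_snd.comp dSmooth_snd)))) _
  · intro x
    obtain ⟨p, hp⟩ := hQ.subduction.1 (f x)
    exact ⟨⟨(x, p), hp.symm⟩, rfl⟩
  · exact dSmooth_fst.comp dSmooth_subtype_val
  · intro n a u ha
    obtain ⟨p, hp, he⟩ := hQ.exists_lift (hf n a ha) u
    obtain ⟨ψ, hψ, hψN, hid⟩ := exists_contDiff_retract he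
    refine ⟨fun v => ⟨(a (ψ v), p (ψ v)), hψN v⟩, isPlot_subtype_iff.2
      (isPlot_prod_iff.2 ⟨isPlot_reparam ha hψ, isPlot_reparam hp hψ⟩), ?_⟩
    filter_upwards [hid] with v hv
    rw [hv, id]
  · intro h p hp
    have : h • p.1.2 = (1 : H) • p.1.2 :=
      (congrArg (fun a : (Q.pullback f).Total => a.1.2) hp).trans (one_smul _ _).symm
    exact hQ.eq_of_smul_eq this
  · rintro ⟨⟨x, p⟩, hp⟩ ⟨⟨y, q⟩, hq⟩ hxy
    obtain rfl : x = y := hxy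
    obtain ⟨k, rfl⟩ := hQ.exists_smul_eq (hp.symm.trans hq)
    exact ⟨k, rfl⟩
  · intro n a b h ha hb hab
    exact hQ.isPlot_div (dSmooth_pullback_snd n a ha) (dSmooth_pullback_snd n b hb) fun v =>
      congrArg (fun a : (Q.pullback f).Total => a.1.2) (hab v)

/-- A bundle map over `f` identifies its source with the pull-back along `f`. -/
theorem IsPrincipal.iso_pullback {P : HSpaceOver.{u, v, max u v} H X} (hP : P.IsPrincipal)
    (hQ : Q.IsPrincipal) (hf : DSmooth f) {φ : P.Total → Q.Total} (hφ : DSmooth φ)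
    (h_eq : ∀ (h : H) p, φ (h • p) = h • φ p) (h_over : ∀ p, Q.proj (φ p) = f (P.proj p)) :
    P.Iso (Q.pullback f) :=
  hP.iso_of_equivariant (hQ.pullback hf)
    (φ := fun p => ⟨(P.proj p, φ p), (h_over p).symm⟩)
    (dSmooth_subtype_mk (dSmooth_pair hP.dSmooth_proj hφ) _)
    (fun h p => Subtype.ext (Prod.ext (P.proj_smul h p) (h_eq h p))) fun _ => rfl

end HSpaceOver

/-! ### The universal bundle -/

section Universal

variable {G : Type u} [Group G] [DiffeologicalSpace G] [DiffeologicalGroup G]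
  {σ : ℤˣ →* MulAut G}

/-- At any point some coordinate `i` is non-zero, and there the element carrying `a` to `b` is the
`i`-th frame of `b` times the inverse of the `i`-th frame of `a`. -/
theorem isPrincipal_universalBundle (hσ : DSmooth (fun a : ℤˣ × G => σ a.1 a.2))
    (hsmooth : DSmooth (fun a : (G ⋊[σ] ℤˣ) × ESph G => a.1 • a.2))
    (hfree : ∀ (h : G ⋊[σ] ℤˣ) (e : ESph G), h • e = e → h = 1) :
    (universalBundle σ).IsPrincipal := by
  have hH := diffeologicalGroup_semidirect hσ
  refine HSpaceOver.isPrincipal_of_div hsmooth isSubduction_toB hfree ?_ ?_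
  · intro p q hpq
    obtain ⟨k, hk⟩ := Quotient.exact hpq.symm
    exact ⟨k, hk.symm⟩
  · intro n a b h ha hb hab
    refine isPlot_of_isPlotAt fun u => ?_
    obtain ⟨i, hi⟩ := exists_coord_ne_zero (a u)
    have hbi : coord i (b u) ≠ 0 := by
      rw [hab]
      exact coord_smul_ne_zero.2 hi
    refine (DiffeologicalGroup.smooth_mul.isPlotAt ((dSmoothOn_frame i n b u hb hbi).pair
      (DiffeologicalGroup.smooth_inv.isPlotAt (dSmoothOn_frame i n a u ha hi)))).congr ?_
    filter_upwards [(IsPlot.continuous_real (dSmooth_coord i n a ha)).continuousAt.eventually_ne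
      hi] with v hv
    rw [hab v, frame_smul _ hv, mul_inv_cancel_right]

end Universal

/-! ### Shrinking a locally finite family of functions -/

section Shrink

variable {X : Type v} [DiffeologicalSpace X] {ι : Type w}

/-- The quantity `2 η_i ∑ η_j - ∑ η_j ^ 2`; it is positive for some `i`, and `η_i ≠ 0` where it is
non-negative. -/
noncomputable def gap {X : Type v} (η : ι → X → ℝ) (i : ι) (x : X) : ℝ :=
  2 * η i x * (∑ᶠ j, η j x) - ∑ᶠ j, η j x ^ 2

/-- A bump function supported where `gap η i` is positive. -/
noncomputable def shrink {X : Type v} (η : ι → X → ℝ) (i : ι) (x : X) : ℝ :=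
  expNegInvGlue (gap η i x)

/-- The normalised bump functions. -/
noncomputable def shrinkPartition {X : Type v} (η : ι → X → ℝ) (i : ι) (x : X) : ℝ :=
  shrink η i x / ∑ᶠ j, shrink η j x

/-- A family of smooth non-negative functions, locally finite along plots, without common zeros. -/
structure IsNumeration (η : ι → X → ℝ) : Prop where
  smooth : ∀ i, DSmooth (η i)
  nonneg : ∀ i x, 0 ≤ η i x
  locallyFinite : PlotLocallyFinite η
  exists_ne_zero : ∀ x, ∃ i, η i x ≠ 0

theorem shrink_nonneg {X : Type v} (η : ι → X → ℝ) (i : ι) (x : X) : 0 ≤ shrink η i x :=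
  expNegInvGlue.nonneg _

theorem shrink_ne_zero_iff {X : Type v} {η : ι → X → ℝ} {i : ι} {x : X} :
    shrink η i x ≠ 0 ↔ 0 < gap η i x := by
  constructor
  · intro h
    by_contra h'
    exact h (expNegInvGlue.zero_of_nonpos (not_lt.1 h'))
  · exact fun h => (expNegInvGlue.pos_of_pos h).ne'

namespace IsNumeration

variable {η : ι → X → ℝ}

theorem comp (hη : IsNumeration η) {Y : Type u} [DiffeologicalSpace Y] {f : Y → X}
    (hf : DSmooth f) : IsNumeration (fun i y => η i (f y)) where
  smooth i := (hη.smooth i).comp hf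
  nonneg i y := hη.nonneg i (f y)
  locallyFinite := hη.locallyFinite.comp hf
  exists_ne_zero y := hη.exists_ne_zero (f y)

theorem locallyFinite_sq (hη : IsNumeration η) : PlotLocallyFinite (fun i x => η i x ^ 2) :=
  hη.locallyFinite.mono fun i x h => by simp [h]

theorem finsum_pos (hη : IsNumeration η) (x : X) : 0 < ∑ᶠ i, η i x := by
  obtain ⟨i, hi⟩ := hη.exists_ne_zero x
  exact _root_.finsum_pos (fun j => hη.nonneg j x) ⟨i, (hη.nonneg i x).lt_of_ne' hi⟩
    (hη.locallyFinite.finite x)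

theorem finsum_sq_pos (hη : IsNumeration η) (x : X) : 0 < ∑ᶠ i, η i x ^ 2 := by
  obtain ⟨i, hi⟩ := hη.exists_ne_zero x
  exact _root_.finsum_pos (fun j => sq_nonneg _) ⟨i, by positivity⟩ (hη.locallyFinite_sq.finite x)

theorem dSmooth_finsum (hη : IsNumeration η) : DSmooth (fun x => ∑ᶠ i, η i x) :=
  hη.locallyFinite.dSmooth_finsum hη.smooth

theorem dSmooth_finsum_sq (hη : IsNumeration η) : DSmooth (fun x => ∑ᶠ i, η i x ^ 2) :=
  hη.locallyFinite_sq.dSmooth_finsum fun i =>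
    (hη.smooth i).comp_contDiff (k := fun t => t ^ 2) (by fun_prop)

theorem dSmooth_gap (hη : IsNumeration η) (i : ι) : DSmooth (gap η i) :=
  (((dSmooth_const (y := (2 : ℝ))).mul_real (hη.smooth i)).mul_real hη.dSmooth_finsum).sub_real
    hη.dSmooth_finsum_sq

theorem gap_neg_of_eq_zero (hη : IsNumeration η) {i : ι} {x : X} (h : η i x = 0) :
    gap η i x < 0 := by
  simpa [gap, h] using hη.finsum_sq_pos x

theorem ne_zero_of_gap_nonneg (hη : IsNumeration η) {i : ι} {x : X} (h : 0 ≤ gap η i x) :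
    η i x ≠ 0 :=
  fun h' => h.not_gt (hη.gap_neg_of_eq_zero h')

/-- The average of the gaps with weights `η_i` equals `(∑ η_j ^ 2) * (∑ η_j) > 0` up to
normalisation, so they cannot all be non-positive. Here `gap` is a smooth substitute for comparing
`η_i` with the maximum of the family. -/
theorem exists_gap_pos (hη : IsNumeration η) (x : X) : ∃ i, 0 < gap η i x := by
  by_contra! h
  obtain ⟨I, hI⟩ := hη.locallyFinite 0 (fun _ => x) 0 isPlot_const
  have hI' := hI.self_of_nhds
  have h1 := finsum_eq_sum_of_zero hI'
  have h2 : ∑ᶠ i, η i x ^ 2 = ∑ i ∈ I, η i x ^ 2 :=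
    finsum_eq_sum_of_zero fun i hi => by rw [hI' i hi]; simp
  have h3 : ∑ i ∈ I, η i x * gap η i x ≤ 0 :=
    Finset.sum_nonpos fun i _ => mul_nonpos_of_nonneg_of_nonpos (hη.nonneg i x) (h i)
  have h4 : ∑ i ∈ I, η i x * gap η i x = (∑ᶠ i, η i x ^ 2) * ∑ᶠ i, η i x := by
    have : ∀ i, η i x * gap η i x =
        2 * (∑ᶠ j, η j x) * η i x ^ 2 - (∑ᶠ j, η j x ^ 2) * η i x := fun i => by
      rw [gap]; ring
    simp only [this, Finset.sum_sub_distrib, ← Finset.mul_sum]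
    rw [← h1, ← h2]
    ring
  have := mul_pos (hη.finsum_sq_pos x) (hη.finsum_pos x)
  linarith

theorem shrink_eq_zero (hη : IsNumeration η) {i : ι} {x : X} (h : η i x = 0) :
    shrink η i x = 0 :=
  expNegInvGlue.zero_of_nonpos (hη.gap_neg_of_eq_zero h).le

theorem shrink (hη : IsNumeration η) : IsNumeration (shrink η) where
  smooth i := (hη.dSmooth_gap i).comp_contDiff expNegInvGlue.contDiff
  nonneg := shrink_nonneg η
  locallyFinite := hη.locallyFinite.mono fun _ _ h => hη.shrink_eq_zero h
  exists_ne_zero x := (hη.exists_gap_pos x).imp fun _ h => shrink_ne_zero_iff.2 h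

theorem ne_zero_or_eventually_shrink_eq_zero (hη : IsNumeration η) (i : ι) {n : ℕ} {p : Eu n → X}
    (hp : IsPlot p) (u : Eu n) : η i (p u) ≠ 0 ∨ ∀ᶠ v in 𝓝 u, SphMilnor.shrink η i (p v) = 0 := by
  by_cases h : η i (p u) = 0
  · right
    filter_upwards [(IsPlot.continuous_real (hη.dSmooth_gap i n p hp)).continuousAt.eventually_lt_const
      (hη.gap_neg_of_eq_zero h)] with v hv
    exact expNegInvGlue.zero_of_nonpos hv.le
  · exact Or.inl h

theorem dSmooth_shrinkPartition (hη : IsNumeration η) (i : ι) : DSmooth (shrinkPartition η i) :=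
  (hη.shrink.smooth i).div_real hη.shrink.dSmooth_finsum fun x => (hη.shrink.finsum_pos x).ne'

theorem shrinkPartition_nonneg (hη : IsNumeration η) (i : ι) (x : X) :
    0 ≤ shrinkPartition η i x :=
  div_nonneg (shrink_nonneg η i x) (hη.shrink.finsum_pos x).le

theorem finsum_shrinkPartition (hη : IsNumeration η) (x : X) :
    ∑ᶠ i, shrinkPartition η i x = 1 := by
  simp only [shrinkPartition, div_eq_mul_inv]
  rw [← finsum_mul, mul_inv_cancel₀ (hη.shrink.finsum_pos x).ne']

theorem gap_pos_of_shrinkPartition_ne_zero {X : Type v} {η : ι → X → ℝ} {i : ι} {x : X}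
    (h : shrinkPartition η i x ≠ 0) : 0 < gap η i x :=
  shrink_ne_zero_iff.1 fun h' => h (by rw [shrinkPartition, h', zero_div])

theorem locallyFinite_shrinkPartition (hη : IsNumeration η) :
    PlotLocallyFinite (shrinkPartition η) :=
  hη.shrink.locallyFinite.mono fun i x h => by rw [shrinkPartition, h, zero_div]

/-- A zero of `η i` has `gap η i < 0`, an open condition, whereas the `i`-th bump function lives
where `gap η i > 0`. This margin keeps closed supports inside `{η i ≠ 0}` and upgrades local
finiteness along plots to local finiteness for the D-topology. -/
theorem isSmoothPartition {ι : Type v} {η : ι → X → ℝ} (hη : IsNumeration η) :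
    HSpaceOver.IsSmoothPartition (fun i => {x | η i x ≠ 0}) (shrinkPartition η) where
  isOpen i := isOpen_dTopology_ne (hη.smooth i)
  cover := hη.exists_ne_zero
  smooth := hη.dSmooth_shrinkPartition
  nonneg := hη.shrinkPartition_nonneg
  support_subset i := (closure_dTopology_subset_le (f := fun _ => 0) dSmooth_const
    (hη.dSmooth_gap i) fun _ hx => (gap_pos_of_shrinkPartition_ne_zero hx).le).trans
      fun _ hx => hη.ne_zero_of_gap_nonneg hx
  locallyFinite x := by
    obtain ⟨I, hI⟩ := hη.locallyFinite 0 (fun _ => x) 0 isPlot_const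
    -- Infinitely many inequalities still define a D-open set: along a plot all but finitely many `η
    -- i` vanish locally, and for those the inequality is automatic.
    refine ⟨{y | ∀ i ∉ I, gap η i y < 0}, isOpen_dTopology_of_eventually fun n p u hp hu => ?_,
      fun i hi => hη.gap_neg_of_eq_zero (hI.self_of_nhds i hi), I.finite_toSet.subset ?_⟩
    · classical
      obtain ⟨J, hJ⟩ := hη.locallyFinite n p u hp
      have hfin : ∀ᶠ v in 𝓝 u, ∀ i ∈ J \ I, gap η i (p v) < 0 :=
        (eventually_all_finset _).2 fun i hi =>
          (IsPlot.continuous_real (hη.dSmooth_gap i n p hp)).continuousAt.eventually_lt_const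
            (hu i (Finset.mem_sdiff.1 hi).2)
      filter_upwards [hJ, hfin] with v h1 h2 i hi
      by_cases hiJ : i ∈ J
      · exact h2 i (Finset.mem_sdiff.2 ⟨hiJ, hi⟩)
      · exact hη.gap_neg_of_eq_zero (h1 i hiJ)
    · rintro i ⟨y, hy, hyW⟩
      by_contra hi
      exact (hyW i hi).not_gt (gap_pos_of_shrinkPartition_ne_zero hy)
  sum_eq_one := hη.finsum_shrinkPartition

end IsNumeration

end Shrink

/-! ### Numerability of pull-backs of the universal bundle -/

section Pullback

variable {G : Type u} [Group G] [DiffeologicalSpace G] {σ : ℤˣ →* MulAut G}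

theorem isNumeration_sqCoord : IsNumeration (fun i (b : BSph σ) => sqCoord i b) where
  smooth := dSmooth_sqCoord
  nonneg := sqCoord_nonneg
  locallyFinite := plotLocallyFinite_sqCoord
  exists_ne_zero b := by
    by_contra! h
    simpa [h] using finsum_sqCoord b

/-- The index type in `IsDNumerable` lives in the universe of the base, so the index set `ℕ` has to
be lifted. -/
theorem IsNumeration.uLift {X : Type v} [DiffeologicalSpace X] {ι : Type w} {η : ι → X → ℝ}
    (hη : IsNumeration η) : IsNumeration (fun (i : ULift.{u} ι) x => η i.down x) where
  smooth i := hη.smooth i.down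
  nonneg i := hη.nonneg i.down
  locallyFinite n p u hp := by
    obtain ⟨I, hI⟩ := hη.locallyFinite n p u hp
    refine ⟨I.map Equiv.ulift.symm.toEmbedding, hI.mono fun v hv i hi => hv _ fun h => hi ?_⟩
    exact Finset.mem_map.2 ⟨i.down, h, rfl⟩
  exists_ne_zero x := (hη.exists_ne_zero x).elim fun i hi => ⟨⟨i⟩, hi⟩

theorem isDNumerable_pullback [DiffeologicalGroup G]
    (hσ : DSmooth (fun a : ℤˣ × G => σ a.1 a.2)) (hE : (universalBundle σ).IsPrincipal)
    {X : Type v} [DiffeologicalSpace X] {f : X → BSph σ} (hf : DSmooth f) :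
    ((universalBundle σ).pullback f).IsDNumerable := by
  have hH := diffeologicalGroup_semidirect hσ
  refine ⟨ULift.{v} ℕ, _, _, (isNumeration_sqCoord.comp hf).uLift.isSmoothPartition, fun i => ?_⟩
  have hne : ∀ p : ((universalBundle σ).pullback f).Total,
      sqCoord i.down (f p.1.1) ≠ 0 → coord i.down p.1.2 ≠ 0 := fun p hp =>
    sqCoord_toB_ne_zero.1 fun h => hp ((congrArg (sqCoord i.down) p.2).trans h)
  refine (hE.pullback hf).isTrivialOver_of_frame (τ := fun p => frame σ i.down p.1.2) ?_ ?_
  · intro n p u hp hu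
    exact dSmoothOn_frame i.down n _ u (HSpaceOver.dSmooth_pullback_snd n p hp) (hne _ hu)
  · intro h p hp
    exact frame_smul h (hne p hp)

end Pullback

/-! ### Derivatives and integrals along the time coordinate -/

section Calculus

/-- The integral is the value at `0` of a convolution with an indicator function, which is smooth in
the parameter once the integrand has compact support in `s`. -/
theorem contDiff_intervalIntegral {V : Type u} [NormedAddCommGroup V] [NormedSpace ℝ V]
    {h : V × ℝ → ℝ} (hh : ContDiff ℝ ∞ h) : ContDiff ℝ ∞ (fun x => ∫ s in (0 : ℝ)..1, h (x, s)) := by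
  let χ : ContDiffBump (0 : ℝ) := ⟨2, 3, by norm_num, by norm_num⟩
  -- Convolution at `0` evaluates `f` at `-s`, and `-s ∈ [-1, 0)` means `s ∈ (0, 1]`. The cut-off
  -- `χ` equals `1` there.
  let f : ℝ → ℝ := (Set.Ico (-1 : ℝ) 0).indicator fun _ => 1
  have hf : MeasureTheory.LocallyIntegrable f MeasureTheory.volume :=
    (MeasureTheory.locallyIntegrable_const 1).indicator measurableSet_Ico
  have key := MeasureTheory.contDiffOn_convolution_right_with_param_comp (μ := MeasureTheory.volume) (n := ⊤)
    (ContinuousLinearMap.mul ℝ ℝ) (s := (Set.univ : Set V)) (v := fun _ => (0 : ℝ))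
    contDiffOn_const (f := f) (g := fun x s => χ s * h (x, s)) isOpen_univ
    (isCompact_closedBall (0 : ℝ) 3) (fun x s _ hs => by
      rw [χ.zero_of_le_dist (not_le.1 fun h' => hs (Metric.mem_closedBall.2 h')).le, zero_mul]) hf
    (((χ.contDiff.comp contDiff_snd).mul hh).contDiffOn)
  rw [contDiffOn_univ] at key
  convert key using 2 with x
  rw [MeasureTheory.convolution_eq_swap, intervalIntegral.integral_of_le zero_le_one,
    ← MeasureTheory.integral_indicator measurableSet_Ioc]
  congr 1
  funext s
  simp only [ContinuousLinearMap.mul_apply', f, zero_sub, Set.indicator_apply, Set.mem_Ico,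
    Set.mem_Ioc]
  by_cases hs : 0 < s ∧ s ≤ 1
  · have h2 : -1 ≤ -s ∧ -s < 0 := by constructor <;> linarith [hs.1, hs.2]
    rw [if_pos hs, if_pos h2, χ.one_of_mem_closedBall, one_mul, one_mul]
    simp only [Metric.mem_closedBall, dist_zero_right, Real.norm_eq_abs, χ]
    rw [abs_le]
    constructor <;> linarith [hs.1, hs.2]
  · have h2 : ¬(-1 ≤ -s ∧ -s < 0) := fun h => hs ⟨by linarith [h.2], by linarith [h.1]⟩
    rw [if_neg hs, if_neg h2, zero_mul]

variable {X : Type v} [DiffeologicalSpace X]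

instance isContDiffCompatible_prod {V : Type u} {W : Type w} [NormedAddCommGroup V]
    [NormedSpace ℝ V] [DiffeologicalSpace V] [IsContDiffCompatible V] [NormedAddCommGroup W]
    [NormedSpace ℝ W] [DiffeologicalSpace W] [IsContDiffCompatible W] :
    IsContDiffCompatible (V × W) where
  isPlot_iff := by
    intro n p
    rw [isPlot_prod_iff, isPlot_iff_contDiff, isPlot_iff_contDiff, contDiff_prod_iff]
    rfl

theorem contDiff_of_dSmooth_prod {K : X × ℝ → ℝ} (hK : DSmooth K) {n : ℕ} {p : Eu n → X}
    (hp : IsPlot p) : ContDiff ℝ ∞ (fun a : Eu n × ℝ => K (p a.1, a.2)) :=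
  DSmooth.contDiff (hK.comp (dSmooth_pair ((IsPlot.dSmooth hp).comp dSmooth_fst) dSmooth_snd))

theorem contDiff_time {K : X × ℝ → ℝ} (hK : DSmooth K) (x : X) :
    ContDiff ℝ ∞ (fun s => K (x, s)) :=
  DSmooth.contDiff (hK.comp (dSmooth_pair dSmooth_const dSmooth_id))

theorem dSmooth_integral {K : X × ℝ → ℝ} (hK : DSmooth K) :
    DSmooth (fun x => ∫ s in (0 : ℝ)..1, K (x, s)) := fun _ _ hp =>
  (contDiff_intervalIntegral (contDiff_of_dSmooth_prod hK hp)).isPlot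

theorem dSmooth_deriv {K : X × ℝ → ℝ} (hK : DSmooth K) :
    DSmooth (fun a : X × ℝ => deriv (fun s => K (a.1, s)) a.2) := fun n p hp => by
  have hp' := isPlot_prod_iff.1 hp
  have h1 := contDiff_of_dSmooth_prod hK hp'.1
  set h : Eu n × ℝ → ℝ := fun a => K ((p a.1).1, a.2) with hh
  have h2 : ContDiff ℝ ∞ (fun a : Eu n => fderiv ℝ h (a, (p a).2) (0, 1)) :=
    ((h1.fderiv_right (m := ∞) le_rfl).comp
      (contDiff_id.prodMk (IsPlot.contDiff hp'.2))).clm_apply contDiff_const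
  refine ContDiff.isPlot ?_
  convert h2 using 2 with a
  have h3 : HasFDerivAt h (fderiv ℝ h (a, (p a).2)) (a, (p a).2) :=
    (h1.differentiable (by simp)).differentiableAt.hasFDerivAt
  have h4 : HasDerivAt (fun s : ℝ => (a, s)) ((0 : Eu n), (1 : ℝ)) (p a).2 :=
    (hasDerivAt_const _ _).prodMk (hasDerivAt_id _)
  exact (h3.comp_hasDerivAt _ h4).deriv

/-- A function whose derivative is controlled by an energy density varies slowly. -/
theorem sub_lt_half_of_energy {f K : ℝ → ℝ} (hf : ContDiff ℝ ∞ f) (hK : Continuous K)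
    (hfK : ∀ s, deriv f s ^ 2 ≤ K s) {D : ℝ} (hD : 0 < D) (hKD : ∫ s in (0 : ℝ)..1, K s ≤ D)
    {s t : ℝ} (hs : 0 ≤ s) (hst : s ≤ t) (ht : t ≤ 1) (hd : (t - s) * D ≤ 1 / 8) :
    f s - f t < 1 / 2 := by
  have hdf : Continuous (deriv f) := hf.continuous_deriv (by simp)
  have hK0 : ∀ s, 0 ≤ K s := fun s => (sq_nonneg _).trans (hfK s)
  have h1 : ∫ r in s..t, deriv f r = f t - f s :=
    intervalIntegral.integral_deriv_eq_sub (fun r _ => (hf.differentiable (by simp)) r)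
      (hdf.intervalIntegrable _ _)
  -- From `(f' + 2D)² ≥ 0` follows `f' ≥ -D - f'² / (4D)`. After integration the two terms cost at
  -- most `1/8` and `1/4`, in total less than `1/2`.
  have h2 : ∫ r in s..t, (-D - K r / (4 * D)) ≤ ∫ r in s..t, deriv f r := by
    refine intervalIntegral.integral_mono_on hst
      (Continuous.intervalIntegrable (by fun_prop) _ _) (hdf.intervalIntegrable _ _)
      fun r _ => ?_
    have h3 : 0 ≤ (deriv f r + 2 * D) ^ 2 + (K r - deriv f r ^ 2) :=
      add_nonneg (sq_nonneg _) (sub_nonneg.2 (hfK r))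
    rw [← sub_nonneg]
    have : deriv f r - (-D - K r / (4 * D)) =
        ((deriv f r + 2 * D) ^ 2 + (K r - deriv f r ^ 2)) / (4 * D) := by
      field_simp
      ring
    rw [this]
    positivity
  have h3 : ∫ r in s..t, (-D - K r / (4 * D)) = -((t - s) * D) - (∫ r in s..t, K r) / (4 * D) := by
    rw [intervalIntegral.integral_sub (Continuous.intervalIntegrable (by fun_prop) _ _)
      (Continuous.intervalIntegrable (by fun_prop) _ _)]
    simp
  have h4 : ∫ r in s..t, K r ≤ ∫ r in (0 : ℝ)..1, K r :=
    intervalIntegral.integral_mono_interval hs hst ht (Eventually.of_forall hK0)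
      (hK.intervalIntegrable _ _)
  have h5 : (∫ r in s..t, K r) / (4 * D) ≤ 1 / 4 := by
    rw [div_le_iff₀ (by positivity)]
    linarith
  linarith

end Calculus

/-! ### Eventually stationary sequences -/

section Stationary

variable {X : Type v} {Y : Type w}

open Classical in
/-- The limit of an eventually stationary sequence. -/
noncomputable def evLim (s : ℕ → Y) : Y :=
  if h : ∃ N, ∀ i ≥ N, s i = s N then s h.choose else s 0

theorem evLim_eq {s : ℕ → Y} {N : ℕ} (h : ∀ i ≥ N, s i = s N) : evLim s = s N := by
  have hex : ∃ N, ∀ i ≥ N, s i = s N := ⟨N, h⟩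
  rw [evLim, dif_pos hex]
  rw [← hex.choose_spec _ (le_max_left _ N), h _ (le_max_right _ _)]

theorem dSmooth_evLim [DiffeologicalSpace X] [DiffeologicalSpace Y] {s : ℕ → X → Y}
    (hs : ∀ i, DSmooth (s i))
    (h : ∀ (n : ℕ) (p : Eu n → X) (u : Eu n), IsPlot p →
      ∃ N, ∀ᶠ v in 𝓝 u, ∀ i ≥ N, s i (p v) = s N (p v)) :
    DSmooth (fun x => evLim fun i => s i x) :=
  dSmooth_of_isPlotAt fun n p u hp => by
    obtain ⟨N, hN⟩ := h n p u hp
    exact ⟨_, hs N n p hp, hN.mono fun v hv => evLim_eq hv⟩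

end Stationary

/-! ### Transport along short paths in the base -/

section Transport

variable {G : Type u} [Group G] {σ : ℤˣ →* MulAut G}

open Classical in
/-- The point over `b` with the same `i`-th frame coordinate as `e`, when it makes sense. -/
noncomputable def move (i : ℕ) (e : ESph G) (b : BSph σ) : ESph G :=
  if coord i e ≠ 0 ∧ sqCoord i b ≠ 0 then (frame σ i e * (frame σ i b.out)⁻¹) • b.out else e

theorem toB_out (b : BSph σ) : toB σ b.out = b := Quotient.out_eq b

/-- The chosen representative of the base point is irrelevant: by equivariance of the frame, any
point of the fibre with non-zero `i`-th coordinate gives the same result. Smoothness can therefore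
be checked on local lifts. -/
theorem move_eq {i : ℕ} {e e' : ESph G} (h : coord i e ≠ 0) (h' : coord i e' ≠ 0) :
    move i e (toB σ e') = (frame σ i e * (frame σ i e')⁻¹) • e' := by
  have h2 : sqCoord i (toB σ e') ≠ 0 := sqCoord_toB_ne_zero.2 h'
  obtain ⟨k, hk⟩ := Quotient.exact (toB_out (toB σ e'))
  simp only at hk
  rw [move, if_pos ⟨h, h2⟩, ← hk, frame_smul k h', mul_inv_rev, ← mul_smul]
  simp [mul_assoc]

theorem move_smul {i : ℕ} (k : G ⋊[σ] ℤˣ) (e : ESph G) (b : BSph σ) :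
    move i (k • e) b = k • move i e b := by
  by_cases h : coord i e ≠ 0 ∧ sqCoord i b ≠ 0
  · rw [move, move, if_pos h, if_pos ⟨coord_smul_ne_zero.2 h.1, h.2⟩, frame_smul k h.1, ← mul_smul,
      mul_assoc]
  · rw [move, move, if_neg h, if_neg fun h' => h ⟨coord_smul_ne_zero.1 h'.1, h'.2⟩]

theorem toB_move {i : ℕ} {e : ESph G} {b : BSph σ} (h : coord i e ≠ 0) (h' : sqCoord i b ≠ 0) :
    toB σ (move i e b) = b := by
  rw [move, if_pos ⟨h, h'⟩, toB_smul, toB_out]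

/-- The default value `e` in `move` makes this unconditional, so a step of weight zero is the
identity even where the `i`-th frame is unavailable. -/
theorem move_self (i : ℕ) (e : ESph G) : move i e (toB σ e) = e := by
  by_cases h : coord i e ≠ 0
  · rw [move_eq h h, mul_inv_cancel, one_smul]
  · rw [move, if_neg fun h' => h h'.1]

/-- The weight of the `i`-th step of the transport along `c`. -/
noncomputable def stepWeight (c : ℝ → BSph σ) (i : ℕ) : ℝ :=
  shrinkPartition (fun i (b : BSph σ) => sqCoord i b) i (c 0)

/-- The time reached before the `i`-th step of the transport along `c`. -/
noncomputable def stepTime (c : ℝ → BSph σ) (i : ℕ) : ℝ :=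
  ∑ j ∈ Finset.range i, stepWeight c j

/-- The successive positions of the transport along `c`. -/
noncomputable def stepSeq (e : ESph G) (c : ℝ → BSph σ) : ℕ → ESph G
  | 0 => e
  | i + 1 => move i (stepSeq e c i) (c (stepTime c (i + 1)))

/-- The transport of `e` along `c` from time `0` to time `1`. -/
noncomputable def transport (e : ESph G) (c : ℝ → BSph σ) : ESph G := evLim (stepSeq e c)

/-- Along a short path, a coordinate that is large at time `0` does not vanish up to time `1`. -/
def IsShort (c : ℝ → BSph σ) : Prop :=
  ∀ i, 0 ≤ gap (fun i (b : BSph σ) => sqCoord i b) i (c 0) → ∀ s, 0 ≤ s → s ≤ 1 → sqCoord i (c s) ≠ 0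

theorem stepTime_zero (c : ℝ → BSph σ) : stepTime c 0 = 0 := by simp [stepTime]

theorem stepTime_succ (c : ℝ → BSph σ) (i : ℕ) :
    stepTime c (i + 1) = stepTime c i + stepWeight c i := Finset.sum_range_succ _ _

theorem stepSeq_smul (k : G ⋊[σ] ℤˣ) (e : ESph G) (c : ℝ → BSph σ) (i : ℕ) :
    stepSeq (k • e) c i = k • stepSeq e c i := by
  induction i with
  | zero => rfl
  | succ i ih => rw [stepSeq, ih, move_smul, stepSeq]

theorem gap_nonneg_of_stepWeight_ne_zero {c : ℝ → BSph σ} {i : ℕ} (h : stepWeight c i ≠ 0) :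
    0 ≤ gap (fun i (b : BSph σ) => sqCoord i b) i (c 0) :=
  (IsNumeration.gap_pos_of_shrinkPartition_ne_zero h).le

variable [DiffeologicalSpace G]

theorem stepWeight_nonneg (c : ℝ → BSph σ) (i : ℕ) : 0 ≤ stepWeight c i :=
  isNumeration_sqCoord.shrinkPartition_nonneg i (c 0)

theorem finsum_stepWeight (c : ℝ → BSph σ) : ∑ᶠ i, stepWeight c i = 1 :=
  isNumeration_sqCoord.finsum_shrinkPartition (c 0)

theorem stepTime_eq_one {c : ℝ → BSph σ} {N : ℕ} (h : ∀ i ≥ N, stepWeight c i = 0) :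
    stepTime c N = 1 := by
  rw [← finsum_stepWeight c, stepTime, finsum_eq_sum_of_zero]
  intro i hi
  exact h i (by simpa using hi)

theorem exists_stepWeight_eq_zero (c : ℝ → BSph σ) : ∃ N, ∀ i ≥ N, stepWeight c i = 0 := by
  obtain ⟨I, hI⟩ := isNumeration_sqCoord.locallyFinite_shrinkPartition 0 (fun _ => c 0) 0
    isPlot_const
  refine ⟨I.sup id + 1, fun i hi => hI.self_of_nhds i fun h => ?_⟩
  have := Finset.le_sup (f := id) h
  simp only [id] at this
  omega

theorem stepTime_nonneg (c : ℝ → BSph σ) (i : ℕ) : 0 ≤ stepTime c i :=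
  Finset.sum_nonneg fun j _ => stepWeight_nonneg c j

theorem stepTime_le_one (c : ℝ → BSph σ) (i : ℕ) : stepTime c i ≤ 1 := by
  obtain ⟨N, hN⟩ := exists_stepWeight_eq_zero c
  rw [← stepTime_eq_one (N := max i N) fun j hj => hN j ((le_max_right _ _).trans hj)]
  exact Finset.sum_le_sum_of_subset_of_nonneg
    (Finset.range_mono (le_max_left _ _)) fun j _ _ => stepWeight_nonneg c j

/-- A step of weight zero changes neither the time nor the point. A step of non-zero weight uses a
coordinate with positive gap at time `0`, and on a short path this coordinate is non-zero at all
times in question. -/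
theorem toB_stepSeq {e : ESph G} {c : ℝ → BSph σ} (he : toB σ e = c 0) (hc : IsShort c) (i : ℕ) :
    toB σ (stepSeq e c i) = c (stepTime c i) := by
  induction i with
  | zero => rw [stepTime_zero, ← he, stepSeq]
  | succ i ih =>
    by_cases h : stepWeight c i = 0
    · rw [stepSeq, stepTime_succ, h, add_zero, ← ih, move_self]
    · have hs := hc i (gap_nonneg_of_stepWeight_ne_zero h)
      refine toB_move ?_ (hs _ (stepTime_nonneg c _) (stepTime_le_one c _))
      rw [← sqCoord_toB_ne_zero (σ := σ), ih]
      exact hs _ (stepTime_nonneg c _) (stepTime_le_one c _)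

theorem stepSeq_succ_of_eq_zero {e : ESph G} {c : ℝ → BSph σ} (he : toB σ e = c 0)
    (hc : IsShort c) {i : ℕ} (h : stepWeight c i = 0) : stepSeq e c (i + 1) = stepSeq e c i := by
  rw [stepSeq, stepTime_succ, h, add_zero, ← toB_stepSeq he hc i, move_self]

theorem stepSeq_stationary {e : ESph G} {c : ℝ → BSph σ} (he : toB σ e = c 0) (hc : IsShort c)
    {N : ℕ} (h : ∀ i ≥ N, stepWeight c i = 0) : ∀ i ≥ N, stepSeq e c i = stepSeq e c N := by
  intro i hi
  induction i, hi using Nat.le_induction with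
  | base => rfl
  | succ i hi ih => rw [stepSeq_succ_of_eq_zero he hc (h i hi), ih]

theorem transport_eq {e : ESph G} {c : ℝ → BSph σ} (he : toB σ e = c 0) (hc : IsShort c)
    {N : ℕ} (h : ∀ i ≥ N, stepWeight c i = 0) : transport e c = stepSeq e c N :=
  evLim_eq (stepSeq_stationary he hc h)

theorem toB_transport {e : ESph G} {c : ℝ → BSph σ} (he : toB σ e = c 0) (hc : IsShort c) :
    toB σ (transport e c) = c 1 := by
  obtain ⟨N, hN⟩ := exists_stepWeight_eq_zero c
  rw [transport_eq he hc hN, toB_stepSeq he hc, stepTime_eq_one hN]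

theorem transport_smul {e : ESph G} {c : ℝ → BSph σ} (he : toB σ e = c 0) (hc : IsShort c)
    (k : G ⋊[σ] ℤˣ) : transport (k • e) c = k • transport e c := by
  obtain ⟨N, hN⟩ := exists_stepWeight_eq_zero c
  rw [transport_eq he hc hN, transport_eq ((toB_smul k e).trans he) hc hN, stepSeq_smul]

theorem dSmooth_stepWeight {Z : Type v} [DiffeologicalSpace Z] {γ : Z × ℝ → BSph σ}
    (hγ : DSmooth γ) (i : ℕ) : DSmooth (fun z => stepWeight (fun s => γ (z, s)) i) :=
  (isNumeration_sqCoord.dSmooth_shrinkPartition i).comp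
    (hγ.comp (dSmooth_pair dSmooth_id dSmooth_const))

theorem dSmooth_stepTime {Z : Type v} [DiffeologicalSpace Z] {γ : Z × ℝ → BSph σ}
    (hγ : DSmooth γ) (i : ℕ) : DSmooth (fun z => stepTime (fun s => γ (z, s)) i) :=
  DSmooth.sum_real fun j _ => dSmooth_stepWeight hγ j

theorem transport_const {e : ESph G} {c : ℝ → BSph σ} (h : ∀ r, 0 ≤ r → c r = toB σ e) :
    transport e c = e := by
  have : ∀ i, stepSeq e c i = e := fun i => by
    induction i with
    | zero => rfl
    | succ i ih => rw [stepSeq, ih, h _ (stepTime_nonneg c _), move_self]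
  rw [transport, evLim_eq (N := 0) fun i _ => by rw [this, this], this]

variable [DiffeologicalGroup (G ⋊[σ] ℤˣ)]

theorem isPlotAt_move (hE : (universalBundle σ).IsPrincipal) {n i : ℕ} {e : Eu n → ESph G}
    {b : Eu n → BSph σ} {u : Eu n} (he : IsPlotAt e u) (hb : IsPlotAt b u)
    (heu : coord i (e u) ≠ 0) (hbu : sqCoord i (b u) ≠ 0) :
    IsPlotAt (fun v => move i (e v) (b v)) u := by
  obtain ⟨b', hb', hbe⟩ := hb
  obtain ⟨q, hq, hqe⟩ := hE.exists_lift hb' u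
  have hbq : ∀ᶠ v in 𝓝 u, b v = toB σ (q v) := hbe.trans hqe
  have hqu : coord i (q u) ≠ 0 := by
    rw [← sqCoord_toB_ne_zero (σ := σ), ← hbq.self_of_nhds]
    exact hbu
  have hq' : IsPlotAt q u := isPlotAt_of_isPlot hq u
  refine (hE.isPlotAt_smul (DiffeologicalGroup.smooth_mul.isPlotAt
    (((dSmoothOn_frame i).isPlotAt he heu).pair (DiffeologicalGroup.smooth_inv.isPlotAt
      ((dSmoothOn_frame i).isPlotAt hq' hqu)))) hq').congr ?_
  filter_upwards [hbq, ((dSmooth_coord i).isPlotAt he).continuousAt.eventually_ne heu,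
    ((dSmooth_coord i).isPlotAt hq').continuousAt.eventually_ne hqu] with v h1 h2 h3
  rw [h1]
  exact move_eq h2 h3

theorem dSmooth_stepSeq (hE : (universalBundle σ).IsPrincipal) {Z : Type v} [DiffeologicalSpace Z]
    {γ : Z × ℝ → BSph σ} (hγ : DSmooth γ) {ε : Z → ESph G} (hε : DSmooth ε)
    (he : ∀ z, toB σ (ε z) = γ (z, 0)) (hc : ∀ z, IsShort fun s => γ (z, s)) (i : ℕ) :
    DSmooth (fun z => stepSeq (ε z) (fun s => γ (z, s)) i) := by
  induction i with
  | zero => exact hε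
  | succ i ih =>
    refine dSmooth_of_isPlotAt fun n p u hp => ?_
    have hp0 : DSmooth (fun z => γ (z, 0)) := hγ.comp (dSmooth_pair dSmooth_id dSmooth_const)
    have hη := (isNumeration_sqCoord (σ := σ)).comp hp0
    -- The dichotomy is closed against open: a negative gap stays negative nearby, so the step is
    -- locally trivial. The boundary case of gap `0` falls under shortness, which is why `IsShort`
    -- asks for `0 ≤ gap` and not for strict positivity.
    by_cases h : 0 ≤ gap (fun i (b : BSph σ) => sqCoord i b) i (γ (p u, 0))
    · have hs := hc (p u) i h
      refine isPlotAt_move hE (isPlotAt_of_isPlot (ih n p hp) u) (isPlotAt_of_isPlot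
        ((hγ.comp (dSmooth_pair dSmooth_id (dSmooth_stepTime hγ (i + 1)))) n p hp) u) ?_
          (hs _ (stepTime_nonneg _ _) (stepTime_le_one _ _))
      rw [← sqCoord_toB_ne_zero (σ := σ)]
      simp only [toB_stepSeq (he (p u)) (hc (p u))]
      exact hs _ (stepTime_nonneg _ _) (stepTime_le_one _ _)
    · refine (isPlotAt_of_isPlot (ih n p hp) u).congr ?_
      have hcont := (IsPlot.continuous_real (hη.dSmooth_gap i n p hp)).continuousAt (x := u)
      filter_upwards [hcont.eventually_lt_const (not_le.1 h)] with v hv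
      refine stepSeq_succ_of_eq_zero (he (p v)) (hc (p v)) ?_
      by_contra hne
      exact hv.not_ge (gap_nonneg_of_stepWeight_ne_zero hne)

theorem dSmooth_transport (hE : (universalBundle σ).IsPrincipal) {Z : Type v}
    [DiffeologicalSpace Z] {γ : Z × ℝ → BSph σ} (hγ : DSmooth γ) {ε : Z → ESph G} (hε : DSmooth ε)
    (he : ∀ z, toB σ (ε z) = γ (z, 0)) (hc : ∀ z, IsShort fun s => γ (z, s)) :
    DSmooth (fun z => transport (ε z) (fun s => γ (z, s))) := by
  refine dSmooth_evLim (dSmooth_stepSeq hE hγ hε he hc) fun n p u hp => ?_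
  have hp0 : DSmooth (fun z => γ (z, 0)) := hγ.comp (dSmooth_pair dSmooth_id dSmooth_const)
  obtain ⟨I, hI⟩ := (isNumeration_sqCoord (σ := σ)).locallyFinite_shrinkPartition n
    (fun v => γ (p v, 0)) u (hp0 n p hp)
  refine ⟨I.sup id + 1, ?_⟩
  filter_upwards [hI] with v hv
  refine stepSeq_stationary (he (p v)) (hc (p v)) fun i hi => hv i fun h => ?_
  have := Finset.le_sup (f := id) h
  simp only [id] at this
  omega

end Transport

/-! ### The covering homotopy theorem -/

section Energy

variable {X : Type v} [DiffeologicalSpace X]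

/-- A time derivative needs vanishing on an open time interval with the point of `X` held fixed. So
time is made an independent parameter, giving a plot on `Eu n × ℝ`, and local finiteness is applied
to that plot. -/
theorem PlotLocallyFinite.deriv {ι : Type w} {f : ι → X × ℝ → ℝ} (hf : PlotLocallyFinite f) :
    PlotLocallyFinite (fun i (a : X × ℝ) => deriv (fun s => f i (a.1, s)) a.2) := by
  intro n p u hp
  have hp' := isPlot_prod_iff.1 hp
  let T := toEuclidean (E := Eu n × ℝ)
  let q : EuclideanSpace ℝ (Fin (Module.finrank ℝ (Eu n × ℝ))) → X × ℝ :=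
    fun w => ((p (T.symm w).1).1, (T.symm w).2)
  have hq : IsPlot q := by
    refine isPlot_prod_iff.2 ⟨?_, ContDiff.isPlot ?_⟩
    · exact isPlot_reparam (f := fun w => (T.symm w).1) hp'.1 (contDiff_fst.comp T.symm.contDiff)
    · exact (contDiff_snd.comp T.symm.contDiff).isPlot
  obtain ⟨I, hI⟩ := hf _ q (T (u, (p u).2)) hq
  refine ⟨I, ?_⟩
  have h1 : ∀ᶠ a : Eu n × ℝ in 𝓝 (u, (p u).2), ∀ i ∉ I, f i ((p a.1).1, a.2) = 0 := by
    filter_upwards [T.continuous.continuousAt.eventually hI] with a ha i hi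
    simpa [q] using ha i hi
  have hc : Continuous fun v : Eu n => (v, (p v).2) :=
    continuous_id.prodMk (IsPlot.continuous_real hp'.2)
  filter_upwards [hc.continuousAt.eventually (eventually_eventually_nhds.2 h1)] with v hv i hi
  have hr : ContinuousAt (fun r : ℝ => (v, r)) (p v).2 := by fun_prop
  have : (fun s => f i ((p v).1, s)) =ᶠ[𝓝 (p v).2] fun _ => 0 :=
    (hr.eventually hv).mono fun r h => h i hi
  rw [this.deriv_eq]
  simp

variable {G : Type u} [Group G] {σ : ℤˣ →* MulAut G}

/-- The `i`-th squared coordinate along a homotopy, normalised by the sum of the squares. -/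
noncomputable def relCoord {X : Type v} (F : X × ℝ → BSph σ) (i : ℕ) (a : X × ℝ) : ℝ :=
  sqCoord i (F a) / ∑ᶠ j, sqCoord j (F a) ^ 2

/-- The energy density of a homotopy. -/
noncomputable def energy {X : Type v} (F : X × ℝ → BSph σ) (a : X × ℝ) : ℝ :=
  ∑ᶠ i, (deriv (fun s => relCoord F i (a.1, s)) a.2) ^ 2

/-- A bound for the energy of a homotopy. -/
noncomputable def energyBound {X : Type v} (F : X × ℝ → BSph σ) (x : X) : ℝ :=
  1 + ∫ s in (0 : ℝ)..1, energy F (x, s)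

/-- The length of the time steps in which the covering homotopy is constructed. -/
noncomputable def timeStep {X : Type v} (F : X × ℝ → BSph σ) (x : X) : ℝ :=
  1 / (8 * energyBound F x)

theorem one_le_energyBound {X : Type v} (F : X × ℝ → BSph σ) (x : X) : 1 ≤ energyBound F x := by
  have : 0 ≤ ∫ s in (0 : ℝ)..1, energy F (x, s) :=
    intervalIntegral.integral_nonneg zero_le_one fun s _ => finsum_nonneg fun i => sq_nonneg _
  rw [energyBound]
  linarith

theorem timeStep_pos {X : Type v} (F : X × ℝ → BSph σ) (x : X) : 0 < timeStep F x := by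
  have := one_le_energyBound F x
  rw [timeStep]
  positivity

variable [DiffeologicalSpace G] {F : X × ℝ → BSph σ}

theorem dSmooth_relCoord (hF : DSmooth F) (i : ℕ) : DSmooth (relCoord F i) :=
  ((dSmooth_sqCoord i).comp hF).div_real (isNumeration_sqCoord.dSmooth_finsum_sq.comp hF)
    fun a => (isNumeration_sqCoord.finsum_sq_pos (F a)).ne'

theorem plotLocallyFinite_deriv_relCoord (hF : DSmooth F) :
    PlotLocallyFinite
      (fun i (a : X × ℝ) => (deriv (fun s => relCoord F i (a.1, s)) a.2) ^ 2) := by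
  have h1 : PlotLocallyFinite (relCoord F) :=
    (plotLocallyFinite_sqCoord.comp hF).mono fun i a h => by
      rw [relCoord, h, zero_div]
  exact h1.deriv.mono fun i a h => by simp [h]

theorem dSmooth_energy (hF : DSmooth F) : DSmooth (energy F) :=
  (plotLocallyFinite_deriv_relCoord hF).dSmooth_finsum fun i =>
    (dSmooth_deriv (dSmooth_relCoord hF i)).comp_contDiff (k := fun t => t ^ 2) (by fun_prop)

theorem dSmooth_energyBound (hF : DSmooth F) : DSmooth (energyBound F) :=
  dSmooth_const.add_real (dSmooth_integral (dSmooth_energy hF))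

theorem dSmooth_timeStep (hF : DSmooth F) : DSmooth (timeStep F) :=
  dSmooth_const.div_real (dSmooth_const.mul_real (dSmooth_energyBound hF)) fun x => by
    have := one_le_energyBound F x
    positivity

/-- The energy dominates the squared derivative of every relative coordinate at once, which makes
the step length independent of `i`. Being an integral, unlike a supremum over time, it depends
smoothly on `x`. -/
theorem relCoord_sub_lt (hF : DSmooth F) (i : ℕ) (x : X) {s t : ℝ} (hs : 0 ≤ s) (hst : s ≤ t)
    (ht : t ≤ 1) (hd : t - s ≤ timeStep F x) :
    relCoord F i (x, s) - relCoord F i (x, t) < 1 / 2 := by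
  have hD := one_le_energyBound F x
  refine sub_lt_half_of_energy (f := fun s => relCoord F i (x, s)) (K := fun s => energy F (x, s))
    (contDiff_time (dSmooth_relCoord hF i) x) (contDiff_time (dSmooth_energy hF) x).continuous
    (fun r => ?_) (D := energyBound F x) (by linarith) (by rw [energyBound]; linarith) hs hst ht ?_
  · exact single_le_finsum i ((plotLocallyFinite_deriv_relCoord hF).finite (x, r))
      fun j => sq_nonneg _
  · calc (t - s) * energyBound F x ≤ timeStep F x * energyBound F x := by gcongr
      _ = 1 / 8 := by rw [timeStep]; field_simp

theorem isShort_timeStep (hF : DSmooth F) (h1 : ∀ x s, 1 ≤ s → F (x, s) = F (x, 1)) (x : X)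
    {s : ℝ} (hs : 0 ≤ s) : IsShort fun r => F (x, s + r * timeStep F x) := by
  intro i hi r hr0 hr1
  simp only [zero_mul, add_zero] at hi
  change sqCoord i (F (x, s + r * timeStep F x)) ≠ 0
  have hδ := timeStep_pos F x
  have hrδ : 0 ≤ r * timeStep F x := mul_nonneg hr0 hδ.le
  by_cases hs1 : 1 ≤ s
  · rw [h1 x _ (by linarith), ← h1 x s hs1]
    exact isNumeration_sqCoord.ne_zero_of_gap_nonneg hi
  push Not at hs1
  -- The energy controls only times in `[0, 1]`, and `F` is constant in time afterwards.
  set t := min (s + r * timeStep F x) 1 with ht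
  have hFt : F (x, s + r * timeStep F x) = F (x, t) := by
    rcases le_total (s + r * timeStep F x) 1 with h | h
    · rw [ht, min_eq_left h]
    · rw [ht, min_eq_right h, h1 x _ h]
  rw [hFt]
  have hts : t - s ≤ timeStep F x := by
    have h2 : t ≤ s + r * timeStep F x := min_le_left _ _
    nlinarith
  have hlt := relCoord_sub_lt hF i x hs (le_min (by linarith) hs1.le) (min_le_right _ _) hts
  -- As the squared coordinates sum to `1`, non-negativity of the gap reads `2 η_i ≥ ∑ η_j ^ 2`,
  -- that is, relative coordinate at least `1/2`. It drops by less than `1/2`, hence stays positive.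
  have hhalf : 1 / 2 ≤ relCoord F i (x, s) := by
    rw [relCoord, le_div_iff₀ (isNumeration_sqCoord.finsum_sq_pos (F (x, s)))]
    rw [gap, finsum_sqCoord] at hi
    linarith
  intro h0
  have h3 : relCoord F i (x, t) = 0 := by rw [relCoord, h0, zero_div]
  linarith

end Energy

/-! ### Lifting a homotopy by iterated short transports -/

section Covering

variable {G : Type u} [Group G] {σ : ℤˣ →* MulAut G} {X : Type v}

/-- The successive positions of the lift of a homotopy, starting from `e`. -/
noncomputable def coverSeq (F : X × ℝ → BSph σ) (x : X) (e : ESph G) : ℕ → ESph G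
  | 0 => e
  | k + 1 => transport (coverSeq F x e k) fun r => F (x, k * timeStep F x + r * timeStep F x)

variable [DiffeologicalSpace X] [DiffeologicalSpace G] {F : X × ℝ → BSph σ}

theorem isShort_coverSeq (hF : DSmooth F)
    (h1 : ∀ x s, 1 ≤ s → F (x, s) = F (x, 1)) (x : X) (k : ℕ) :
    IsShort fun r => F (x, k * timeStep F x + r * timeStep F x) :=
  isShort_timeStep hF h1 x (mul_nonneg k.cast_nonneg (timeStep_pos F x).le)

theorem toB_coverSeq (hF : DSmooth F)
    (h1 : ∀ x s, 1 ≤ s → F (x, s) = F (x, 1)) {x : X} {e : ESph G} (he : toB σ e = F (x, 0)) (k : ℕ) :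
    toB σ (coverSeq F x e k) = F (x, k * timeStep F x) := by
  induction k with
  | zero => simpa [coverSeq] using he
  | succ k ih =>
    rw [coverSeq, toB_transport (by simpa using ih) (isShort_coverSeq hF h1 x k)]
    push_cast
    ring_nf

theorem coverSeq_smul (hF : DSmooth F)
    (h1 : ∀ x s, 1 ≤ s → F (x, s) = F (x, 1)) {x : X} {e : ESph G} (he : toB σ e = F (x, 0)) (h : G ⋊[σ] ℤˣ) (k : ℕ) :
    coverSeq F x (h • e) k = h • coverSeq F x e k := by
  induction k with
  | zero => rfl
  | succ k ih =>
    rw [coverSeq, ih, transport_smul (by simpa using toB_coverSeq hF h1 he k)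
      (isShort_coverSeq hF h1 x k), coverSeq]

/-- Past time `1` the homotopy is constant, and transport along a constant path does nothing. -/
theorem coverSeq_stationary (hF : DSmooth F)
    (h1 : ∀ x s, 1 ≤ s → F (x, s) = F (x, 1)) {x : X} {e : ESph G} (he : toB σ e = F (x, 0)) {N : ℕ}
    (hN : 1 ≤ N * timeStep F x) : ∀ k ≥ N, coverSeq F x e k = coverSeq F x e N := by
  intro k hk
  induction k, hk using Nat.le_induction with
  | base => rfl
  | succ k hk ih =>
    have hδ := timeStep_pos F x
    have hk1 : 1 ≤ k * timeStep F x := hN.trans (by gcongr)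
    have hconst : ∀ r, 0 ≤ r → F (x, k * timeStep F x + r * timeStep F x) =
        toB σ (coverSeq F x e k) := fun r hr => by
      rw [toB_coverSeq hF h1 he, h1 x _ hk1, h1 x _ (by nlinarith)]
    rw [coverSeq, transport_const hconst, ih]

/-- The end point of the lift of a homotopy, starting from `e`. -/
noncomputable def coverEnd {X : Type v} (F : X × ℝ → BSph σ) (x : X) (e : ESph G) : ESph G :=
  evLim (coverSeq F x e)

theorem exists_one_le_mul {t : ℝ} (ht : 0 < t) : ∃ N : ℕ, 1 ≤ N * t := by
  obtain ⟨N, hN⟩ := exists_nat_ge (1 / t)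
  exact ⟨N, by rwa [div_le_iff₀ ht] at hN⟩

theorem toB_coverEnd (hF : DSmooth F) (h1 : ∀ x s, 1 ≤ s → F (x, s) = F (x, 1)) {x : X}
    {e : ESph G} (he : toB σ e = F (x, 0)) : toB σ (coverEnd F x e) = F (x, 1) := by
  obtain ⟨N, hN⟩ := exists_one_le_mul (timeStep_pos F x)
  rw [coverEnd, evLim_eq (coverSeq_stationary hF h1 he hN), toB_coverSeq hF h1 he, h1 x _ hN]

theorem coverEnd_smul (hF : DSmooth F) (h1 : ∀ x s, 1 ≤ s → F (x, s) = F (x, 1)) {x : X}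
    {e : ESph G} (he : toB σ e = F (x, 0)) (h : G ⋊[σ] ℤˣ) :
    coverEnd F x (h • e) = h • coverEnd F x e := by
  obtain ⟨N, hN⟩ := exists_one_le_mul (timeStep_pos F x)
  rw [coverEnd, coverEnd, evLim_eq (coverSeq_stationary hF h1 he hN),
    evLim_eq (coverSeq_stationary hF h1 ((toB_smul h e).trans he) hN), coverSeq_smul hF h1 he]

variable [DiffeologicalGroup (G ⋊[σ] ℤˣ)] {Z : Type w} [DiffeologicalSpace Z]

theorem dSmooth_coverSeq (hE : (universalBundle σ).IsPrincipal) (hF : DSmooth F)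
    (h1 : ∀ x s, 1 ≤ s → F (x, s) = F (x, 1)) {ξ : Z → X} (hξ : DSmooth ξ) {ε : Z → ESph G}
    (hε : DSmooth ε) (he : ∀ z, toB σ (ε z) = F (ξ z, 0)) (k : ℕ) :
    DSmooth (fun z => coverSeq F (ξ z) (ε z) k) := by
  induction k with
  | zero => exact hε
  | succ k ih =>
    have hδ : DSmooth (fun a : Z × ℝ => timeStep F (ξ a.1)) :=
      (dSmooth_timeStep hF).comp (hξ.comp dSmooth_fst)
    have hγ : DSmooth (fun a : Z × ℝ =>
        F (ξ a.1, k * timeStep F (ξ a.1) + a.2 * timeStep F (ξ a.1))) :=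
      hF.comp (dSmooth_pair (hξ.comp dSmooth_fst)
        ((dSmooth_const.mul_real hδ).add_real (dSmooth_snd.mul_real hδ)))
    exact dSmooth_transport hE hγ ih (fun z => by simpa using toB_coverSeq hF h1 (he z) k)
      fun z => isShort_coverSeq hF h1 (ξ z) k

theorem dSmooth_coverEnd (hE : (universalBundle σ).IsPrincipal) (hF : DSmooth F)
    (h1 : ∀ x s, 1 ≤ s → F (x, s) = F (x, 1)) {ξ : Z → X} (hξ : DSmooth ξ) {ε : Z → ESph G}
    (hε : DSmooth ε) (he : ∀ z, toB σ (ε z) = F (ξ z, 0)) :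
    DSmooth (fun z => coverEnd F (ξ z) (ε z)) := by
  refine dSmooth_evLim (dSmooth_coverSeq hE hF h1 hξ hε he) fun n p u hp => ?_
  -- Half the step length at `u` is a lower bound for the step length near `u`, so one `N` serves a
  -- whole neighbourhood.
  obtain ⟨N, hN⟩ := exists_one_le_mul (half_pos (timeStep_pos F (ξ (p u))))
  have hcont : Continuous fun v => timeStep F (ξ (p v)) :=
    IsPlot.continuous_real (((dSmooth_timeStep hF).comp hξ) n p hp)
  refine ⟨N, ?_⟩
  filter_upwards [hcont.continuousAt.eventually_const_lt (half_lt_self (timeStep_pos F (ξ (p u))))]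
    with v hv
  exact coverSeq_stationary hF h1 (he (p v)) (hN.trans (by gcongr))

/-- Smoothly homotopic maps have isomorphic pull-backs. -/
theorem iso_pullback_of_homotopic (hE : (universalBundle σ).IsPrincipal) {f g : X → BSph σ}
    (hf : DSmooth f) (hg : DSmooth g) (h : SmoothlyHomotopic f g) :
    ((universalBundle σ).pullback f).Iso ((universalBundle σ).pullback g) := by
  obtain ⟨K, hK, hK0, hK1⟩ := h
  -- The reparametrized homotopy is constant in time from time `1` on, so that `coverSeq` becomes
  -- stationary.
  let F : X × ℝ → BSph σ := fun a => K (a.1, Real.smoothTransition a.2)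
  have hF : DSmooth F := dSmooth_reparam hK Real.smoothTransition.contDiff
  have h1 : ∀ x s, 1 ≤ s → F (x, s) = F (x, 1) := fun x s hs => by
    simp only [F, Real.smoothTransition.one_of_one_le hs, Real.smoothTransition.one]
  have he : ∀ z : ((universalBundle σ).pullback f).Total, toB σ z.1.2 = F (z.1.1, 0) := fun z => by
    simp only [F, Real.smoothTransition.zero, hK0]
    exact z.2.symm
  refine (hE.pullback hf).iso_pullback hE hg (φ := fun z => coverEnd F z.1.1 z.1.2)
    (dSmooth_coverEnd hE hF h1 (dSmooth_fst.comp dSmooth_subtype_val)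
      HSpaceOver.dSmooth_pullback_snd he) (fun k z => coverEnd_smul hF h1 (he z) k) fun z => ?_
  refine (toB_coverEnd hF h1 (he z)).trans ?_
  simp only [F, Real.smoothTransition.one, hK1]

end Covering

/-! ### Countable systems of frames -/

namespace HSpaceOver.IsSmoothPartition

variable {X : Type v} [DiffeologicalSpace X] {ι : Type v} {U : ι → Set X} {l : ι → X → ℝ}

theorem isNumeration (hl : IsSmoothPartition U l) : IsNumeration l where
  smooth := hl.smooth
  nonneg := hl.nonneg
  locallyFinite n p u hp := by
    obtain ⟨W, hW, hu, hfin⟩ := hl.locallyFinite (p u)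
    refine ⟨hfin.toFinset, (eventually_mem_of_isOpen hW hp hu).mono fun v hv i hi => ?_⟩
    by_contra h
    exact hi (hfin.mem_toFinset.2 ⟨p v, h, hv⟩)
  exists_ne_zero x := by
    by_contra! h
    simpa [h] using hl.sum_eq_one x

theorem mem_of_ne_zero (hl : IsSmoothPartition U l) {i : ι} {x : X} (h : l i x ≠ 0) : x ∈ U i := by
  let _ : TopologicalSpace X := dTopology
  exact hl.support_subset i (subset_closure h)

theorem sum_le_one (hl : IsSmoothPartition U l) (S : Finset ι) (x : X) :
    ∑ i ∈ S, l i x ≤ 1 := by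
  classical
  obtain ⟨I, hI⟩ := hl.isNumeration.locallyFinite 0 (fun _ => x) 0 isPlot_const
  rw [← hl.sum_eq_one x, finsum_eq_sum_of_zero (I := S ∪ I) fun i hi =>
    hI.self_of_nhds i fun h => hi (Finset.mem_union_right _ h)]
  exact Finset.sum_le_sum_of_subset_of_nonneg Finset.subset_union_left
    fun i _ _ => hl.nonneg i x

end HSpaceOver.IsSmoothPartition

section Dominance

variable {X : Type v} {ι : Type v}

/-- A function that is positive where each member of `l` in `S` exceeds the total weight of the
members outside `S`. -/
noncomputable def dominance (l : ι → X → ℝ) (S : Finset ι) (x : X) : ℝ :=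
  (∑ i ∈ S, l i x) * ∏ i ∈ S, expNegInvGlue (l i x - (1 - ∑ j ∈ S, l j x))

theorem lt_of_dominance_ne_zero {l : ι → X → ℝ} {S : Finset ι} {x : X}
    (h : dominance l S x ≠ 0) {i : ι} (hi : i ∈ S) : 1 - ∑ j ∈ S, l j x < l i x := by
  have h2 := Finset.prod_ne_zero_iff.1 (mul_ne_zero_iff.1 h).2 i hi
  by_contra hlt
  exact h2 (expNegInvGlue.zero_of_nonpos (by linarith))

/-- The factor `∑ i ∈ S, l i x` is there for this: over the empty set the product alone would be
`1`. -/
theorem nonempty_of_dominance_ne_zero {l : ι → X → ℝ} {S : Finset ι} {x : X}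
    (h : dominance l S x ≠ 0) : S.Nonempty := by
  by_contra hS
  rw [Finset.not_nonempty_iff_eq_empty] at hS
  exact h (by simp [dominance, hS])

variable [DiffeologicalSpace X] {U : ι → Set X} {l : ι → X → ℝ}

theorem ne_zero_of_dominance_ne_zero (hl : HSpaceOver.IsSmoothPartition U l) {S : Finset ι} {x : X}
    (h : dominance l S x ≠ 0) {i : ι} (hi : i ∈ S) : l i x ≠ 0 := by
  have h1 := lt_of_dominance_ne_zero h hi
  have h2 := hl.sum_le_one S x
  exact (lt_of_le_of_lt (sub_nonneg.2 h2) h1).ne'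

/-- Members of a dominating set exceed every single function outside it. Distinct sets of equal size
each have a member the other lacks, and each of these two would have to exceed the other. -/
theorem eq_of_dominance_ne_zero (hl : HSpaceOver.IsSmoothPartition U l) {S T : Finset ι} {x : X}
    (hS : dominance l S x ≠ 0) (hT : dominance l T x ≠ 0) (hST : S.card = T.card) : S = T := by
  classical
  by_contra hne
  have key : ∀ {S T : Finset ι}, dominance l S x ≠ 0 → ∀ {i j}, i ∈ S → j ∉ S →
      l j x < l i x := fun {S T} hS i j hi hj => by
    have h1 := hl.sum_le_one (insert j S) x
    rw [Finset.sum_insert hj] at h1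
    linarith [lt_of_dominance_ne_zero hS hi]
  obtain ⟨i, hiS, hiT⟩ : ∃ i ∈ S, i ∉ T := by
    by_contra! h
    exact hne (Finset.eq_of_subset_of_card_le h hST.ge)
  obtain ⟨j, hjT, hjS⟩ : ∃ j ∈ T, j ∉ S := by
    by_contra! h
    exact hne (Finset.eq_of_subset_of_card_le h hST.le).symm
  exact lt_asymm (key (T := T) hS hiS hjS) (key (T := S) hT hjT hiT)

theorem isNumeration_dominance (hl : HSpaceOver.IsSmoothPartition U l) : IsNumeration (dominance l) where
  smooth S := by
    have hsum : DSmooth (fun x => ∑ i ∈ S, l i x) := DSmooth.sum_real fun i _ => hl.smooth i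
    exact hsum.mul_real (DSmooth.prod_real fun i _ =>
      ((hl.smooth i).sub_real (dSmooth_const.sub_real hsum)).comp_contDiff expNegInvGlue.contDiff)
  nonneg S x := mul_nonneg (Finset.sum_nonneg fun i _ => hl.nonneg i x)
    (Finset.prod_nonneg fun i _ => expNegInvGlue.nonneg _)
  locallyFinite n p u hp := by
    obtain ⟨I, hI⟩ := hl.isNumeration.locallyFinite n p u hp
    refine ⟨I.powerset, hI.mono fun v hv S hS => ?_⟩
    by_contra h
    refine hS (Finset.mem_powerset.2 fun i hi => ?_)
    by_contra hi'
    exact ne_zero_of_dominance_ne_zero hl h hi (hv i hi')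
  exists_ne_zero x := by
    classical
    obtain ⟨I, hI⟩ := hl.isNumeration.locallyFinite 0 (fun _ => x) 0 isPlot_const
    have hsum : ∑ i ∈ I with l i x ≠ 0, l i x = 1 := by
      rw [Finset.sum_filter_ne_zero, ← hl.sum_eq_one x, finsum_eq_sum_of_zero hI.self_of_nhds]
    -- The set of all indices active at `x` dominates, because nothing is left outside it.
    refine ⟨I.filter fun i => l i x ≠ 0, ?_⟩
    rw [dominance, hsum, one_mul]
    refine Finset.prod_ne_zero_iff.2 fun i hi => (expNegInvGlue.pos_of_pos ?_).ne'
    rw [sub_self, sub_zero]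
    exact (hl.nonneg i x).lt_of_ne' (Finset.mem_filter.1 hi).2

end Dominance

/-! ### Collecting the index sets by cardinality -/

section Levels

variable {X : Type v} {ι : Type v}

open Classical in
/-- The total weight of the shrunken dominance functions of the sets of cardinality `n`. -/
noncomputable def level (l : ι → X → ℝ) (n : ℕ) (x : X) : ℝ :=
  ∑ᶠ S : Finset ι, if S.card = n then shrink (dominance l) S x else 0

theorem exists_of_level_ne_zero {l : ι → X → ℝ} {n : ℕ} {x : X} (h : level l n x ≠ 0) :
    ∃ S : Finset ι, S.card = n ∧ shrink (dominance l) S x ≠ 0 := by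
  by_contra! h'
  refine h ((finsum_congr fun S => ?_).trans finsum_zero)
  split_ifs with hS
  · exact h' S hS
  · rfl

variable [DiffeologicalSpace X] {U : ι → Set X} {l : ι → X → ℝ}

theorem plotLocallyFinite_levelTerm (hl : HSpaceOver.IsSmoothPartition U l) (n : ℕ) :
    PlotLocallyFinite fun (S : Finset ι) (x : X) =>
      if S.card = n then shrink (dominance l) S x else 0 :=
  (isNumeration_dominance hl).shrink.locallyFinite.mono fun S x h => by simp [h]

theorem isNumeration_level (hl : HSpaceOver.IsSmoothPartition U l) : IsNumeration (level l) where
  smooth n := (plotLocallyFinite_levelTerm hl n).dSmooth_finsum fun S => by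
    split_ifs
    · exact (isNumeration_dominance hl).shrink.smooth S
    · exact dSmooth_const
  nonneg n x := finsum_nonneg fun S => by
    split_ifs
    · exact shrink_nonneg _ _ _
    · exact le_rfl
  locallyFinite m p u hp := by
    classical
    obtain ⟨J, hJ⟩ := (isNumeration_dominance hl).shrink.locallyFinite m p u hp
    refine ⟨J.image Finset.card, hJ.mono fun v hv n hn => ?_⟩
    by_contra h
    obtain ⟨S, hS, hne⟩ := exists_of_level_ne_zero h
    exact hne (hv S fun hSJ => hn (Finset.mem_image.2 ⟨S, hSJ, hS⟩))
  exists_ne_zero x := by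
    obtain ⟨S, hS⟩ := (isNumeration_dominance hl).shrink.exists_ne_zero x
    refine ⟨S.card, ne_of_gt (finsum_pos (fun T => ?_) ⟨S, ?_⟩
      ((plotLocallyFinite_levelTerm hl _).finite x))⟩
    · split_ifs
      · exact shrink_nonneg _ _ _
      · exact le_rfl
    · rw [if_pos rfl]
      exact (shrink_nonneg _ _ _).lt_of_ne' hS

end Levels

namespace HSpaceOver

variable {H : Type u} [Group H] [DiffeologicalSpace H] {X : Type v} [DiffeologicalSpace X]
  {P : HSpaceOver.{u, v, w} H X}

/-- A D-numerable principal bundle has a countable system of frames, defined on the sets where the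
functions of a smooth numeration do not vanish. -/
theorem IsDNumerable.exists_countable_frames (hN : P.IsDNumerable) (hP : P.IsPrincipal) :
    ∃ (t : ℕ → X → ℝ) (τ : ℕ → P.Total → H), IsNumeration t ∧
      (∀ i (h : H) p, t i (P.proj p) ≠ 0 → τ i (h • p) = h * τ i p) ∧
      ∀ i (n : ℕ) (p : Eu n → P.Total) (u : Eu n), IsPlot p → ∃ r : Eu n → H, IsPlotAt r u ∧
        ∀ᶠ v in 𝓝 u, t i (P.proj (p v)) ≠ 0 → τ i (p v) = r v := by
  classical
  obtain ⟨ι, U, l, hl, hT⟩ := hN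
  have hη := isNumeration_dominance hl
  choose θ hθ hθe using fun i => hP.exists_frame_of_isTrivialOver (hl.isOpen i) (hT i)
  -- Where `S` dominates, all its members are non-zero, so the frame of any one of them is
  -- available.
  let θS : Finset ι → P.Total → H := fun S => if h : S.Nonempty then θ h.choose else 1
  have hθS : ∀ {S x}, dominance l S x ≠ 0 → ∃ i, θS S = θ i ∧ x ∈ U i := fun {S x} h => by
    have hS := nonempty_of_dominance_ne_zero h
    exact ⟨hS.choose, dif_pos hS,
      hl.mem_of_ne_zero (ne_zero_of_dominance_ne_zero hl h hS.choose_spec)⟩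
  have hsd : ∀ {S x}, shrink (dominance l) S x ≠ 0 → dominance l S x ≠ 0 :=
    fun {S x} h h' => h (hη.shrink_eq_zero h')
  let τ : ℕ → P.Total → H := fun n p =>
    if h : ∃ S : Finset ι, S.card = n ∧ shrink (dominance l) S (P.proj p) ≠ 0 then
      θS h.choose p else 1
  have hτ : ∀ {n S p}, S.card = n → shrink (dominance l) S (P.proj p) ≠ 0 → τ n p = θS S p :=
    fun {n S p} hS hne => by
      have hex : ∃ S : Finset ι, S.card = n ∧ shrink (dominance l) S (P.proj p) ≠ 0 :=
        ⟨S, hS, hne⟩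
      have := eq_of_dominance_ne_zero hl (hsd hex.choose_spec.2) (hsd hne)
        (hex.choose_spec.1.trans hS.symm)
      simp only [τ, dif_pos hex]
      rw [this]
  refine ⟨level l, τ, isNumeration_level hl, ?_, ?_⟩
  · intro n h p hne
    obtain ⟨S, hS, hSne⟩ := exists_of_level_ne_zero hne
    obtain ⟨i, hi, hU⟩ := hθS (hsd hSne)
    rw [hτ hS (by rwa [P.proj_smul]), hτ hS hSne, hi, hθe i h p hU]
  · intro k n p u hp
    have hpx : IsPlot (fun v => P.proj (p v)) := hP.dSmooth_proj n p hp
    -- The case split is on `dominance`, whereas `τ` is selected by its shrunken version. If `S`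
    -- dominates at `u` it does so nearby, and by uniqueness the frame of `S` is the only one
    -- selected there.
    by_cases hex : ∃ S : Finset ι, S.card = k ∧ dominance l S (P.proj (p u)) ≠ 0
    · obtain ⟨S, hS, hSne⟩ := hex
      obtain ⟨i, hi, hU⟩ := hθS hSne
      refine ⟨_, hθ i n p u hp hU, ?_⟩
      filter_upwards [(IsPlot.continuous_real (hη.smooth S n _ hpx)).continuousAt.eventually_ne
        hSne] with v hv hne
      obtain ⟨T, hTc, hTne⟩ := exists_of_level_ne_zero hne
      obtain rfl : T = S := eq_of_dominance_ne_zero hl (hsd hTne) hv (hTc.trans hS.symm)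
      rw [hτ hTc hTne, hi]
    -- If no set of size `k` dominates at `u`, all the shrunken functions of that size vanish near
    -- `u`. Then so does the level, and any plot serves as `r`.
    · push Not at hex
      refine ⟨fun _ => 1, isPlotAt_of_isPlot isPlot_const u, ?_⟩
      obtain ⟨J, hJ⟩ := hη.shrink.locallyFinite n _ u hpx
      have hJ' : ∀ᶠ v in 𝓝 u, ∀ S ∈ J, S.card = k → shrink (dominance l) S (P.proj (p v)) = 0 :=
        (eventually_all_finset J).2 fun S _ => by
          by_cases hS : S.card = k
          · obtain h | h := hη.ne_zero_or_eventually_shrink_eq_zero S hpx u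
            · exact absurd (hex S hS) h
            · exact h.mono fun v hv _ => hv
          · exact Eventually.of_forall fun v h => absurd h hS
      filter_upwards [hJ, hJ'] with v h1 h2 hne
      obtain ⟨S, hS, hSne⟩ := exists_of_level_ne_zero hne
      by_cases hSJ : S ∈ J
      · exact absurd (h2 S hSJ hS) hSne
      · exact absurd (h1 S hSJ) hSne

end HSpaceOver

/-! ### Classifying maps -/

section Classify

variable {G : Type u} [Group G] [DiffeologicalSpace G] {σ : ℤˣ →* MulAut G}
  {X : Type v} [DiffeologicalSpace X] {P : HSpaceOver.{u, v, w} (G ⋊[σ] ℤˣ) X}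

/-- A D-numerable principal bundle admits a smooth equivariant map to the spherical Milnor
space. -/
theorem exists_equivariant_eSph (hP : P.IsPrincipal) (hN : P.IsDNumerable) :
    ∃ φ : P.Total → ESph G, DSmooth φ ∧ ∀ (h : G ⋊[σ] ℤˣ) p, φ (h • p) = h • φ p := by
  obtain ⟨t, τ, ht, hτ, hloc⟩ := hN.exists_countable_frames hP
  -- The coordinates are proportional to `t i` itself, not to its square root, so only the strictly
  -- positive sum of squares is put under a root.
  let ρ : ℕ → X → ℝ := fun i x => t i x / Real.sqrt (∑ᶠ j, t j x ^ 2)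
  have hsq := ht.finsum_sq_pos
  have hρ0 : ∀ {i x}, t i x = 0 → ρ i x = 0 := fun {i x} h => by simp only [ρ, h, zero_div]
  have hρ : ∀ i, DSmooth (ρ i) := fun i => (ht.smooth i).div_real
    (ht.dSmooth_finsum_sq.sqrt_real fun x => (hsq x).ne') fun x => (Real.sqrt_pos.2 (hsq x)).ne'
  have hρsum : ∀ x, ∑ᶠ i, ρ i x ^ 2 = 1 := fun x => by
    simp only [ρ, div_pow, Real.sq_sqrt (hsq x).le]
    simp only [div_eq_mul_inv]
    rw [← finsum_mul, mul_inv_cancel₀ (hsq x).ne']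
  let ξ : ℕ → P.Total → ℝ := fun i p => (((τ i p).right : ℤ) : ℝ) * ρ i (P.proj p)
  have hξsq : ∀ i p, ξ i p ^ 2 = ρ i (P.proj p) ^ 2 := fun i p => by
    simp only [ξ, mul_pow]
    rcases Int.units_eq_one_or (τ i p).right with h | h <;> simp [h]
  have hξ0 : ∀ {i p}, t i (P.proj p) = 0 → ξ i p = 0 := fun {i p} h => by
    simp only [ξ, hρ0 h, mul_zero]
  have hfin : ∀ p, (Function.support fun i => ξ i p).Finite := fun p =>
    (ht.locallyFinite.finite (P.proj p)).subset fun i hi h => hi (hξ0 h)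
  let φ : P.Total → ESph G := fun p => mkPt (fun i => ξ i p) (fun i => (τ i p).left) (hfin p) (by
    simp only [hξsq]
    exact hρsum _)
  refine ⟨φ, dSmooth_of_isPlotAt fun n p u hp => ?_, fun h p => ?_⟩
  · have hpx : IsPlot (fun v => P.proj (p v)) := hP.dSmooth_proj n p hp
    obtain ⟨I, hI⟩ := ht.locallyFinite n _ u hpx
    -- Both sign and label are read from the plot `r` that extends the frame across zeros of `t i`;
    -- at such zeros the coordinate vanishes whatever the sign.
    refine isPlotAt_eSph I (hI.mono fun v hv i hi => hξ0 (hv i hi)) (fun i _ => ?_) fun i _ => ?_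
    · obtain ⟨r, hr, he⟩ := hloc i n p u hp
      have h1 : DSmooth (fun k : G ⋊[σ] ℤˣ => (((k.right : ℤˣ) : ℤ) : ℝ)) :=
        (dSmooth_units fun ε : ℤˣ => ((ε : ℤ) : ℝ)).comp dSmooth_right
      refine ((dSmooth_fst.mul_real dSmooth_snd).isPlotAt ((h1.isPlotAt hr).pair
        (isPlotAt_of_isPlot (hρ i n _ hpx) u))).congr (he.mono fun v hv => ?_)
      by_cases h0 : t i (P.proj (p v)) = 0
      · exact (hξ0 h0).trans (by simp [hρ0 h0])
      · change (((τ i (p v)).right : ℤ) : ℝ) * _ = _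
        rw [hv h0]
        rfl
    · obtain ⟨r, hr, he⟩ := hloc i n p u hp
      refine ⟨fun v => (r v).left, dSmooth_left.isPlotAt hr, he.mono fun v hv hne => ?_⟩
      have h0 : t i (P.proj (p v)) ≠ 0 := fun h => hne (hξ0 h)
      rw [lab_mkPt _ _ _ _ hne, hv h0]
  · have hx : ∀ i, coord i (φ (h • p)) = coord i (h • φ p) := fun i => by
      rw [coord_smul]
      change ξ i (h • p) = _ * ξ i p
      by_cases h0 : t i (P.proj p) = 0
      · rw [hξ0 h0, hξ0 (by rwa [P.proj_smul]), mul_zero]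
      · simp only [ξ, hτ i h p h0, P.proj_smul, SemidirectProduct.mul_right, Units.val_mul,
          Int.cast_mul, mul_assoc]
    refine eSph_ext hx fun i hi => ?_
    have hi' : coord i (φ p) ≠ 0 := by
      rw [hx] at hi
      exact coord_smul_ne_zero.1 hi
    have h0 : t i (P.proj p) ≠ 0 := fun h' => hi' (hξ0 h')
    rw [lab_smul h hi', lab_mkPt _ _ _ _ hi, lab_mkPt _ _ _ _ hi', hτ i h p h0]
    rfl

/-- The map between bases induced by an equivariant smooth map to the spherical Milnor space. -/
theorem exists_classifying_map (hP : P.IsPrincipal) {φ : P.Total → ESph G} (hφ : DSmooth φ)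
    (h_eq : ∀ (h : G ⋊[σ] ℤˣ) p, φ (h • p) = h • φ p) :
    ∃ f : X → BSph σ, DSmooth f ∧ ∀ p, toB σ (φ p) = f (P.proj p) := by
  choose s hs using hP.subduction.1
  have key : ∀ p, toB σ (φ p) = toB σ (φ (s (P.proj p))) := fun p => by
    obtain ⟨k, hk⟩ := hP.exists_smul_eq (p := s (P.proj p)) (q := p) (hs _)
    conv_lhs => rw [hk, h_eq, toB_smul]
  have hsm : DSmooth fun p => toB σ (φ p) :=
    (isSubduction_iff.1 isSubduction_toB).2.1.comp hφ
  exact ⟨fun x => toB σ (φ (s x)), hP.subduction.dSmooth_of_comp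
    ((funext key : _ = fun p => toB σ (φ (s (P.proj p)))) ▸ hsm), key⟩

end Classify

/-! ### Maps into the spherical Milnor space given by coordinates -/

section Coordinatewise

variable {G : Type u}

theorem finsum_eq_of_hasSum {f : ℕ → ℝ} {a : ℝ} (hf : (Function.support f).Finite)
    (h : HasSum f a) : ∑ᶠ i, f i = a := by
  exact (tsum_eq_finsum hf).symm.trans h.tsum_eq

theorem hasSum_coord_sq (e : ESph G) : HasSum (fun i => coord i e ^ 2) 1 := by
  have hf : (Function.support fun i => coord i e ^ 2).Finite :=
    (finite_support_coord e).subset fun i hi h => hi (by simp only [h]; simp)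
  have hs : Summable fun i => coord i e ^ 2 := summable_of_hasFiniteSupport hf
  have h := hs.hasSum
  rwa [show ∑' i, coord i e ^ 2 = 1 from (tsum_eq_finsum hf).trans (finsum_coord_sq e)] at h

/-- A position `m` filled from the source `s m ≥ m / 2` satisfies `m ≤ 2 * s m + 1`, so bounded
sources give bounded positions. -/
theorem finite_support_of_half_le {x : ℕ → ℝ} {s : ℕ → ℕ} (hs : ∀ m, m / 2 ≤ s m) {y : ℕ → ℝ}
    (hx : (Function.support x).Finite) (hy : ∀ m, y m ≠ 0 → x (s m) ≠ 0) :
    (Function.support y).Finite := by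
  obtain ⟨N, hN⟩ := hx.bddAbove
  refine (Set.finite_Iio (2 * N + 2)).subset fun m hm => ?_
  have h1 := hN (hy m hm)
  have h2 := hs m
  simp only [Set.mem_Iio]
  omega

variable [Group G] [DiffeologicalSpace G] {Z : Type v} [DiffeologicalSpace Z]

/-- Covers maps that only rescale coordinates and copy labels. As there are at most two source maps,
one finite index set works for all positions along a plot, and the copied labels inherit the
extensions given by `exists_chart`. -/
theorem dSmooth_eSph_of_source {φ : Z → ESph G} {s : ℕ → ℕ} (hs : ∀ m, m / 2 ≤ s m)
    {ε : ℕ → Z → ESph G} (hε : ∀ i, DSmooth (ε i)) (hfin : ∃ ε₀ ε₁ : Z → ESph G, DSmooth ε₀ ∧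
      DSmooth ε₁ ∧ ∀ i, ε i = ε₀ ∨ ε i = ε₁)
    (hc : ∀ i, DSmooth (fun z => coord i (φ z)))
    (hφ : ∀ i z, coord i (φ z) ≠ 0 →
      coord (s i) (ε i z) ≠ 0 ∧ lab i (φ z) = lab (s i) (ε i z)) : DSmooth φ := by
  refine dSmooth_of_isPlotAt fun n p u hp => ?_
  obtain ⟨ε₀, ε₁, h0, h1, h01⟩ := hfin
  obtain ⟨I, hI⟩ := plotLocallyFinite_coord n _ u (h0 n p hp)
  obtain ⟨J, hJ⟩ := plotLocallyFinite_coord n _ u (h1 n p hp)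
  refine isPlotAt_eSph (Finset.range (2 * ((I ∪ J).sup id + 1))) ?_
    (fun i _ => isPlotAt_of_isPlot (hc i n p hp) u) fun i _ => ?_
  · filter_upwards [hI, hJ] with v hv hv' i hi
    by_contra hne
    have h2 := (hφ i (p v) hne).1
    have hmem : s i ∈ I ∪ J := by
      by_contra hs'
      rw [Finset.mem_union, not_or] at hs'
      rcases h01 i with h | h
      · exact h2 (h ▸ hv _ hs'.1)
      · exact h2 (h ▸ hv' _ hs'.2)
    have h3 := Finset.le_sup (f := id) hmem
    have h4 := hs i
    simp only [id, Finset.mem_range] at h3 hi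
    omega
  · obtain ⟨_, _, g, _, hg, he⟩ := (isPlotAt_of_isPlot (hε i n p hp) u).exists_chart
    refine ⟨g (s i), isPlotAt_of_isPlot (hg (s i)) u, he.mono fun v hv hne => ?_⟩
    obtain ⟨h2, h3⟩ := hφ i (p v) hne
    rw [h3]
    exact (hv.2 (s i)).2 h2

end Coordinatewise

/-! ### Joining two points -/

section Join

variable {G : Type u}

/-- The coordinates of the join of two points. -/
noncomputable def joinCoord (e e' : ESph G) (θ : ℝ) (m : ℕ) : ℝ :=
  if m % 2 = 0 then Real.cos θ * coord (m / 2) e else Real.sin θ * coord (m / 2) e'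

theorem joinCoord_even (e e' : ESph G) (θ : ℝ) (j : ℕ) :
    joinCoord e e' θ (2 * j) = Real.cos θ * coord j e := by
  rw [joinCoord, if_pos (by omega), show 2 * j / 2 = j by omega]

theorem joinCoord_odd (e e' : ESph G) (θ : ℝ) (j : ℕ) :
    joinCoord e e' θ (2 * j + 1) = Real.sin θ * coord j e' := by
  rw [joinCoord, if_neg (by omega), show (2 * j + 1) / 2 = j by omega]

theorem finite_support_joinCoord (e e' : ESph G) (θ : ℝ) :
    (Function.support (joinCoord e e' θ)).Finite := by
  refine finite_support_of_half_le (x := fun i => |coord i e| + |coord i e'|) (s := fun m => m / 2)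
    (fun _ => le_rfl) (((finite_support_coord e).union (finite_support_coord e')).subset
      fun i hi => ?_) fun m hm => ?_
  · by_contra h
    simp only [Set.mem_union, Function.mem_support, not_or, not_not] at h
    exact hi (by simp [h])
  · intro h
    have h1 := abs_nonneg (coord (m / 2) e)
    have h2 := abs_nonneg (coord (m / 2) e')
    have h3 : coord (m / 2) e = 0 := abs_eq_zero.1 (by linarith)
    have h4 : coord (m / 2) e' = 0 := abs_eq_zero.1 (by linarith)
    exact hm (by simp [joinCoord, h3, h4])

variable [Group G]

/-- The join `cos θ · e + sin θ · e'`, with `e` in the even and `e'` in the odd coordinates. -/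
noncomputable def join (e e' : ESph G) (θ : ℝ) : ESph G :=
  mkPt (joinCoord e e' θ) (fun m => if m % 2 = 0 then lab (m / 2) e else lab (m / 2) e')
    (finite_support_joinCoord e e' θ) (by
      refine finsum_eq_of_hasSum ((finite_support_joinCoord e e' θ).subset
        fun i hi h => hi (by simp only [h]; simp)) ?_
      rw [← Real.cos_sq_add_sin_sq θ]
      refine HasSum.even_add_odd ?_ ?_
      · simpa [joinCoord_even, mul_pow] using (hasSum_coord_sq e).mul_left (Real.cos θ ^ 2)
      · simpa [joinCoord_odd, mul_pow] using (hasSum_coord_sq e').mul_left (Real.sin θ ^ 2))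

theorem coord_join (e e' : ESph G) (θ : ℝ) (m : ℕ) : coord m (join e e' θ) = joinCoord e e' θ m :=
  rfl

theorem lab_join {e e' : ESph G} {θ : ℝ} {m : ℕ} (h : coord m (join e e' θ) ≠ 0) :
    coord (m / 2) (if m % 2 = 0 then e else e') ≠ 0 ∧
      lab m (join e e' θ) = lab (m / 2) (if m % 2 = 0 then e else e') := by
  rw [coord_join, joinCoord] at h
  rw [join, lab_mkPt _ _ _ _ h]
  split_ifs at h ⊢
  · exact ⟨right_ne_zero_of_mul h, rfl⟩
  · exact ⟨right_ne_zero_of_mul h, rfl⟩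

theorem join_smul {σ : ℤˣ →* MulAut G} (k : G ⋊[σ] ℤˣ) (e e' : ESph G) (θ : ℝ) :
    join (k • e) (k • e') θ = k • join e e' θ := by
  have hx : ∀ i, coord i (join (k • e) (k • e') θ) = coord i (k • join e e' θ) := fun i => by
    rw [coord_smul, coord_join, coord_join, joinCoord, joinCoord]
    split_ifs <;> rw [coord_smul] <;> ring
  refine eSph_ext hx fun i hi => ?_
  have hi' : coord i (join e e' θ) ≠ 0 := coord_smul_ne_zero.1 (hx i ▸ hi)
  rw [(lab_join hi).2, lab_smul k hi', (lab_join hi').2, ← lab_smul k (lab_join hi').1]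
  split_ifs <;> rfl

/-- The factor `cos (π / 2) = 0` erases the first point together with its labels, so every first
point leads to the same end. -/
theorem join_pi_div_two (e₁ e₂ e' : ESph G) : join e₁ e' (Real.pi / 2) = join e₂ e' (Real.pi / 2) := by
  have hx : ∀ i, coord i (join e₁ e' (Real.pi / 2)) = coord i (join e₂ e' (Real.pi / 2)) :=
    fun i => by simp [coord_join, joinCoord]
  refine eSph_ext hx fun i hi => ?_
  rw [(lab_join hi).2, (lab_join (hx i ▸ hi)).2]
  by_cases h : i % 2 = 0
  · exact absurd (by simp [coord_join, joinCoord, h]) hi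
  · rw [if_neg h, if_neg h]

variable [DiffeologicalSpace G] {Z : Type v} [DiffeologicalSpace Z]

theorem dSmooth_join {ε₀ ε₁ : Z → ESph G} (h0 : DSmooth ε₀) (h1 : DSmooth ε₁) {θ : Z → ℝ}
    (hθ : DSmooth θ) : DSmooth (fun z => join (ε₀ z) (ε₁ z) (θ z)) := by
  refine dSmooth_eSph_of_source (s := fun m => m / 2) (fun _ => le_rfl)
    (ε := fun i => if i % 2 = 0 then ε₀ else ε₁) (fun i => by split_ifs <;> assumption)
    ⟨ε₀, ε₁, h0, h1, fun i => by by_cases h : i % 2 = 0 <;> simp [h]⟩ (fun i => ?_) fun i z h => ?_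
  · simp only [coord_join, joinCoord]
    split_ifs
    · exact (hθ.comp_contDiff Real.contDiff_cos).mul_real ((dSmooth_coord _).comp h0)
    · exact (hθ.comp_contDiff Real.contDiff_sin).mul_real ((dSmooth_coord _).comp h1)
  · have := lab_join h
    by_cases hi : i % 2 = 0 <;> simpa [hi] using this

end Join

/-! ### Spreading the coordinates -/

section Spread

variable {G : Type u}

/-- The coordinate that is moved to the position `m` in the `n`-th stage of the spreading. -/
def spreadSource (n m : ℕ) : ℕ := if m ≤ n then m else n + 1 + (m - (n + 1)) / 2

/-- The factor at the position `m` in the `n`-th stage of the spreading. -/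
noncomputable def spreadFactor (n : ℕ) (θ : ℝ) (m : ℕ) : ℝ :=
  if m ≤ n then 1 else if (m - (n + 1)) % 2 = 0 then Real.sin θ else Real.cos θ

theorem half_le_spreadSource (n m : ℕ) : m / 2 ≤ spreadSource n m := by
  rw [spreadSource]
  split_ifs <;> omega

/-- The coordinates of the `n`-th stage of the spreading. -/
noncomputable def spreadCoord (n : ℕ) (θ : ℝ) (e : ESph G) (m : ℕ) : ℝ :=
  spreadFactor n θ m * coord (spreadSource n m) e

theorem finite_support_spreadCoord (n : ℕ) (θ : ℝ) (e : ESph G) :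
    (Function.support (spreadCoord n θ e)).Finite :=
  finite_support_of_half_le (half_le_spreadSource n) (finite_support_coord e)
    fun _ h => right_ne_zero_of_mul h

theorem hasSum_spreadCoord_sq (n : ℕ) (θ : ℝ) (e : ESph G) :
    HasSum (fun m => spreadCoord n θ e m ^ 2) 1 := by
  have hT := (hasSum_nat_add_iff' (n + 1)).2 (hasSum_coord_sq e)
  set T : ℝ := 1 - ∑ i ∈ Finset.range (n + 1), coord i e ^ 2 with hTdef
  rw [← hasSum_nat_add_iff' (n + 1)]
  have hhead : ∑ i ∈ Finset.range (n + 1), spreadCoord n θ e i ^ 2 =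
      ∑ i ∈ Finset.range (n + 1), coord i e ^ 2 := Finset.sum_congr rfl fun i hi => by
    have : i ≤ n := by simpa [Nat.lt_succ_iff] using hi
    simp [spreadCoord, spreadFactor, spreadSource, this]
  rw [hhead, ← hTdef, show T = Real.sin θ ^ 2 * T + Real.cos θ ^ 2 * T by
    rw [← add_mul, Real.sin_sq_add_cos_sq, one_mul]]
  refine HasSum.even_add_odd ?_ ?_
  · have h : ∀ q, spreadCoord n θ e (2 * q + (n + 1)) = Real.sin θ * coord (q + (n + 1)) e := by
      intro q
      rw [spreadCoord, spreadFactor, spreadSource, if_neg (show ¬2 * q + (n + 1) ≤ n by omega),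
        if_pos (show (2 * q + (n + 1) - (n + 1)) % 2 = 0 by omega), if_neg (show ¬2 * q + (n + 1) ≤ n by omega),
        show n + 1 + (2 * q + (n + 1) - (n + 1)) / 2 = q + (n + 1) by omega]
    simpa only [h, mul_pow] using hT.mul_left (Real.sin θ ^ 2)
  · have h : ∀ q, spreadCoord n θ e (2 * q + 1 + (n + 1)) =
        Real.cos θ * coord (q + (n + 1)) e := by
      intro q
      rw [spreadCoord, spreadFactor, spreadSource, if_neg (show ¬2 * q + 1 + (n + 1) ≤ n by omega),
        if_neg (show ¬(2 * q + 1 + (n + 1) - (n + 1)) % 2 = 0 by omega), if_neg (show ¬2 * q + 1 + (n + 1) ≤ n by omega),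
        show n + 1 + (2 * q + 1 + (n + 1) - (n + 1)) / 2 = q + (n + 1) by omega]
    simpa only [h, mul_pow] using hT.mul_left (Real.cos θ ^ 2)

variable [Group G]

/-- The `n`-th stage of the spreading: the coordinates up to `n` are kept, and each later
coordinate is rotated between two neighbouring positions. -/
noncomputable def spread (n : ℕ) (θ : ℝ) (e : ESph G) : ESph G :=
  mkPt (spreadCoord n θ e) (fun m => lab (spreadSource n m) e) (finite_support_spreadCoord n θ e)
    (finsum_eq_of_hasSum ((finite_support_spreadCoord n θ e).subset
      fun i hi h => hi (by simp only [h]; simp)) (hasSum_spreadCoord_sq n θ e))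

theorem coord_spread (n : ℕ) (θ : ℝ) (e : ESph G) (m : ℕ) :
    coord m (spread n θ e) = spreadFactor n θ m * coord (spreadSource n m) e :=
  rfl

theorem lab_spread {n : ℕ} {θ : ℝ} {e : ESph G} {m : ℕ} (h : coord m (spread n θ e) ≠ 0) :
    coord (spreadSource n m) e ≠ 0 ∧ lab m (spread n θ e) = lab (spreadSource n m) e :=
  ⟨right_ne_zero_of_mul h, lab_mkPt _ _ _ _ h⟩

theorem spread_smul {σ : ℤˣ →* MulAut G} (k : G ⋊[σ] ℤˣ) (n : ℕ) (θ : ℝ) (e : ESph G) :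
    spread n θ (k • e) = k • spread n θ e := by
  have hx : ∀ i, coord i (spread n θ (k • e)) = coord i (k • spread n θ e) := fun i => by
    rw [coord_smul, coord_spread, coord_spread, coord_smul]
    ring
  refine eSph_ext hx fun i hi => ?_
  have hi' : coord i (spread n θ e) ≠ 0 := coord_smul_ne_zero.1 (hx i ▸ hi)
  rw [(lab_spread hi).2, lab_smul k hi', (lab_spread hi').2, ← lab_smul k (lab_spread hi').1]

/-- On both sides coordinates up to `n + 1` are in place and coordinate `n + 1 + q` sits at position
`n + 1 + 2 * q`. This is why consecutive stages can be concatenated. -/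
theorem spread_pi_div_two (n : ℕ) (e : ESph G) :
    spread n (Real.pi / 2) e = spread (n + 1) 0 e := by
  have key : ∀ m, spreadFactor n (Real.pi / 2) m = spreadFactor (n + 1) 0 m ∧
      (spreadFactor n (Real.pi / 2) m ≠ 0 → spreadSource n m = spreadSource (n + 1) m) := fun m => by
    simp only [spreadFactor, spreadSource, Real.sin_pi_div_two, Real.cos_pi_div_two, Real.sin_zero,
      Real.cos_zero]
    constructor
    · split_ifs <;> first | rfl | omega
    · intro h
      split_ifs at h ⊢ <;> first | omega | exact absurd rfl h
  have hx : ∀ i, coord i (spread n (Real.pi / 2) e) = coord i (spread (n + 1) 0 e) := fun i => by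
    rw [coord_spread, coord_spread, ← (key i).1]
    by_cases h : spreadFactor n (Real.pi / 2) i = 0
    · simp [h]
    · rw [(key i).2 h]
  refine eSph_ext hx fun i hi => ?_
  rw [(lab_spread hi).2, (lab_spread (hx i ▸ hi)).2, (key i).2 (left_ne_zero_of_mul hi)]

theorem spread_of_coord_eq_zero {n : ℕ} (θ : ℝ) {e : ESph G} (h : ∀ i, n < i → coord i e = 0) :
    spread n θ e = e := by
  have hx : ∀ i, coord i (spread n θ e) = coord i e := fun i => by
    rw [coord_spread, spreadFactor, spreadSource]
    split_ifs with hi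
    · rw [one_mul]
    · rw [h i (by omega), h _ (by omega), mul_zero]
    · rw [h i (by omega), h _ (by omega), mul_zero]
  refine eSph_ext hx fun i hi => ?_
  rw [(lab_spread hi).2, spreadSource, if_pos]
  by_contra hi'
  exact hi ((hx i).trans (h i (by omega)))

/-- Stage `0` at angle `0` puts coordinate `j` at position `2 * j`, as does the join at angle `0`,
where `e'` is multiplied by `sin 0`. -/
theorem spread_zero_zero (e e' : ESph G) : spread 0 0 e = join e e' 0 := by
  have hs : ∀ m, spreadFactor 0 0 m = (if m % 2 = 0 then 1 else 0) ∧
      (m % 2 = 0 → spreadSource 0 m = m / 2) := fun m => by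
    simp only [spreadFactor, spreadSource, Real.sin_zero, Real.cos_zero]
    constructor
    · split_ifs <;> first | rfl | omega
    · intro h
      split_ifs <;> omega
  have hx : ∀ i, coord i (spread 0 0 e) = coord i (join e e' 0) := fun i => by
    rw [coord_spread, coord_join, joinCoord, (hs i).1]
    by_cases h : i % 2 = 0
    · simp [h, (hs i).2 h]
    · simp [h]
  refine eSph_ext hx fun i hi => ?_
  rw [(lab_spread hi).2, (lab_join (hx i ▸ hi)).2]
  by_cases h : i % 2 = 0
  · rw [if_pos h, (hs i).2 h]
  · refine absurd ?_ hi
    rw [coord_spread, (hs i).1, if_neg h, zero_mul]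

/-- The angle of the rotation inside a stage; it is constant near the ends of `[0, 1]`. -/
noncomputable def stageAngle (r : ℝ) : ℝ := Real.pi / 2 * Real.smoothTransition (3 * r - 1)

theorem contDiff_stageAngle : ContDiff ℝ ∞ stageAngle :=
  contDiff_const.mul (Real.smoothTransition.contDiff.comp (by fun_prop))

theorem stageAngle_of_le {r : ℝ} (h : r ≤ 1 / 3) : stageAngle r = 0 := by
  rw [stageAngle, Real.smoothTransition.zero_of_nonpos (by linarith), mul_zero]

theorem stageAngle_of_ge {r : ℝ} (h : 2 / 3 ≤ r) : stageAngle r = Real.pi / 2 := by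
  rw [stageAngle, Real.smoothTransition.one_of_one_le (by linarith), mul_one]

/-- All stages of the spreading, run one after the other. -/
noncomputable def spreadFlow (e : ESph G) (s : ℝ) : ESph G :=
  spread ⌊s⌋₊ (stageAngle (s - ⌊s⌋₊)) e

/-- The angle is constant on the outer thirds of each stage, so the formula of stage `n` persists a
third of a unit into both neighbours. These overlapping open intervals give smoothness at integer
times. For `n = 0` no lower bound is needed, since negative times have floor `0` and angle `0`. -/
theorem spreadFlow_eq {n : ℕ} {s : ℝ} (h : n = 0 ∨ (n : ℝ) - 1 / 3 < s) (h' : s < n + 4 / 3)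
    (e : ESph G) : spreadFlow e s = spread n (stageAngle (s - n)) e := by
  rw [spreadFlow]
  rcases lt_or_ge s n with hlt | hge
  · rcases Nat.eq_zero_or_pos n with rfl | hn
    · rw [Nat.floor_of_nonpos (by simpa using hlt.le)]
    · have hs := h.resolve_left hn.ne'
      obtain ⟨k, rfl⟩ : ∃ k, n = k + 1 := ⟨n - 1, by omega⟩
      push_cast at hs hlt h' ⊢
      have hfl : ⌊s⌋₊ = k := by
        rw [Nat.floor_eq_iff (by have := k.cast_nonneg (α := ℝ); linarith)]
        constructor <;> linarith
      rw [hfl, stageAngle_of_ge (by linarith), stageAngle_of_le (r := s - _) (by linarith),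
        spread_pi_div_two]
  · rcases lt_or_ge s (n + 1) with hlt' | hge'
    · have hfl : ⌊s⌋₊ = n := by
        rw [Nat.floor_eq_iff (n.cast_nonneg.trans hge)]
        exact ⟨hge, hlt'⟩
      rw [hfl]
    · have hfl : ⌊s⌋₊ = n + 1 := by
        rw [Nat.floor_eq_iff (n.cast_nonneg.trans hge)]
        push_cast
        constructor <;> linarith
      rw [hfl]
      push_cast
      rw [stageAngle_of_le (by linarith), stageAngle_of_ge (r := s - _) (by linarith),
        spread_pi_div_two]

open Classical in
/-- A smooth equivariant homotopy from the spreading over the even coordinates to the identity. -/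
noncomputable def spreadHomotopy (e : ESph G) (t : ℝ) : ESph G :=
  if t < 1 then spreadFlow e ((1 - t)⁻¹ - 1) else e

theorem spreadHomotopy_zero (e e' : ESph G) : spreadHomotopy e 0 = join e e' 0 := by
  rw [spreadHomotopy, if_pos one_pos, spreadFlow_eq (n := 0) (Or.inl rfl) (by norm_num),
    stageAngle_of_le (by norm_num), spread_zero_zero]

theorem spreadHomotopy_one (e : ESph G) : spreadHomotopy e 1 = e := by
  rw [spreadHomotopy, if_neg (lt_irrefl _)]

theorem spreadHomotopy_smul {σ : ℤˣ →* MulAut G} (k : G ⋊[σ] ℤˣ) (e : ESph G) (t : ℝ) :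
    spreadHomotopy (k • e) t = k • spreadHomotopy e t := by
  simp only [spreadHomotopy, spreadFlow, spread_smul]
  split_ifs <;> rfl

variable [DiffeologicalSpace G] {Z : Type v} [DiffeologicalSpace Z]

theorem dSmooth_spread (n : ℕ) {ε : Z → ESph G} (hε : DSmooth ε) {θ : Z → ℝ} (hθ : DSmooth θ) :
    DSmooth (fun z => spread n (θ z) (ε z)) := by
  refine dSmooth_eSph_of_source (half_le_spreadSource n) (ε := fun _ => ε) (fun _ => hε)
    ⟨ε, ε, hε, hε, fun _ => Or.inl rfl⟩ (fun i => ?_) fun i z h => lab_spread h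
  simp only [coord_spread]
  refine DSmooth.mul_real ?_ ((dSmooth_coord _).comp hε)
  simp only [spreadFactor]
  split_ifs
  · exact dSmooth_const
  · exact hθ.comp_contDiff Real.contDiff_sin
  · exact hθ.comp_contDiff Real.contDiff_cos

theorem dSmooth_spreadFlow : DSmooth (fun a : ESph G × ℝ => spreadFlow a.1 a.2) := by
  refine dSmooth_of_isPlotAt fun k p u hp => ?_
  have hp' := isPlot_prod_iff.1 hp
  have hc : Continuous fun v => (p v).2 := IsPlot.continuous_real hp'.2
  set n := ⌊(p u).2⌋₊ with hn
  have h1 : DSmooth (fun a : ESph G × ℝ => spread n (stageAngle (a.2 - n)) a.1) :=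
    dSmooth_spread n dSmooth_fst ((dSmooth_snd.sub_real dSmooth_const).comp_contDiff
      contDiff_stageAngle)
  refine ⟨_, h1 k p hp, ?_⟩
  have hlt : (p u).2 < n + 1 := Nat.lt_floor_add_one _
  have hev : ∀ᶠ v in 𝓝 u, n = 0 ∨ (n : ℝ) - 1 / 3 < (p v).2 := by
    rcases Nat.eq_zero_or_pos n with h0 | h0
    · exact Eventually.of_forall fun _ => Or.inl h0
    · have : (n : ℝ) ≤ (p u).2 := Nat.floor_le (Nat.pos_of_floor_pos h0).le
      exact (hc.continuousAt.eventually_const_lt (by linarith)).mono fun _ h => Or.inr h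
  filter_upwards [hev, hc.continuousAt.eventually_lt_const
    (show (p u).2 < n + 4 / 3 by linarith)] with v h2 h3
  exact spreadFlow_eq h2 h3 _

theorem dSmoothOn_of_contDiffOn {f : ℝ → ℝ} {U : Set ℝ} (hU : IsOpen U)
    (hf : ContDiffOn ℝ ∞ f U) : DSmoothOn f U := fun n p u hp hu => by
  have hc := IsPlot.continuous_real hp
  obtain ⟨ψ, hψ, hψN, hid⟩ := exists_contDiff_retract (hc.continuousAt (hU.mem_nhds hu))
  refine ⟨fun v => f (p (ψ v)), ContDiff.isPlot ?_, ?_⟩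
  · exact hf.comp_contDiff ((IsPlot.contDiff hp).comp hψ) hψN
  · filter_upwards [hid] with v hv
    rw [hv, id]

theorem dSmooth_spreadHomotopy : DSmooth (fun a : ESph G × ℝ => spreadHomotopy a.1 a.2) := by
  refine dSmooth_of_isPlotAt fun n p u hp => ?_
  have hp' := isPlot_prod_iff.1 hp
  have hc : Continuous fun v => (p v).2 := IsPlot.continuous_real hp'.2
  by_cases hu : (p u).2 < 1
  · have hk : ContDiffOn ℝ ∞ (fun t : ℝ => (1 - t)⁻¹ - 1) (Set.Iio 1) :=
      ((contDiffOn_const.sub contDiffOn_id).inv fun t ht => (sub_pos.2 ht).ne').sub contDiffOn_const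
    have h1 := dSmoothOn_of_contDiffOn isOpen_Iio hk n _ u hp'.2 hu
    refine (dSmooth_spreadFlow.isPlotAt ((isPlotAt_of_isPlot hp'.1 u).pair h1)).congr ?_
    filter_upwards [hc.continuousAt.eventually_lt_const hu] with v hv
    rw [spreadHomotopy, if_pos hv]
  -- From time `1` on the homotopy is the identity. Just before, the stage number exceeds every
  -- index active along the plot, so the spreading is the identity there as well.
  · obtain ⟨I, hI⟩ := plotLocallyFinite_coord n _ u hp'.1
    refine ⟨_, hp'.1, ?_⟩
    set N := I.sup id with hN
    -- If `0 < 1 - t < 1 / (N + 2)`, then `(1 - t)⁻¹ - 1 ≥ N`, so the stage is at least `N`.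
    have hpos : (0 : ℝ) < 1 / (N + 2) := by positivity
    filter_upwards [hI, hc.continuousAt.eventually_const_lt
      (show 1 - 1 / ((N : ℝ) + 2) < (p u).2 by linarith)] with v h1 h2
    rw [spreadHomotopy]
    split_ifs with hv
    · rw [spreadFlow]
      refine spread_of_coord_eq_zero _ fun i hi => h1 i fun hiI => ?_
      have h3 : i ≤ N := Finset.le_sup (f := id) hiI
      have h4 : N ≤ ⌊(1 - (p v).2)⁻¹ - 1⌋₊ := by
        refine Nat.le_floor ?_
        rw [le_sub_iff_add_le, le_inv_comm₀ (by positivity) (by linarith)]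
        have : (1 : ℝ) / (N + 2) ≤ ((N : ℝ) + 1)⁻¹ := by
          rw [one_div]
          exact inv_anti₀ (by positivity) (by linarith)
        linarith
      omega
    · rfl

end Spread

/-! ### Uniqueness of classifying maps -/

section Uniqueness

variable {G : Type u} [Group G] [DiffeologicalSpace G] {σ : ℤˣ →* MulAut G}
  {X : Type v} [DiffeologicalSpace X] {P : HSpaceOver.{u, v, w} (G ⋊[σ] ℤˣ) X}

/-- An equivariant homotopy descends: the projected value is constant on fibres, so it can be
computed from an arbitrary section and checked for smoothness on local lifts. -/
theorem homotopic_of_equivariant (hP : P.IsPrincipal) {Φ : P.Total × ℝ → ESph G} (hΦ : DSmooth Φ)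
    (h_eq : ∀ (h : G ⋊[σ] ℤˣ) p t, Φ (h • p, t) = h • Φ (p, t)) {f g : X → BSph σ}
    (hf : ∀ p, toB σ (Φ (p, 0)) = f (P.proj p)) (hg : ∀ p, toB σ (Φ (p, 1)) = g (P.proj p)) :
    SmoothlyHomotopic f g := by
  choose s hs using hP.subduction.1
  refine ⟨fun a => toB σ (Φ (s a.1, a.2)), dSmooth_of_isPlotAt fun n a u ha => ?_,
    fun x => (hf _).trans (by rw [hs]), fun x => (hg _).trans (by rw [hs])⟩
  have ha' := isPlot_prod_iff.1 ha
  obtain ⟨p, hp, he⟩ := hP.exists_lift ha'.1 u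
  have hsm : DSmooth fun b => toB σ (Φ b) := (isSubduction_iff.1 isSubduction_toB).2.1.comp hΦ
  refine ⟨_, hsm n (fun v => (p v, (a v).2)) (isPlot_prod_iff.2 ⟨hp, ha'.2⟩), he.mono fun v hv => ?_⟩
  obtain ⟨k, hk⟩ := hP.exists_smul_eq (p := s (a v).1) (q := p v) (by rw [hs]; exact hv)
  simp only [Function.comp]
  rw [hk, h_eq, toB_smul]

/-- Two homotopies in succession: `φ₀` is spread over the even coordinates, which makes room for
`φ₁` in the odd ones, and then the angle runs from `0` to `π / 2`. -/
theorem exists_homotopic_join (hP : P.IsPrincipal) {φ₀ φ₁ : P.Total → ESph G} (h0 : DSmooth φ₀)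
    (h1 : DSmooth φ₁) (h0e : ∀ (h : G ⋊[σ] ℤˣ) p, φ₀ (h • p) = h • φ₀ p)
    (h1e : ∀ (h : G ⋊[σ] ℤˣ) p, φ₁ (h • p) = h • φ₁ p) {f : X → BSph σ}
    (hf : ∀ p, toB σ (φ₀ p) = f (P.proj p)) :
    ∃ k : X → BSph σ, (∀ p, toB σ (join (φ₀ p) (φ₁ p) (Real.pi / 2)) = k (P.proj p)) ∧
      SmoothlyHomotopic f k := by
  have hj : ∀ θ : ℝ, ∃ k : X → BSph σ, DSmooth k ∧
      ∀ p, toB σ (join (φ₀ p) (φ₁ p) θ) = k (P.proj p) := fun θ =>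
    exists_classifying_map hP (dSmooth_join h0 h1 dSmooth_const) fun h p => by
      rw [h0e, h1e, join_smul]
  obtain ⟨j, -, hj0⟩ := hj 0
  obtain ⟨k, -, hk⟩ := hj (Real.pi / 2)
  refine ⟨k, hk, SmoothlyHomotopic.trans (g := j) (SmoothlyHomotopic.symm ?_) ?_⟩
  · refine homotopic_of_equivariant hP (Φ := fun a => spreadHomotopy (φ₀ a.1) a.2)
      (dSmooth_spreadHomotopy.comp (dSmooth_pair (h0.comp dSmooth_fst) dSmooth_snd))
      (fun h p t => ?_) (fun p => ?_) fun p => ?_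
    · simp only [h0e, spreadHomotopy_smul]
    · rw [← hj0, ← spreadHomotopy_zero]
    · rw [← hf, spreadHomotopy_one]
  · refine homotopic_of_equivariant hP
      (Φ := fun a => join (φ₀ a.1) (φ₁ a.1) (a.2 * (Real.pi / 2)))
      (dSmooth_join (h0.comp dSmooth_fst) (h1.comp dSmooth_fst)
        (dSmooth_snd.mul_real dSmooth_const)) (fun h p t => ?_) (fun p => ?_) fun p => ?_
    · simp only [h0e, h1e, join_smul]
    · rw [← hj0, zero_mul]
    · rw [← hk, one_mul]

/-- Maps covered by equivariant maps from the same principal bundle are homotopic. -/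
theorem homotopic_of_covered (hP : P.IsPrincipal) {φ₀ φ₁ : P.Total → ESph G} (h0 : DSmooth φ₀)
    (h1 : DSmooth φ₁) (h0e : ∀ (h : G ⋊[σ] ℤˣ) p, φ₀ (h • p) = h • φ₀ p)
    (h1e : ∀ (h : G ⋊[σ] ℤˣ) p, φ₁ (h • p) = h • φ₁ p) {f g : X → BSph σ}
    (hf : ∀ p, toB σ (φ₀ p) = f (P.proj p)) (hg : ∀ p, toB σ (φ₁ p) = g (P.proj p)) :
    SmoothlyHomotopic f g := by
  obtain ⟨k, hk, hfk⟩ := exists_homotopic_join hP h0 h1 h0e h1e hf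
  -- Joining `φ₁` with itself brings `g` to the same end as `f`, with no need for a separate
  -- spreading over the odd coordinates.
  obtain ⟨k', hk', hgk⟩ := exists_homotopic_join hP h1 h1 h1e h1e hg
  have : k = k' := funext fun x => by
    obtain ⟨p, rfl⟩ := hP.subduction.1 x
    rw [← hk, ← hk', join_pi_div_two _ (φ₁ p)]
  exact hfk.trans (this ▸ hgk.symm)

end Uniqueness

end SphMilnor

theorem mainTheorem3 {G : Type u} [Group G] [DiffeologicalSpace G] [DiffeologicalGroup G]
    (σ : ℤˣ →* MulAut G)
    (hσ : DSmooth (fun a : ℤˣ × G => σ a.1 a.2))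
    (hcontr : SmoothlyContractible (ESph G))
    (hsmooth : DSmooth (fun a : (G ⋊[σ] ℤˣ) × ESph G => a.1 • a.2))
    (hfree : ∀ (h : G ⋊[σ] ℤˣ) (e : ESph G), h • e = e → h = 1) :
    (universalBundle σ).IsPrincipal ∧
    ∀ (X : Type v) [DiffeologicalSpace X],
      ∃ Φ : SmoothHomotopyClasses X (BSph σ) → IsoClasses.{u, v, max u v} (G ⋊[σ] ℤˣ) X,
        Function.Bijective Φ ∧
        ∀ f : DMap X (BSph σ),
          ∃ hf : ((universalBundle σ).pullback f.1).IsPrincipal ∧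
              ((universalBundle σ).pullback f.1).IsDNumerable,
            Φ (Quotient.mk _ f) = Quotient.mk _ ⟨(universalBundle σ).pullback f.1, hf⟩ := by
  have hH := diffeologicalGroup_semidirect hσ
  have hE := isPrincipal_universalBundle hσ hsmooth hfree
  refine ⟨hE, fun X _ => ?_⟩
  have hpb : ∀ f : DMap X (BSph σ), ((universalBundle σ).pullback f.1).IsPrincipal ∧
      ((universalBundle σ).pullback f.1).IsDNumerable := fun f =>
    ⟨hE.pullback f.2, isDNumerable_pullback hσ hE f.2⟩
  refine ⟨Quotient.lift (fun f => Quotient.mk _ ⟨(universalBundle σ).pullback f.1, hpb f⟩)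
    fun f g hfg => Quotient.sound (iso_pullback_of_homotopic hE f.2 g.2 hfg),
    ⟨?_, ?_⟩, fun f => ⟨hpb f, rfl⟩⟩
  · intro a b hab
    induction a using Quotient.inductionOn with | _ f
    induction b using Quotient.inductionOn with | _ g
    obtain ⟨e, he, he_eq, he_over⟩ := Quotient.exact hab
    -- On the pull-back along `f`, the projection to `ESph G` covers `f`, and the isomorphism
    -- followed by the projection of the other pull-back covers `g`.
    refine Quotient.sound (homotopic_of_covered (hpb f).1
      (φ₀ := fun p => p.1.2) (φ₁ := fun p => (e p).1.2) HSpaceOver.dSmooth_pullback_snd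
      (HSpaceOver.dSmooth_pullback_snd.comp he.smooth) (fun _ _ => rfl) (fun h p => ?_)
      (fun p => p.2.symm) fun p => ?_)
    · rw [he_eq]
      rfl
    · exact (e p).2.symm.trans (congrArg g.1 (he_over p))
  · intro b
    induction b using Quotient.inductionOn with | _ P
    obtain ⟨φ, hφ, h_eq⟩ := exists_equivariant_eSph P.2.1 P.2.2
    obtain ⟨f, hf, h_over⟩ := exists_classifying_map P.2.1 hφ h_eq
    have hiso : P.1.Iso ((universalBundle σ).pullback f) :=
      P.2.1.iso_pullback hE hf hφ h_eq h_over
    exact ⟨Quotient.mk _ ⟨f, hf⟩, (Quotient.sound hiso).symm⟩
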